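/- Let $n$ and $m\ge 1$ be integers, let $0<\alpha<1$ and $\theta\in(0,1]$, and let $E\subset\mathbb R^n$ be non-empty and compact. Write $|U|$ for the diameter of a set $U$. For a bounded non-empty $F\subset\mathbb R^m$, the lower $\theta$-intermediate dimension $\underline{\dim}_\theta F$ is the infimum of all $s\ge 0$ such that for all $\varepsilon>0$ and $r_0>0$ there are $0<r\le r_0$ and a cover $\{U_i\}$ of $F$ with $r^{1/\theta}\le |U_i|\le r$ for all $i$ and $\sum_i|U_i|^s\le\varepsilon$. The upper $\theta$-intermediate dimension $\overline{\dim}_\theta F$ is the infimum of all $s\ge0$ such that for all $\varepsilon>0$ there is $r_0>0$ such that for all $0<r\le r_0$ there is a cover of this kind. For $t>0$, $0\le s\le t$ and $0<r<1$ let $\phi_{r,\theta}^{s,t}:\mathbb R^n\to\mathbb R$ be equal to $1$ where $|x|<r$, to $(r/|x|)^s$ where $r\le|x|<r^\theta$, and to $r^{\theta(t-s)+s}/|x|^t$ where $r^\theta\le|x|$, and let $$C_{r,\theta}^{s,t}(E)=\Bigl(\inf_\mu\iint\phi_{r,\theta}^{s,t}(x-y)\,d\mu(x)\,d\mu(y)\Bigr)^{-1},$$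 where $\mu$ runs over the Borel probability measures supported on $E$. The lower and the upper intermediate dimension profile of $E$ at parameter $t$, $\underline{\dim}_\theta^{t}E$ and $\overline{\dim}_\theta^{t}E$, are the unique $s\in[0,t]$ with $$\liminf_{r\to0}\frac{\log C_{r,\theta}^{s,t}(E)}{-\log r}=s\qquad\text{and}\qquad \limsup_{r\to0}\frac{\log C_{r,\theta}^{s,t}(E)}{-\log r}=s$$ respectively. Let $B_\alpha=(B_{\alpha,1},\dots,B_{\alpha,m}):\mathbb R^n\to\mathbb R^m$ be index-$\alpha$ fractional Brownian motion: the components $B_{\alpha,i}$ are independent Gaussian processes indexed by $\mathbb R^n$ which almost surely satisfy $B_{\alpha,i}(0)=0$ and have continuous paths, and for all $x,y\in\mathbb R^n$ the increment $B_{\alpha,i}(x)-B_{\alpha,i}(y)$ is normally distributed with mean $0$ and variance $|x-y|^{2\alpha}$. Then there is exactly one $s\in[0,m\alpha]$ as in the definition of $\underline{\dim}_\theta^{m\alpha}E$ and exactly one as in that of $\overline{\dim}_\theta^{m\alpha}E$ and, almost surely, $$\underline{\dim}_\theta B_\alpha(E)=\frac1\alpha\,\underline{\dim}_\theta^{m\alpha}E\qquad\text{and}\qquad\overline{\dim}_\theta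 B_\alpha(E)=\frac1\alpha\,\overline{\dim}_\theta^{m\alpha}E .$$ -/

import Mathlib

open MeasureTheory ProbabilityTheory Filter Topology
open scoped ENNReal NNReal

/-- `𝒰` is a cover of `F` by sets with diameters in `[r ^ (1 / θ), r]` whose `s`-th powers sum to at
most `ε`. For `r > 0` all the diameters are bounded below by a positive number, so a cover for which
the sum is finite is a finite one. (An unbounded set has `Metric.diam` equal to `0` and is therefore
not admissible.) -/
def IsAdmissibleCover {X : Type*} [MetricSpace X] (θ s r ε : ℝ) (F : Set X)
    (𝒰 : Finset (Set X)) : Prop :=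
  (F ⊆ ⋃ U ∈ 𝒰, U) ∧
  (∀ U ∈ 𝒰, r ^ (1 / θ) ≤ Metric.diam U ∧ Metric.diam U ≤ r) ∧
  ∑ U ∈ 𝒰, Metric.diam U ^ s ≤ ε

/-- The lower `θ`-intermediate dimension of `F`. -/
noncomputable def lowerIntermediateDim {X : Type*} [MetricSpace X] (θ : ℝ) (F : Set X) : ℝ :=
  sInf {s : ℝ | 0 ≤ s ∧ ∀ ε : ℝ, 0 < ε → ∀ r₀ : ℝ, 0 < r₀ →
    ∃ r : ℝ, 0 < r ∧ r ≤ r₀ ∧ ∃ 𝒰 : Finset (Set X), IsAdmissibleCover θ s r ε F 𝒰}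

/-- The upper `θ`-intermediate dimension of `F`. -/
noncomputable def upperIntermediateDim {X : Type*} [MetricSpace X] (θ : ℝ) (F : Set X) : ℝ :=
  sInf {s : ℝ | 0 ≤ s ∧ ∀ ε : ℝ, 0 < ε → ∃ r₀ : ℝ, 0 < r₀ ∧
    ∀ r : ℝ, 0 < r → r ≤ r₀ → ∃ 𝒰 : Finset (Set X), IsAdmissibleCover θ s r ε F 𝒰}

/-- The kernel `φ_{r,θ}^{s,t}`, for `0 < r < 1`, `0 < θ ≤ 1` and `0 ≤ s ≤ t`. -/
noncomputable def profileKernel {n : ℕ} (r θ s t : ℝ) (x : EuclideanSpace ℝ (Fin n)) : ℝ :=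
  if ‖x‖ < r then 1
  else if ‖x‖ < r ^ θ then (r / ‖x‖) ^ s
  else r ^ (θ * (t - s) + s) / ‖x‖ ^ t

/-- The energy `∬ φ_{r,θ}^{s,t}(x - y) dμ(x) dμ(y)` of a measure (the kernel is nonnegative). -/
noncomputable def profileEnergy {n : ℕ} (r θ s t : ℝ) (μ : Measure (EuclideanSpace ℝ (Fin n))) :
    ℝ≥0∞ :=
  ∫⁻ x, ∫⁻ y, ENNReal.ofReal (profileKernel r θ s t (x - y)) ∂μ ∂μ

/-- The capacity `C_{r,θ}^{s,t}(E)`: the reciprocal of the infimum of the energies of the Borel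
probability measures supported on the closure of `E` (on `E` itself if `E` is compact). -/
noncomputable def profileCapacity {n : ℕ} (r θ s t : ℝ) (E : Set (EuclideanSpace ℝ (Fin n))) :
    ℝ≥0∞ :=
  (⨅ (μ : ProbabilityMeasure (EuclideanSpace ℝ (Fin n)))
      (_ : (μ : Measure (EuclideanSpace ℝ (Fin n))) (closure E)ᶜ = 0),
    profileEnergy r θ s t (μ : Measure (EuclideanSpace ℝ (Fin n))))⁻¹

/-- The ratio `log C_{r,θ}^{s,t}(E) / (- log r)`. -/
noncomputable def capacityRatio {n : ℕ} (θ s t : ℝ) (E : Set (EuclideanSpace ℝ (Fin n)))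
    (r : ℝ) : ℝ :=
  Real.log (profileCapacity r θ s t E).toReal / (-Real.log r)

/-- `s ∈ [0, t]` is a fixed point of `s ↦ liminf_{r → 0+} log C_{r,θ}^{s,t}(E) / (- log r)`.
The lower limit is taken in the extended reals. -/
def IsLowerProfile {n : ℕ} (θ t : ℝ) (E : Set (EuclideanSpace ℝ (Fin n))) (s : ℝ) : Prop :=
  0 ≤ s ∧ s ≤ t ∧
    liminf (fun r : ℝ => (capacityRatio θ s t E r : EReal)) (𝓝[>] (0 : ℝ)) = (s : EReal)

/-- `s ∈ [0, t]` is a fixed point of `s ↦ limsup_{r → 0+} log C_{r,θ}^{s,t}(E) / (- log r)`.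
The upper limit is taken in the extended reals. -/
def IsUpperProfile {n : ℕ} (θ t : ℝ) (E : Set (EuclideanSpace ℝ (Fin n))) (s : ℝ) : Prop :=
  0 ≤ s ∧ s ≤ t ∧
    limsup (fun r : ℝ => (capacityRatio θ s t E r : EReal)) (𝓝[>] (0 : ℝ)) = (s : EReal)

/-- The lower intermediate dimension profile of `E` at parameter `t`: the `s` with
`IsLowerProfile θ t E s`. -/
noncomputable def lowerDimProfile {n : ℕ} (θ t : ℝ) (E : Set (EuclideanSpace ℝ (Fin n))) : ℝ :=
  Classical.epsilon fun s : ℝ => IsLowerProfile θ t E s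

/-- The upper intermediate dimension profile of `E` at parameter `t`: the `s` with
`IsUpperProfile θ t E s`. -/
noncomputable def upperDimProfile {n : ℕ} (θ t : ℝ) (E : Set (EuclideanSpace ℝ (Fin n))) : ℝ :=
  Classical.epsilon fun s : ℝ => IsUpperProfile θ t E s

/-- `B` is an index-`α` fractional Brownian motion `ℝⁿ → ℝᵐ` on `(Ω, P)`: its `m` components are
independent Gaussian processes, which start at `0` and have continuous paths almost surely, and
whose increments between `x` and `y` are normal with mean `0` and variance `|x - y| ^ (2 α)`. -/
structure IsFractionalBrownianMotion {Ω : Type*} [MeasurableSpace Ω] (P : Measure Ω) {n m : ℕ}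
    (α : ℝ) (B : EuclideanSpace ℝ (Fin n) → Ω → EuclideanSpace ℝ (Fin m)) : Prop where
  measurable : ∀ x, Measurable (B x)
  zero : ∀ᵐ ω ∂P, B 0 ω = 0
  continuous : ∀ᵐ ω ∂P, Continuous fun x => B x ω
  gaussian : ∀ i, IsGaussianProcess (fun x ω => B x ω i) P
  increments : ∀ i x y,
    HasLaw (fun ω => B x ω i - B y ω i) (gaussianReal 0 (‖x - y‖₊ ^ (2 * α))) P
  indep : iIndepFun (fun (i : Fin m) (ω : Ω) (x : EuclideanSpace ℝ (Fin n)) => B x ω i) P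

/-!
The kernel of the profiles is a product of two truncated powers of the distance, one for each of
the scales `r` and `r ^ θ` (`profileKernel_eq_radialKernel`). When `s` increases to `s'`, the
kernel decreases by a factor between `r ^ ((1 - θ) * (s' - s))` and `1`; hence the lower and upper
limits of `capacityRatio θ s t E` are increasing in `s` with slope at most `1 - θ < 1`. As they
map `[0, t]` to itself, they have exactly one fixed point
(`IsLimitFunctional.existsUnique_fixedPoint`).

With `t = m * α`, the sums `∑ |U| ^ (s / α)` over covers of `B(E)` by sets with diameters in
`[r ^ α, r ^ (θ * α)]` are compared with `r ^ s` times the capacity, up to factors `r ^ (± η)`.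

*All covers.* By the Cauchy–Schwarz inequality, the sum over any cover is at least `r ^ s` divided
by the energy of the image of a measure on `E`, for a kernel on `ℝᵐ` truncated at the distance
`r ^ (θ * α)` (`IsAdmissibleCover.rpow_le_mul_lintegral_truncatedKernel`). The increments of `B` have
independent centred normal coordinates with standard deviation `|x - y| ^ α`, so that the
expectation of this kernel is at most a constant times the kernel of the profile
(`IsFractionalBrownianMotion.lintegral_truncatedKernel_le`). Applied to near-minimizers of the
energy at the scales `2 ^ (-k)`, a Borel–Cantelli argument yields a lower bound for the sums,
simultaneously for all small `r`
(`IsFractionalBrownianMotion.ae_eventually_rpow_mul_profileCapacity_le`).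

*Suitable covers.* For each `r` there is a probability measure on `E` whose potential is on all of
`E` at least half the minimal energy (`exists_half_le_profilePotential`). A pigeonhole argument
over dyadic radii and Vitali's covering lemma turn it into a cover of `E` by balls that is
efficient with respect to the kernel (`exists_finset_closedBall_cover`). By a Kolmogorov criterion
(`ae_exists_holder_of_hasLaw`) the paths are almost surely Hölder of every order below `α`; the
images of the balls, subdivided where they are too large, form a cover whose sum is bounded by the
capacity (`eventually_exists_isAdmissibleCover_image`).

At the fixed point the capacity is of the order `r ^ (-s)`, for all or for arbitrarily small `r`,
so that the two bounds show that the dimensions of `B(E)` are the fixed points divided by `α`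
(`lowerIntermediateDim_eq_of_bounds`, `upperIntermediateDim_eq_of_bounds`).
-/

/-! ### The kernel and the capacities -/

/-- The kernel of the profiles as a function of the distance `u`, written without case distinction
as a product of two truncated powers, one for each of the scales `r` and `r ^ θ`. -/
noncomputable def radialKernel (r θ s t u : ℝ) : ℝ :=
  (r / max r u) ^ s * (r ^ θ / max (r ^ θ) u) ^ (t - s)

theorem div_max_pos {a : ℝ} (ha : 0 < a) (u : ℝ) : 0 < a / max a u :=
  div_pos ha (lt_max_of_lt_left ha)

theorem div_max_le_one {a : ℝ} (ha : 0 < a) (u : ℝ) : a / max a u ≤ 1 :=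
  (div_le_one (lt_max_of_lt_left ha)).2 (le_max_left _ _)

theorem div_max_antitone {a u v : ℝ} (ha : 0 < a) (h : u ≤ v) : a / max a v ≤ a / max a u :=
  div_le_div_of_nonneg_left ha.le (lt_max_of_lt_left ha) (max_le_max_left _ h)

theorem div_max_monotone {a b u : ℝ} (ha : 0 < a) (h : a ≤ b) : a / max a u ≤ b / max b u := by
  rw [div_le_div_iff₀ (lt_max_of_lt_left ha) (lt_max_of_lt_left (ha.trans_le h))]
  rcases le_total b u with hb | hb
  · rw [max_eq_right hb, max_eq_right (h.trans hb)]
    exact mul_le_mul_of_nonneg_right h (ha.le.trans (h.trans hb))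
  · rw [max_eq_left hb, mul_comm]
    exact mul_le_mul_of_nonneg_left (le_max_left _ _) (ha.le.trans h)

theorem div_max_le_mul {a b c u : ℝ} (ha : 0 < a) (hb : 0 < b) (hab : a ≤ b) (hc : b ≤ c * a) :
    b / max b u ≤ c * (a / max a u) := by
  rw [← mul_div_assoc]
  exact div_le_div₀ (hb.le.trans hc) hc (lt_max_of_lt_left ha) (max_le_max_right _ hab)

theorem div_max_mul_le {a c u : ℝ} (ha : 0 < a) (hc : 1 ≤ c) :
    a / max a u ≤ c * (a / max a (c * u)) := by
  have hc0 : 0 < c := by linarith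
  rw [← mul_div_assoc, div_le_div_iff₀ (lt_max_of_lt_left ha) (lt_max_of_lt_left ha)]
  have : max a (c * u) ≤ c * max a u :=
    max_le ((le_max_left a u).trans (le_mul_of_one_le_left (ha.le.trans (le_max_left _ _)) hc))
      (mul_le_mul_of_nonneg_left (le_max_right _ _) hc0.le)
  nlinarith

theorem radialKernel_pos {r θ s t : ℝ} (hr : 0 < r) (u : ℝ) : 0 < radialKernel r θ s t u :=
  mul_pos (Real.rpow_pos_of_pos (div_max_pos hr u) _)
    (Real.rpow_pos_of_pos (div_max_pos (Real.rpow_pos_of_pos hr _) u) _)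

theorem radialKernel_le_one {r θ s t : ℝ} (hr : 0 < r) (hs : 0 ≤ s) (hst : s ≤ t) (u : ℝ) :
    radialKernel r θ s t u ≤ 1 :=
  mul_le_one₀ (Real.rpow_le_one (div_max_pos hr u).le (div_max_le_one hr u) hs)
    (Real.rpow_nonneg (div_max_pos (Real.rpow_pos_of_pos hr _) u).le _)
    (Real.rpow_le_one (div_max_pos (Real.rpow_pos_of_pos hr _) u).le
      (div_max_le_one (Real.rpow_pos_of_pos hr _) u) (sub_nonneg.2 hst))

theorem radialKernel_antitone {r θ s t u v : ℝ} (hr : 0 < r) (hs : 0 ≤ s) (hst : s ≤ t)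
    (h : u ≤ v) : radialKernel r θ s t v ≤ radialKernel r θ s t u := by
  have hrθ : 0 < r ^ θ := Real.rpow_pos_of_pos hr _
  exact mul_le_mul
    (Real.rpow_le_rpow (div_max_pos hr _).le (div_max_antitone hr h) hs)
    (Real.rpow_le_rpow (div_max_pos hrθ _).le (div_max_antitone hrθ h) (sub_nonneg.2 hst))
    (Real.rpow_nonneg (div_max_pos hrθ _).le _) (Real.rpow_nonneg (div_max_pos hr _).le _)

theorem mul_rpow_mul_mul_rpow {c a b s t : ℝ} (hc : 0 < c) (ha : 0 < a) (hb : 0 < b) :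
    (c * a) ^ s * (c * b) ^ (t - s) = c ^ t * (a ^ s * b ^ (t - s)) := by
  rw [Real.mul_rpow hc.le ha.le, Real.mul_rpow hc.le hb.le,
    show c ^ t = c ^ s * c ^ (t - s) by rw [← Real.rpow_add hc]; ring_nf]
  ring

theorem radialKernel_le_mul {r θ s t u c : ℝ} (hr : 0 < r) (hs : 0 ≤ s) (hst : s ≤ t)
    (hc : 1 ≤ c) : radialKernel r θ s t u ≤ c ^ t * radialKernel r θ s t (c * u) := by
  have hrθ : 0 < r ^ θ := Real.rpow_pos_of_pos hr _
  have hc0 : 0 < c := by linarith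
  rw [radialKernel, radialKernel,
    ← mul_rpow_mul_mul_rpow hc0 (div_max_pos hr _) (div_max_pos hrθ _)]
  exact mul_le_mul
    (Real.rpow_le_rpow (div_max_pos hr _).le (div_max_mul_le hr hc) hs)
    (Real.rpow_le_rpow (div_max_pos hrθ _).le (div_max_mul_le hrθ hc) (sub_nonneg.2 hst))
    (Real.rpow_nonneg (div_max_pos hrθ _).le _)
    (Real.rpow_nonneg (mul_nonneg hc0.le (div_max_pos hr _).le) _)

theorem radialKernel_le_of_le_mul {r b θ s t u c : ℝ} (hr : 0 < r) (hθ₀ : 0 < θ) (hθ₁ : θ ≤ 1)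
    (hs : 0 ≤ s) (hst : s ≤ t) (hrb : r ≤ b) (hc : 1 ≤ c) (hbr : b ≤ c * r) :
    radialKernel b θ s t u ≤ c ^ t * radialKernel r θ s t u := by
  have hb : 0 < b := hr.trans_le hrb
  have hrθ : 0 < r ^ θ := Real.rpow_pos_of_pos hr _
  have hbθ : 0 < b ^ θ := Real.rpow_pos_of_pos hb _
  have hc0 : 0 < c := by linarith
  have h2 : b ^ θ ≤ c * r ^ θ := by
    calc b ^ θ ≤ (c * r) ^ θ := Real.rpow_le_rpow hb.le hbr hθ₀.le
      _ = c ^ θ * r ^ θ := Real.mul_rpow hc0.le hr.le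
      _ ≤ c ^ (1 : ℝ) * r ^ θ :=
        mul_le_mul_of_nonneg_right (Real.rpow_le_rpow_of_exponent_le hc hθ₁) hrθ.le
      _ = c * r ^ θ := by rw [Real.rpow_one]
  rw [radialKernel, radialKernel,
    ← mul_rpow_mul_mul_rpow hc0 (div_max_pos hr _) (div_max_pos hrθ _)]
  exact mul_le_mul
    (Real.rpow_le_rpow (div_max_pos hb _).le (div_max_le_mul hr hb hrb hbr) hs)
    (Real.rpow_le_rpow (div_max_pos hbθ _).le
      (div_max_le_mul hrθ hbθ (Real.rpow_le_rpow hr.le hrb hθ₀.le) h2) (sub_nonneg.2 hst))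
    (Real.rpow_nonneg (div_max_pos hbθ _).le _)
    (Real.rpow_nonneg (mul_nonneg hc0.le (div_max_pos hr _).le) _)

theorem radialKernel_eq_mul_div_rpow {r θ s s' t u : ℝ} (hr : 0 < r) :
    radialKernel r θ s' t u = radialKernel r θ s t u *
      ((r / max r u) / (r ^ θ / max (r ^ θ) u)) ^ (s' - s) := by
  have h1 := div_max_pos hr u
  have h2 := div_max_pos (Real.rpow_pos_of_pos hr θ) u
  rw [radialKernel, radialKernel, Real.div_rpow h1.le h2.le,
    show s' = s + (s' - s) by ring, Real.rpow_add h1,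
      show t - (s + (s' - s)) = (t - s) - (s' - s) by ring,
    Real.rpow_sub h2]
  ring_nf

theorem le_rpow_self_of_le_one {r θ : ℝ} (hr : 0 < r) (hr1 : r ≤ 1) (hθ₁ : θ ≤ 1) : r ≤ r ^ θ := by
  simpa using Real.rpow_le_rpow_of_exponent_ge hr hr1 hθ₁

theorem radialKernel_antitone_exponent {r θ s s' t u : ℝ} (hr : 0 < r) (hr1 : r ≤ 1) (hθ₁ : θ ≤ 1)
    (hss : s ≤ s') : radialKernel r θ s' t u ≤ radialKernel r θ s t u := by
  have h1 := div_max_pos hr u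
  have h2 := div_max_pos (Real.rpow_pos_of_pos hr θ) u
  rw [radialKernel_eq_mul_div_rpow hr (s := s)]
  refine mul_le_of_le_one_right (radialKernel_pos hr u).le
    (Real.rpow_le_one (div_pos h1 h2).le ?_ (sub_nonneg.2 hss))
  rw [div_le_one h2]
  exact div_max_monotone hr (le_rpow_self_of_le_one hr hr1 hθ₁)

theorem radialKernel_le_rpow_mul {r θ s s' t u : ℝ} (hr : 0 < r) (hr1 : r ≤ 1)
    (hθ₁ : θ ≤ 1) (hss : s ≤ s') :
    radialKernel r θ s t u ≤ r ^ (-((1 - θ) * (s' - s))) * radialKernel r θ s' t u := by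
  have h1 := div_max_pos hr u
  have hrθ := Real.rpow_pos_of_pos hr θ
  have h2 := div_max_pos hrθ u
  have hq : r ^ (1 - θ) ≤ (r / max r u) / (r ^ θ / max (r ^ θ) u) := by
    rw [Real.rpow_sub hr, Real.rpow_one, div_div_div_eq, div_le_div_iff₀ hrθ (by positivity)]
    have : max r u ≤ max (r ^ θ) u := max_le_max_right _ (le_rpow_self_of_le_one hr hr1 hθ₁)
    calc r * (max r u * r ^ θ) = (r * r ^ θ) * max r u := by ring
      _ ≤ (r * r ^ θ) * max (r ^ θ) u := mul_le_mul_of_nonneg_left this (by positivity)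
      _ = _ := by ring
  rw [radialKernel_eq_mul_div_rpow hr (s := s) (s' := s'), mul_left_comm, Real.rpow_neg hr.le,
    Real.rpow_mul hr.le, ← Real.inv_rpow (by positivity),
      ← Real.mul_rpow (by positivity) (div_pos h1 h2).le]
  refine le_mul_of_one_le_right (radialKernel_pos hr u).le
    (Real.one_le_rpow ?_ (sub_nonneg.2 hss))
  rw [inv_mul_eq_div, one_le_div (by positivity)]
  exact hq

theorem continuous_radialKernel {r θ s t : ℝ} (hr : 0 < r) :
    Continuous fun u => radialKernel r θ s t u := by
  have hrθ := Real.rpow_pos_of_pos hr θ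
  unfold radialKernel
  refine Continuous.mul ?_ ?_
  · refine Continuous.rpow_const ?_ fun u => Or.inl (div_max_pos hr u).ne'
    exact continuous_const.div (by fun_prop) fun u => (lt_max_of_lt_left hr).ne'
  · refine Continuous.rpow_const ?_ fun u => Or.inl (div_max_pos hrθ u).ne'
    exact continuous_const.div (by fun_prop) fun u => (lt_max_of_lt_left hrθ).ne'

theorem profileKernel_eq_radialKernel {n : ℕ} {r θ s t : ℝ} (hr : 0 < r) (hr1 : r ≤ 1)
    (hθ₁ : θ ≤ 1) (x : EuclideanSpace ℝ (Fin n)) :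
    profileKernel r θ s t x = radialKernel r θ s t ‖x‖ := by
  have hle := le_rpow_self_of_le_one hr hr1 hθ₁
  have hrθ := Real.rpow_pos_of_pos hr θ
  unfold profileKernel radialKernel
  split_ifs with h1 h2
  · rw [max_eq_left h1.le, max_eq_left (h1.le.trans hle), div_self hr.ne', div_self hrθ.ne']
    simp
  · rw [max_eq_right (not_lt.1 h1), max_eq_left h2.le, div_self hrθ.ne']
    simp
  · have hx : 0 < ‖x‖ := hr.trans_le (not_lt.1 h1)
    rw [max_eq_right (not_lt.1 h1), max_eq_right (not_lt.1 h2), Real.div_rpow hr.le hx.le,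
      Real.div_rpow hrθ.le hx.le, div_mul_div_comm, ← Real.rpow_mul hr.le, ← Real.rpow_add hr,
      ← Real.rpow_add hx]
    ring_nf

section Capacity

variable {n : ℕ} {E : Set (EuclideanSpace ℝ (Fin n))} {r θ s t : ℝ}

theorem measurable_profileKernel (hr : 0 < r) (hr1 : r ≤ 1) (hθ₁ : θ ≤ 1) :
    Measurable (profileKernel (n := n) r θ s t) := by
  rw [funext (profileKernel_eq_radialKernel hr hr1 hθ₁)]
  exact ((continuous_radialKernel hr).comp continuous_norm).measurable

/-- A comparison of two kernels yields the reverse comparison of the capacities. -/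
theorem profileCapacity_le_mul {r' s' t' K : ℝ} (hK : 0 < K)
    (h : ∀ x ∈ Set.image2 (· - ·) (closure E) (closure E),
      profileKernel r θ s t x ≤ K * profileKernel r' θ s' t' x) :
    profileCapacity r' θ s' t' E ≤ ENNReal.ofReal K * profileCapacity r θ s t E := by
  have hK0 : ENNReal.ofReal K ≠ 0 := by simpa using hK
  have key : (ENNReal.ofReal K)⁻¹ * (⨅ (μ : ProbabilityMeasure (EuclideanSpace ℝ (Fin n)))
      (_ : (μ : Measure (EuclideanSpace ℝ (Fin n))) (closure E)ᶜ = 0),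
      profileEnergy r θ s t (μ : Measure (EuclideanSpace ℝ (Fin n)))) ≤
    ⨅ (μ : ProbabilityMeasure (EuclideanSpace ℝ (Fin n)))
      (_ : (μ : Measure (EuclideanSpace ℝ (Fin n))) (closure E)ᶜ = 0),
      profileEnergy r' θ s' t' (μ : Measure (EuclideanSpace ℝ (Fin n))) := by
    refine le_iInf₂ fun μ hμ => ?_
    rw [← ENNReal.div_eq_inv_mul]
    refine ENNReal.div_le_of_le_mul' ((iInf₂_le μ hμ).trans ?_)
    have hae : ∀ᵐ x ∂(μ : Measure (EuclideanSpace ℝ (Fin n))), x ∈ closure E :=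
      measure_eq_zero_iff_ae_notMem.1 hμ |>.mono fun x hx => by simpa using hx
    rw [profileEnergy, profileEnergy, ← lintegral_const_mul' _ _ ENNReal.ofReal_ne_top]
    refine lintegral_mono_ae (hae.mono fun x hx => ?_)
    rw [← lintegral_const_mul' _ _ ENNReal.ofReal_ne_top]
    refine lintegral_mono_ae (hae.mono fun y hy => ?_)
    rw [← ENNReal.ofReal_mul hK.le]
    exact ENNReal.ofReal_le_ofReal (h _ ⟨x, hx, y, hy, rfl⟩)
  rw [profileCapacity, profileCapacity, ENNReal.inv_le_iff_inv_le,
    ENNReal.mul_inv (Or.inl hK0) (Or.inl ENNReal.ofReal_ne_top), inv_inv]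
  exact key

theorem profileKernel_le_one (hr : 0 < r) (hr1 : r ≤ 1) (hθ₁ : θ ≤ 1) (hs : 0 ≤ s) (hst : s ≤ t)
    (x : EuclideanSpace ℝ (Fin n)) : profileKernel r θ s t x ≤ 1 := by
  rw [profileKernel_eq_radialKernel hr hr1 hθ₁]
  exact radialKernel_le_one hr hs hst _

theorem one_le_profileCapacity (hne : E.Nonempty) (hr : 0 < r) (hr1 : r ≤ 1) (hθ₁ : θ ≤ 1)
    (hs : 0 ≤ s) (hst : s ≤ t) : 1 ≤ profileCapacity r θ s t E := by
  obtain ⟨x, hx⟩ := hne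
  rw [profileCapacity, ENNReal.le_inv_iff_le_inv, inv_one]
  refine (iInf₂_le (⟨Measure.dirac x, inferInstance⟩ : ProbabilityMeasure _) ?_).trans ?_
  · simp [subset_closure hx]
  · simp only [ProbabilityMeasure.coe_mk, profileEnergy]
    calc _ ≤ ∫⁻ _ : EuclideanSpace ℝ (Fin n), ∫⁻ _ : EuclideanSpace ℝ (Fin n), 1
          ∂(Measure.dirac x) ∂(Measure.dirac x) := by
          refine lintegral_mono fun y => lintegral_mono fun z => ?_
          exact ENNReal.ofReal_le_one.2 (profileKernel_le_one hr hr1 hθ₁ hs hst _)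
      _ = 1 := by simp

/-- The capacity of a bounded set is at most of order `r ^ (-t)`. -/
theorem profileCapacity_self_le {D : ℝ} (hD : ∀ x ∈ closure E, ∀ y ∈ closure E, ‖x - y‖ ≤ D)
    (hD1 : 1 ≤ D) (ht : 0 ≤ t) (hr : 0 < r) (hr1 : r ≤ 1) (hθ₁ : θ ≤ 1) :
    profileCapacity r θ t t E ≤ ENNReal.ofReal ((D / r) ^ t) := by
  have hDr : 0 < D / r := by positivity
  rw [profileCapacity, ENNReal.inv_le_iff_inv_le, ← ENNReal.ofReal_inv_of_pos (by positivity)]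
  refine le_iInf₂ fun μ hμ => ?_
  have hae : ∀ᵐ x ∂(μ : Measure (EuclideanSpace ℝ (Fin n))), x ∈ closure E :=
    measure_eq_zero_iff_ae_notMem.1 hμ |>.mono fun x hx => by simpa using hx
  calc ENNReal.ofReal ((D / r) ^ t)⁻¹ = ∫⁻ _ : EuclideanSpace ℝ (Fin n),
        ∫⁻ _ : EuclideanSpace ℝ (Fin n), ENNReal.ofReal ((D / r) ^ t)⁻¹ ∂μ ∂μ := by simp
    _ ≤ _ := by
      refine lintegral_mono_ae (hae.mono fun x hx => lintegral_mono_ae (hae.mono fun y hy =>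
        ENNReal.ofReal_le_ofReal ?_))
      rw [profileKernel_eq_radialKernel hr hr1 hθ₁, radialKernel, sub_self, Real.rpow_zero, mul_one,
        ← Real.inv_rpow hDr.le, inv_div]
      refine Real.rpow_le_rpow (by positivity) ?_ ht
      exact div_le_div_of_nonneg_left hr.le (lt_max_of_lt_left hr)
        (max_le (hr1.trans hD1) (hD x hx y hy))

theorem profileCapacity_mono_exponent {s' : ℝ} (hr : 0 < r) (hr1 : r ≤ 1) (hθ₁ : θ ≤ 1)
    (hss : s ≤ s') : profileCapacity r θ s t E ≤ profileCapacity r θ s' t E := by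
  have := profileCapacity_le_mul (E := E) (r := r) (θ := θ) (s := s') (t := t) (r' := r) (s' := s)
    (t' := t) one_pos fun x _ => by
      rw [one_mul, profileKernel_eq_radialKernel hr hr1 hθ₁,
        profileKernel_eq_radialKernel hr hr1 hθ₁]
      exact radialKernel_antitone_exponent hr hr1 hθ₁ hss
  simpa using this

theorem profileCapacity_le_rpow_mul {s' : ℝ} (hr : 0 < r) (hr1 : r ≤ 1) (hθ₁ : θ ≤ 1)
    (hss : s ≤ s') : profileCapacity r θ s' t E ≤
      ENNReal.ofReal (r ^ (-((1 - θ) * (s' - s)))) * profileCapacity r θ s t E :=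
  profileCapacity_le_mul (Real.rpow_pos_of_pos hr _) fun x _ => by
    rw [profileKernel_eq_radialKernel hr hr1 hθ₁, profileKernel_eq_radialKernel hr hr1 hθ₁]
    exact radialKernel_le_rpow_mul hr hr1 hθ₁ hss

theorem profileCapacity_le_two_rpow_mul {b : ℝ} (hr : 0 < r) (hθ₀ : 0 < θ) (hθ₁ : θ ≤ 1)
    (hs : 0 ≤ s) (hst : s ≤ t) (hrb : r ≤ b) (hb1 : b ≤ 1) (hbr : b ≤ 2 * r) :
    profileCapacity r θ s t E ≤ ENNReal.ofReal (2 ^ t) * profileCapacity b θ s t E :=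
  profileCapacity_le_mul (by positivity) fun x _ => by
    rw [profileKernel_eq_radialKernel hr (hrb.trans hb1) hθ₁,
      profileKernel_eq_radialKernel (hr.trans_le hrb) hb1 hθ₁]
    exact radialKernel_le_of_le_mul hr hθ₀ hθ₁ hs hst hrb one_le_two hbr

theorem exists_one_le_norm_sub_le (hE : IsCompact E) :
    ∃ D : ℝ, 1 ≤ D ∧ ∀ x ∈ closure E, ∀ y ∈ closure E, ‖x - y‖ ≤ D :=
  ⟨max 1 (Metric.diam (closure E)), le_max_left _ _, fun x hx y hy =>
    (dist_eq_norm x y ▸ Metric.dist_le_diam_of_mem hE.closure.isBounded hx hy).trans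
      (le_max_right _ _)⟩

theorem profileCapacity_ne_top (hE : IsCompact E) (hr : 0 < r) (hr1 : r ≤ 1) (hθ₁ : θ ≤ 1)
    (hs : 0 ≤ s) (hst : s ≤ t) : profileCapacity r θ s t E ≠ ⊤ := by
  obtain ⟨D, hD1, hD⟩ := exists_one_le_norm_sub_le hE
  exact (((profileCapacity_mono_exponent hr hr1 hθ₁ hst).trans
    (profileCapacity_self_le hD hD1 (hs.trans hst) hr hr1 hθ₁)).trans_lt ENNReal.ofReal_lt_top).ne

/-- A probability measure on `E` whose energy is as close to the infimum as desired. -/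
theorem exists_profileEnergy_lt (hE : IsCompact E) {e : ℝ≥0∞}
    (he : (profileCapacity r θ s t E)⁻¹ < e) :
    ∃ μ : Measure (EuclideanSpace ℝ (Fin n)), IsProbabilityMeasure μ ∧ μ Eᶜ = 0 ∧
      profileEnergy r θ s t μ < e := by
  rw [profileCapacity, inv_inv] at he
  obtain ⟨μ, hμ⟩ := iInf_lt_iff.1 he
  obtain ⟨h0, h1⟩ := iInf_lt_iff.1 hμ
  rw [hE.isClosed.closure_eq] at h0
  exact ⟨μ, inferInstance, h0, h1⟩

theorem inv_profileCapacity_le_profileEnergy (hE : IsCompact E)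
    {μ : Measure (EuclideanSpace ℝ (Fin n))} [IsProbabilityMeasure μ] (hμ : μ Eᶜ = 0) :
    (profileCapacity r θ s t E)⁻¹ ≤ profileEnergy r θ s t μ := by
  rw [profileCapacity, inv_inv]
  exact iInf₂_le (⟨μ, inferInstance⟩ : ProbabilityMeasure _) (by rwa [hE.isClosed.closure_eq])

end Capacity

/-! ### Existence and uniqueness of the profiles -/

section Profile

variable {n : ℕ} {E : Set (EuclideanSpace ℝ (Fin n))} {r θ s t : ℝ}

theorem one_le_toReal_profileCapacity (hE : IsCompact E) (hne : E.Nonempty) (hr : 0 < r)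
    (hr1 : r ≤ 1) (hθ₁ : θ ≤ 1) (hs : 0 ≤ s) (hst : s ≤ t) :
    1 ≤ (profileCapacity r θ s t E).toReal := by
  simpa using ENNReal.toReal_mono (profileCapacity_ne_top hE hr hr1 hθ₁ hs hst)
    (one_le_profileCapacity hne hr hr1 hθ₁ hs hst)

theorem capacityRatio_nonneg (hE : IsCompact E) (hne : E.Nonempty) (hr : 0 < r)
    (hr1 : r < 1) (hθ₁ : θ ≤ 1) (hs : 0 ≤ s) (hst : s ≤ t) : 0 ≤ capacityRatio θ s t E r :=
  div_nonneg (Real.log_nonneg (one_le_toReal_profileCapacity hE hne hr hr1.le hθ₁ hs hst))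
    (neg_pos.2 (Real.log_neg hr hr1)).le

theorem capacityRatio_mono (hE : IsCompact E) (hne : E.Nonempty) {s' : ℝ} (hr : 0 < r)
    (hr1 : r < 1) (hθ₁ : θ ≤ 1) (hs : 0 ≤ s) (hss : s ≤ s') (hst : s' ≤ t) :
    capacityRatio θ s t E r ≤ capacityRatio θ s' t E r :=
  div_le_div_of_nonneg_right (Real.log_le_log
    (one_pos.trans_le (one_le_toReal_profileCapacity hE hne hr hr1.le hθ₁ hs (hss.trans hst)))
    (ENNReal.toReal_mono (profileCapacity_ne_top hE hr hr1.le hθ₁ (hs.trans hss) hst)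
      (profileCapacity_mono_exponent hr hr1.le hθ₁ hss)))
    (neg_pos.2 (Real.log_neg hr hr1)).le

theorem capacityRatio_le_add (hE : IsCompact E) (hne : E.Nonempty) {s' : ℝ} (hr : 0 < r)
    (hr1 : r < 1) (hθ₁ : θ ≤ 1) (hs : 0 ≤ s) (hss : s ≤ s') (hst : s' ≤ t) :
    capacityRatio θ s' t E r ≤ capacityRatio θ s t E r + (1 - θ) * (s' - s) := by
  have hl := neg_pos.2 (Real.log_neg hr hr1)
  have h1 := one_le_toReal_profileCapacity hE hne hr hr1.le hθ₁ hs (hss.trans hst)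
  have h2 := one_le_toReal_profileCapacity hE hne hr hr1.le hθ₁ (hs.trans hss) hst
  have hle : (profileCapacity r θ s' t E).toReal ≤
      r ^ (-((1 - θ) * (s' - s))) * (profileCapacity r θ s t E).toReal := by
    have := ENNReal.toReal_mono (ENNReal.mul_ne_top ENNReal.ofReal_ne_top
      (profileCapacity_ne_top hE hr hr1.le hθ₁ hs (hss.trans hst)))
      (profileCapacity_le_rpow_mul (E := E) (t := t) hr hr1.le hθ₁ hss)
    rwa [ENNReal.toReal_mul, ENNReal.toReal_ofReal (by positivity)] at this
  rw [capacityRatio, capacityRatio, div_le_iff₀ hl, add_mul, div_mul_cancel₀ _ hl.ne']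
  refine (Real.log_le_log (by linarith) hle).trans ?_
  rw [Real.log_mul (by positivity) (by positivity), Real.log_rpow hr]
  linarith

theorem eventually_nhdsGT_zero_lt {δ : ℝ} (hδ : 0 < δ) : ∀ᶠ r : ℝ in 𝓝[>] 0, 0 < r ∧ r < δ :=
  Ioo_mem_nhdsGT hδ

theorem eventually_capacityRatio_self_le (hE : IsCompact E) (hne : E.Nonempty) (hθ₁ : θ ≤ 1)
    (ht : 0 ≤ t) {δ : ℝ} (hδ : 0 < δ) : ∀ᶠ r in 𝓝[>] 0, capacityRatio θ t t E r ≤ t + δ := by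
  obtain ⟨D, hD1, hD⟩ := exists_one_le_norm_sub_le hE
  have hlim : ∀ᶠ r : ℝ in 𝓝[>] 0, Real.log r ≤ -(t * Real.log D / δ) :=
    Real.tendsto_log_nhdsGT_zero.eventually_le_atBot _
  filter_upwards [eventually_nhdsGT_zero_lt one_pos, hlim] with r ⟨hr, hr1⟩ hlog
  have hl := neg_pos.2 (Real.log_neg hr hr1)
  have h1 := one_le_toReal_profileCapacity hE hne hr hr1.le hθ₁ ht le_rfl
  have hle : (profileCapacity r θ t t E).toReal ≤ (D / r) ^ t := by
    have := ENNReal.toReal_mono ENNReal.ofReal_ne_top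
      (profileCapacity_self_le hD hD1 ht hr hr1.le hθ₁)
    rwa [ENNReal.toReal_ofReal (by positivity)] at this
  rw [capacityRatio, div_le_iff₀ hl]
  refine (Real.log_le_log (by linarith) hle).trans ?_
  rw [Real.log_rpow (by positivity), Real.log_div (by positivity) hr.ne']
  have : t * Real.log D ≤ -Real.log r * δ := by
    rw [← div_le_iff₀ hδ]; linarith
  linarith

theorem rpow_lt_of_lt_capacityRatio (hE : IsCompact E) (hne : E.Nonempty) {a : ℝ} (hr : 0 < r)
    (hr1 : r < 1) (hθ₁ : θ ≤ 1) (hs : 0 ≤ s) (hst : s ≤ t) (h : a < capacityRatio θ s t E r) :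
    r ^ (-a) < (profileCapacity r θ s t E).toReal := by
  have hl := neg_pos.2 (Real.log_neg hr hr1)
  have h1 := one_le_toReal_profileCapacity hE hne hr hr1.le hθ₁ hs hst
  rw [capacityRatio, lt_div_iff₀ hl] at h
  rw [← Real.log_lt_log_iff (by positivity) (by linarith), Real.log_rpow hr]
  linarith

theorem lt_rpow_of_capacityRatio_lt (hE : IsCompact E) (hne : E.Nonempty) {a : ℝ} (hr : 0 < r)
    (hr1 : r < 1) (hθ₁ : θ ≤ 1) (hs : 0 ≤ s) (hst : s ≤ t) (h : capacityRatio θ s t E r < a) :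
    (profileCapacity r θ s t E).toReal < r ^ (-a) := by
  have hl := neg_pos.2 (Real.log_neg hr hr1)
  have h1 := one_le_toReal_profileCapacity hE hne hr hr1.le hθ₁ hs hst
  rw [capacityRatio, div_lt_iff₀ hl] at h
  rw [← Real.log_lt_log_iff (by linarith) (by positivity), Real.log_rpow hr]
  linarith

/-- The common properties of `liminf` and `limsup` as `r → 0+`, as functionals on real functions
with values in the extended reals, on which the theory of both profiles rests. -/
structure IsLimitFunctional (L : (ℝ → ℝ) → EReal) : Prop where
  mono : ∀ f g : ℝ → ℝ, (∀ᶠ r in 𝓝[>] 0, f r ≤ g r) → L f ≤ L g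
  add_const : ∀ (f : ℝ → ℝ) (c : ℝ), L (fun r => f r + c) = L f + c
  const : ∀ c : ℝ, L (fun _ => c) = c

theorem continuous_add_coe_ereal (c : ℝ) : Continuous fun x : EReal => x + c :=
  continuous_iff_continuousAt.2 fun x =>
    (EReal.continuousAt_add (p := (x, (c : EReal))) (Or.inr (by simp)) (Or.inr (by simp))).comp
      (f := fun x : EReal => (x, (c : EReal))) (by fun_prop)

theorem monotone_add_coe_ereal (c : ℝ) : Monotone fun x : EReal => x + c :=
  fun _ _ h => by dsimp; gcongr

theorem isLimitFunctional_liminf :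
    IsLimitFunctional fun f => liminf (fun r => (f r : EReal)) (𝓝[>] (0 : ℝ)) where
  mono f g h := liminf_le_liminf (h.mono fun r hr => EReal.coe_le_coe_iff.2 hr)
  add_const f c := by
    have := (monotone_add_coe_ereal c).map_liminf_of_continuousAt (F := 𝓝[>] (0 : ℝ))
      (fun r => (f r : EReal)) (continuous_add_coe_ereal c).continuousAt
    simpa [Function.comp_def] using this.symm
  const c := by simp

theorem isLimitFunctional_limsup :
    IsLimitFunctional fun f => limsup (fun r => (f r : EReal)) (𝓝[>] (0 : ℝ)) where
  mono f g h := limsup_le_limsup (h.mono fun r hr => EReal.coe_le_coe_iff.2 hr)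
  add_const f c := by
    have := (monotone_add_coe_ereal c).map_limsup_of_continuousAt (F := 𝓝[>] (0 : ℝ))
      (fun r => (f r : EReal)) (continuous_add_coe_ereal c).continuousAt
    simpa [Function.comp_def] using this.symm
  const c := by simp

variable {L : (ℝ → ℝ) → EReal}

theorem IsLimitFunctional.capacityRatio_le_add (hL : IsLimitFunctional L) (hE : IsCompact E)
    (hne : E.Nonempty) {s' : ℝ} (hθ₁ : θ ≤ 1) (hs : 0 ≤ s) (hss : s ≤ s') (hst : s' ≤ t) :
    L (capacityRatio θ s' t E) ≤ L (capacityRatio θ s t E) + ((1 - θ) * (s' - s) : ℝ) := by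
  rw [← hL.add_const]
  refine hL.mono _ _ ?_
  filter_upwards [eventually_nhdsGT_zero_lt one_pos] with r ⟨hr, hr1⟩
  exact _root_.capacityRatio_le_add hE hne hr hr1 hθ₁ hs hss hst

/-- The function `s ↦ L (capacityRatio θ s t E)` is monotone and maps `[0, t]` to itself, so that it
has a fixed point; as it grows at most at the rate `1 - θ < 1`, there is only one. -/
theorem IsLimitFunctional.existsUnique_fixedPoint (hL : IsLimitFunctional L) (hE : IsCompact E)
    (hne : E.Nonempty) (hθ₀ : 0 < θ) (hθ₁ : θ ≤ 1) (ht : 0 ≤ t) :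
    ∃! s : ℝ, 0 ≤ s ∧ s ≤ t ∧ L (capacityRatio θ s t E) = s := by
  have hmono : ∀ s s', 0 ≤ s → s ≤ s' → s' ≤ t →
      L (capacityRatio θ s t E) ≤ L (capacityRatio θ s' t E) := fun s s' hs hss hst =>
    hL.mono _ _ <| (eventually_nhdsGT_zero_lt one_pos).mono fun r hr =>
      capacityRatio_mono hE hne hr.1 hr.2 hθ₁ hs hss hst
  have h0 : ∀ s, 0 ≤ s → s ≤ t → ((0 : ℝ) : EReal) ≤ L (capacityRatio θ s t E) := fun s hs hst => by
    rw [← hL.const]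
    exact hL.mono _ _ <| (eventually_nhdsGT_zero_lt one_pos).mono fun r hr =>
      capacityRatio_nonneg hE hne hr.1 hr.2 hθ₁ hs hst
  have htt : L (capacityRatio θ t t E) ≤ (t : EReal) := by
    have h1 : ∀ δ : ℝ, 0 < δ → L (capacityRatio θ t t E) ≤ ((t + δ : ℝ) : EReal) := fun δ hδ => by
      rw [← hL.const]
      exact hL.mono _ _ (eventually_capacityRatio_self_le hE hne hθ₁ ht hδ)
    refine EReal.le_of_forall_lt_iff_le.1 fun z hz => ?_
    have hz' : t < z := by exact_mod_cast hz
    simpa using h1 (z - t) (by linarith)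
  have ht' : ∀ s, 0 ≤ s → s ≤ t → L (capacityRatio θ s t E) ≤ (t : EReal) := fun s hs hst =>
    (hmono s t hs hst le_rfl).trans htt
  have hreal : ∀ s, 0 ≤ s → s ≤ t → ∃ g : ℝ, L (capacityRatio θ s t E) = g ∧ 0 ≤ g ∧ g ≤ t :=
    fun s hs hst => by
    have hg : (((L (capacityRatio θ s t E)).toReal : ℝ) : EReal) = L (capacityRatio θ s t E) :=
      EReal.coe_toReal (ne_top_of_le_ne_top (EReal.coe_ne_top t) (ht' s hs hst))
        (ne_bot_of_le_ne_bot (EReal.coe_ne_bot 0) (h0 s hs hst))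
    refine ⟨_, hg.symm, ?_, ?_⟩
    · have := h0 s hs hst; rw [← hg] at this; exact_mod_cast this
    · have := ht' s hs hst; rw [← hg] at this; exact_mod_cast this
  set S : Set ℝ := {s | 0 ≤ s ∧ s ≤ t ∧ (s : EReal) ≤ L (capacityRatio θ s t E)} with hS
  have hSne : S.Nonempty := ⟨0, le_rfl, ht, h0 0 le_rfl ht⟩
  have hSb : BddAbove S := ⟨t, fun s hs => hs.2.1⟩
  have hc0 : 0 ≤ sSup S := le_csSup hSb ⟨le_rfl, ht, h0 0 le_rfl ht⟩
  have hct : sSup S ≤ t := csSup_le hSne fun s hs => hs.2.1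
  obtain ⟨g, hg, hg0, hgt⟩ := hreal _ hc0 hct
  have hcg : sSup S ≤ g := csSup_le hSne fun s hs => by
    have := hs.2.2.trans (hmono s _ hs.1 (le_csSup hSb hs) hct)
    rw [hg] at this
    exact_mod_cast this
  have hgc : g ≤ sSup S :=
    le_csSup hSb ⟨hg0, hgt, hg ▸ hmono _ _ hc0 hcg hgt⟩
  have huniq : ∀ a b : ℝ, 0 ≤ a → b ≤ t → L (capacityRatio θ a t E) = a →
      L (capacityRatio θ b t E) = b → b ≤ a := fun a b ha hb hLa hLb => by
    by_contra! hab
    have := hL.capacityRatio_le_add hE hne hθ₁ ha hab.le hb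
    rw [hLa, hLb] at this
    have h2 : b ≤ a + (1 - θ) * (b - a) := by exact_mod_cast this
    nlinarith
  refine ⟨sSup S, ⟨hc0, hct, by rw [hg, le_antisymm hcg hgc]⟩, ?_⟩
  rintro b ⟨hb0, hbt, hb⟩
  have hc : L (capacityRatio θ (sSup S) t E) = (sSup S : ℝ) := by rw [hg, le_antisymm hcg hgc]
  exact le_antisymm (huniq _ _ hc0 hbt hc hb) (huniq _ _ hb0 hct hb hc)

end Profile

/-! ### From bounds on sums over covers to intermediate dimensions -/

section IntermediateDim

theorem tendsto_rpow_nhdsGT_zero {γ : ℝ} (hγ : 0 < γ) :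
    Tendsto (fun r : ℝ => r ^ γ) (𝓝[>] 0) (𝓝[>] 0) := by
  refine tendsto_nhdsWithin_iff.2 ⟨?_, ?_⟩
  · have : Tendsto (fun r : ℝ => r ^ γ) (𝓝 0) (𝓝 (0 ^ γ)) :=
      (Real.continuousAt_rpow_const 0 γ (Or.inr hγ.le)).tendsto
    rw [Real.zero_rpow hγ.ne'] at this
    exact this.mono_left nhdsWithin_le_nhds
  · filter_upwards [self_mem_nhdsWithin] with r hr
    exact Real.rpow_pos_of_pos hr _

theorem map_rpow_nhdsGT_zero {γ : ℝ} (hγ : 0 < γ) :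
    map (fun r : ℝ => r ^ γ) (𝓝[>] 0) = 𝓝[>] 0 := by
  refine le_antisymm (tendsto_rpow_nhdsGT_zero hγ) ?_
  have h1 := map_mono (m := fun r : ℝ => r ^ γ) (tendsto_rpow_nhdsGT_zero (inv_pos.2 hγ))
  rw [map_map] at h1
  refine le_trans (le_of_eq ?_) h1
  conv_lhs => rw [← map_id (f := 𝓝[>] (0 : ℝ))]
  refine Filter.map_congr ?_
  filter_upwards [self_mem_nhdsWithin] with r hr
  simp [← Real.rpow_mul (le_of_lt hr), inv_mul_cancel₀ hγ.ne']

variable {X : Type*} [MetricSpace X] {θ σ τ ε δ r : ℝ} {F : Set X} {𝒰 : Finset (Set X)}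

theorem IsAdmissibleCover.mono (h : IsAdmissibleCover θ σ r ε F 𝒰) (hε : ε ≤ δ) :
    IsAdmissibleCover θ σ r δ F 𝒰 :=
  ⟨h.1, h.2.1, h.2.2.trans hε⟩

theorem IsAdmissibleCover.diam_pos (h : IsAdmissibleCover θ σ r ε F 𝒰) (hr : 0 < r) {U : Set X}
    (hU : U ∈ 𝒰) : 0 < Metric.diam U :=
  (Real.rpow_pos_of_pos hr _).trans_le (h.2.1 U hU).1

theorem IsAdmissibleCover.change_exponent (h : IsAdmissibleCover θ σ r ε F 𝒰) (hr : 0 < r)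
    (hστ : σ ≤ τ) : IsAdmissibleCover θ τ r (r ^ (τ - σ) * ε) F 𝒰 := by
  refine ⟨h.1, h.2.1, ?_⟩
  refine le_trans ?_ (mul_le_mul_of_nonneg_left h.2.2 (Real.rpow_nonneg hr.le _))
  rw [Finset.mul_sum]
  refine Finset.sum_le_sum fun U hU => ?_
  have hd := h.diam_pos hr hU
  rw [← sub_add_cancel τ σ, Real.rpow_add hd, sub_add_cancel]
  exact mul_le_mul_of_nonneg_right
    (Real.rpow_le_rpow hd.le (h.2.1 U hU).2 (sub_nonneg.2 hστ)) (Real.rpow_nonneg hd.le _)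

/-- The lower intermediate dimension in terms of the filter `𝓝[>] 0`, with the scale written as a
power `r ^ γ`. -/
theorem lowerIntermediateDim_eq (θ : ℝ) (F : Set X) {γ : ℝ} (hγ : 0 < γ) :
    lowerIntermediateDim θ F = sInf {s : ℝ | 0 ≤ s ∧ ∀ ε : ℝ, 0 < ε →
      ∃ᶠ r : ℝ in 𝓝[>] 0, ∃ 𝒰 : Finset (Set X), IsAdmissibleCover θ s (r ^ γ) ε F 𝒰} := by
  unfold lowerIntermediateDim
  congr 1
  ext s
  refine and_congr_right fun _ => forall₂_congr fun ε _ => ?_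
  rw [← frequently_map (m := fun r : ℝ => r ^ γ)
    (P := fun r => ∃ 𝒰 : Finset (Set X), IsAdmissibleCover θ s r ε F 𝒰), map_rpow_nhdsGT_zero hγ,
    (nhdsGT_basis_Ioc (0 : ℝ)).frequently_iff]
  simp only [Set.mem_Ioc, and_assoc]

/-- The upper intermediate dimension in terms of the filter `𝓝[>] 0`, with the scale written as a
power `r ^ γ`. -/
theorem upperIntermediateDim_eq (θ : ℝ) (F : Set X) {γ : ℝ} (hγ : 0 < γ) :
    upperIntermediateDim θ F = sInf {s : ℝ | 0 ≤ s ∧ ∀ ε : ℝ, 0 < ε →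
      ∀ᶠ r : ℝ in 𝓝[>] 0, ∃ 𝒰 : Finset (Set X), IsAdmissibleCover θ s (r ^ γ) ε F 𝒰} := by
  unfold upperIntermediateDim
  congr 1
  ext s
  refine and_congr_right fun _ => forall₂_congr fun ε _ => ?_
  rw [← eventually_map (m := fun r : ℝ => r ^ γ)
    (P := fun r => ∃ 𝒰 : Finset (Set X), IsAdmissibleCover θ s r ε F 𝒰), map_rpow_nhdsGT_zero hγ,
    (nhdsGT_basis_Ioc (0 : ℝ)).eventually_iff]
  simp only [Set.mem_Ioc, and_imp]

/-- At a scale at most `1`, if no cover has a sum at most `1` for the exponent `τ`, then none has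
for a smaller exponent. -/
theorem not_isAdmissibleCover_of_le (hr : 0 < r) (hr1 : r ≤ 1) (hστ : σ ≤ τ)
    (h : ∀ 𝒰 : Finset (Set X), ¬ IsAdmissibleCover θ τ r 1 F 𝒰) :
    ¬ ∃ 𝒰 : Finset (Set X), IsAdmissibleCover θ σ r 1 F 𝒰 := by
  rintro ⟨𝒰, h𝒰⟩
  refine h 𝒰 ((h𝒰.change_exponent hr hστ).mono ?_)
  rw [mul_one]
  exact Real.rpow_le_one hr.le hr1 (sub_nonneg.2 hστ)

theorem eventually_rpow_pos_le_one {γ : ℝ} (hγ : 0 < γ) :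
    ∀ᶠ r : ℝ in 𝓝[>] 0, 0 < r ^ γ ∧ r ^ γ ≤ 1 :=
  ((tendsto_rpow_nhdsGT_zero hγ).eventually (eventually_nhdsGT_zero_lt one_pos)).mono
    fun _ h => ⟨h.1, h.2.le⟩

theorem eventually_change_exponent_le {γ η : ℝ} (hη : η < γ * (τ - σ))
    (hστ : σ ≤ τ) (hε : 0 < ε) : ∀ᶠ r : ℝ in 𝓝[>] 0,
      (∃ 𝒰 : Finset (Set X), IsAdmissibleCover θ σ (r ^ γ) (r ^ (-η)) F 𝒰) →
        ∃ 𝒰 : Finset (Set X), IsAdmissibleCover θ τ (r ^ γ) ε F 𝒰 := by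
  filter_upwards [(tendsto_rpow_nhdsGT_zero (sub_pos.2 hη)).eventually
    (eventually_nhdsGT_zero_lt hε), self_mem_nhdsWithin] with r hr hr0 ⟨𝒰, h𝒰⟩
  refine ⟨𝒰, (h𝒰.change_exponent (Real.rpow_pos_of_pos hr0 _) hστ).mono ?_⟩
  rw [← Real.rpow_mul (le_of_lt hr0), ← Real.rpow_add hr0, ← sub_eq_add_neg]
  exact hr.2.le

/-- Below a fixed point `s'`, the limit of the capacity ratio at `s` exceeds `s`, by at least `θ`
times the distance to the fixed point. -/
theorem IsLimitFunctional.le_capacityRatio {n : ℕ} {E : Set (EuclideanSpace ℝ (Fin n))}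
    {L : (ℝ → ℝ) → EReal} (hL : IsLimitFunctional L) (hE : IsCompact E) (hne : E.Nonempty)
    {s s' t : ℝ} (hθ₁ : θ ≤ 1) (hs : 0 ≤ s) (hss : s ≤ s') (hst : s' ≤ t)
    (h : L (capacityRatio θ s' t E) = s') :
    ((s + θ * (s' - s) : ℝ) : EReal) ≤ L (capacityRatio θ s t E) := by
  have h1 := hL.capacityRatio_le_add hE hne hθ₁ hs hss hst
  rw [h, ← EReal.sub_le_iff_le_add (Or.inl (EReal.coe_ne_bot _))
    (Or.inl (EReal.coe_ne_top _)), ← EReal.coe_sub] at h1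
  convert h1 using 2
  ring

variable {n : ℕ} {E : Set (EuclideanSpace ℝ (Fin n))} {α s s' t : ℝ}

/-- If the sums over all covers of `F` are bounded below by the capacities of `E`, then large
capacities preclude covers with small sums. -/
theorem eventually_not_isAdmissibleCover_of_lt_capacityRatio (hE : IsCompact E) (hne : E.Nonempty)
    (hθ₁ : θ ≤ 1) (hs : 0 ≤ s) (hst : s ≤ t) {γ η : ℝ} (hη : 0 < η)
    (hA : ∀ᶠ r in 𝓝[>] 0, ∀ (ε : ℝ) (𝒰 : Finset (Set X)),
      IsAdmissibleCover θ σ (r ^ γ) ε F 𝒰 → r ^ (s + η) * (profileCapacity r θ s t E).toReal ≤ ε) :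
    ∀ᶠ r in 𝓝[>] 0, s + 2 * η < capacityRatio θ s t E r →
      ∀ 𝒰 : Finset (Set X), ¬ IsAdmissibleCover θ σ (r ^ γ) 1 F 𝒰 := by
  filter_upwards [hA, eventually_nhdsGT_zero_lt one_pos] with r hr ⟨hr0, hr1⟩ hlt 𝒰 h𝒰
  have h1 := hr _ _ h𝒰
  have h2 := rpow_lt_of_lt_capacityRatio hE hne hr0 hr1 hθ₁ hs hst hlt
  have h3 : 1 < r ^ (s + η) * (profileCapacity r θ s t E).toReal := by
    calc 1 < r ^ (-η) := Real.one_lt_rpow_of_pos_of_lt_one_of_neg hr0 hr1 (by linarith)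
      _ = r ^ (s + η) * r ^ (-(s + 2 * η)) := by rw [← Real.rpow_add hr0]; ring_nf
      _ < _ := mul_lt_mul_of_pos_left h2 (Real.rpow_pos_of_pos hr0 _)
  linarith

/-- If there are covers of `F` whose sums are bounded by the capacities of `E`, then small
capacities yield covers with small sums. -/
theorem eventually_exists_isAdmissibleCover_of_capacityRatio_lt (hE : IsCompact E)
    (hne : E.Nonempty) (hθ₁ : θ ≤ 1) (hs : 0 ≤ s) (hst : s ≤ t) {γ η : ℝ}
    (hB : ∀ᶠ r in 𝓝[>] 0, ∃ 𝒰 : Finset (Set X),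
      IsAdmissibleCover θ σ (r ^ γ) (r ^ (s - η) * (profileCapacity r θ s t E).toReal) F 𝒰) :
    ∀ᶠ r in 𝓝[>] 0, capacityRatio θ s t E r < s + η →
      ∃ 𝒰 : Finset (Set X), IsAdmissibleCover θ σ (r ^ γ) (r ^ (-(2 * η))) F 𝒰 := by
  filter_upwards [hB, eventually_nhdsGT_zero_lt one_pos] with r ⟨𝒰, h𝒰⟩ ⟨hr0, hr1⟩ hlt
  refine ⟨𝒰, h𝒰.mono ?_⟩
  have h2 := lt_rpow_of_capacityRatio_lt hE hne hr0 hr1 hθ₁ hs hst hlt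
  calc _ ≤ r ^ (s - η) * r ^ (-(s + η)) :=
        mul_le_mul_of_nonneg_left h2.le (Real.rpow_nonneg hr0.le _)
    _ = _ := by rw [← Real.rpow_add hr0]; ring_nf

/-- The exponents above the lower profile (divided by `α`) belong to the set that defines the
lower intermediate dimension. -/
theorem frequently_exists_isAdmissibleCover (hE : IsCompact E) (hne : E.Nonempty) (hα : 0 < α)
    (hθ₀ : 0 < θ) (hθ₁ : θ ≤ 1) (hs : IsLowerProfile θ t E s)
    (hB : ∀ η : ℝ, 0 < η → ∀ᶠ r in 𝓝[>] 0, ∃ 𝒰 : Finset (Set X),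
      IsAdmissibleCover θ (s / α) (r ^ (θ * α))
        (r ^ (s - η) * (profileCapacity r θ s t E).toReal) F 𝒰)
    (hτ : s / α < τ) (hε : 0 < ε) :
    ∃ᶠ r : ℝ in 𝓝[>] 0, ∃ 𝒰 : Finset (Set X), IsAdmissibleCover θ τ (r ^ (θ * α)) ε F 𝒰 := by
  have hγ : 0 < θ * α := mul_pos hθ₀ hα
  have hη : 0 < θ * α * (τ - s / α) / 4 := by have := mul_pos hγ (sub_pos.2 hτ); positivity
  have hfreq : ∃ᶠ r in 𝓝[>] 0, capacityRatio θ s t E r < s + θ * α * (τ - s / α) / 4 := by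
    have : liminf (fun r : ℝ => (capacityRatio θ s t E r : EReal)) (𝓝[>] (0 : ℝ)) <
        ((s + θ * α * (τ - s / α) / 4 : ℝ) : EReal) := by
      rw [hs.2.2]; exact_mod_cast lt_add_of_pos_right s hη
    exact (frequently_lt_of_liminf_lt (by isBoundedDefault) this).mono
      fun r hr => by exact_mod_cast hr
  refine ((hfreq.and_eventually (eventually_exists_isAdmissibleCover_of_capacityRatio_lt hE hne hθ₁
    hs.1 hs.2.1 (hB _ hη))).and_eventually (eventually_change_exponent_le (θ := θ) (F := F)
    (γ := θ * α) (η := 2 * (θ * α * (τ - s / α) / 4)) (by linarith) hτ.le hε)).mono fun r hr => ?_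
  exact hr.2 (hr.1.2 hr.1.1)

/-- The exponents above the upper profile (divided by `α`) belong to the set that defines the
upper intermediate dimension. -/
theorem eventually_exists_isAdmissibleCover (hE : IsCompact E) (hne : E.Nonempty) (hα : 0 < α)
    (hθ₀ : 0 < θ) (hθ₁ : θ ≤ 1) (hs : IsUpperProfile θ t E s)
    (hB : ∀ η : ℝ, 0 < η → ∀ᶠ r in 𝓝[>] 0, ∃ 𝒰 : Finset (Set X),
      IsAdmissibleCover θ (s / α) (r ^ (θ * α))
        (r ^ (s - η) * (profileCapacity r θ s t E).toReal) F 𝒰)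
    (hτ : s / α < τ) (hε : 0 < ε) :
    ∀ᶠ r : ℝ in 𝓝[>] 0, ∃ 𝒰 : Finset (Set X), IsAdmissibleCover θ τ (r ^ (θ * α)) ε F 𝒰 := by
  have hγ : 0 < θ * α := mul_pos hθ₀ hα
  have hη : 0 < θ * α * (τ - s / α) / 4 := by have := mul_pos hγ (sub_pos.2 hτ); positivity
  have hev : ∀ᶠ r in 𝓝[>] 0, capacityRatio θ s t E r < s + θ * α * (τ - s / α) / 4 := by
    have : limsup (fun r : ℝ => (capacityRatio θ s t E r : EReal)) (𝓝[>] (0 : ℝ)) <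
        ((s + θ * α * (τ - s / α) / 4 : ℝ) : EReal) := by
      rw [hs.2.2]; exact_mod_cast lt_add_of_pos_right s hη
    exact (eventually_lt_of_limsup_lt this (by isBoundedDefault)).mono
      fun r hr => by exact_mod_cast hr
  filter_upwards [hev, eventually_exists_isAdmissibleCover_of_capacityRatio_lt hE hne hθ₁
    hs.1 hs.2.1 (hB _ hη), eventually_change_exponent_le (θ := θ) (F := F)
    (γ := θ * α) (η := 2 * (θ * α * (τ - s / α) / 4)) (by linarith) hτ.le hε] with r h1 h2 h3
  exact h3 (h2 h1)

/-- Two bounds on sums over covers by capacities, one for all covers (for exponents below the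
profile) and one for suitable covers (at the profile), determine the lower intermediate
dimension. -/
theorem lowerIntermediateDim_eq_of_bounds (hE : IsCompact E) (hne : E.Nonempty) (hα : 0 < α)
    (hθ₀ : 0 < θ) (hθ₁ : θ ≤ 1) (hs : IsLowerProfile θ t E s)
    (hA : ∀ δ : ℝ, 0 < δ → ∃ s₁, s - δ < s₁ ∧ (0 ≤ s₁ → s₁ < s ∧ ∀ᶠ r in 𝓝[>] 0,
      ∀ (ε : ℝ) (𝒰 : Finset (Set X)), IsAdmissibleCover θ (s₁ / α) (r ^ (θ * α)) ε F 𝒰 →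
        r ^ (s₁ + θ * (s - s₁) / 4) * (profileCapacity r θ s₁ t E).toReal ≤ ε))
    (hB : ∀ η : ℝ, 0 < η → ∀ᶠ r in 𝓝[>] 0, ∃ 𝒰 : Finset (Set X),
      IsAdmissibleCover θ (s / α) (r ^ (θ * α))
        (r ^ (s - η) * (profileCapacity r θ s t E).toReal) F 𝒰) :
    lowerIntermediateDim θ F = s / α := by
  have hγ : 0 < θ * α := mul_pos hθ₀ hα
  rw [lowerIntermediateDim_eq θ F hγ]
  set S := {s : ℝ | 0 ≤ s ∧ ∀ ε : ℝ, 0 < ε →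
      ∃ᶠ r : ℝ in 𝓝[>] 0, ∃ 𝒰 : Finset (Set X), IsAdmissibleCover θ s (r ^ (θ * α)) ε F 𝒰}
  have hmem : ∀ τ, s / α < τ → τ ∈ S := fun τ hτ => ⟨(div_nonneg hs.1 hα.le).trans hτ.le,
    fun ε hε => frequently_exists_isAdmissibleCover hE hne hα hθ₀ hθ₁ hs hB hτ hε⟩
  have hbdd : BddBelow S := ⟨0, fun τ hτ => hτ.1⟩
  refine le_antisymm (le_of_forall_gt_imp_ge_of_dense fun τ hτ => csInf_le hbdd (hmem τ hτ))
    (le_csInf ⟨_, hmem (s / α + 1) (lt_add_one _)⟩ fun τ hτ => ?_)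
  by_contra! hlt
  obtain ⟨s₁, hs₁, h⟩ := hA (s - α * τ) (by rw [lt_div_iff₀ hα] at hlt; linarith)
  have hτs₁ : τ < s₁ / α := by rw [lt_div_iff₀ hα]; linarith
  have hs₁0 : 0 ≤ s₁ := by have := mul_nonneg hα.le hτ.1; linarith
  obtain ⟨hs₁s, hA'⟩ := h hs₁0
  have hη : 0 < θ * (s - s₁) := mul_pos hθ₀ (sub_pos.2 hs₁s)
  have hcap : ∀ᶠ r in 𝓝[>] 0, s₁ + 2 * (θ * (s - s₁) / 4) < capacityRatio θ s₁ t E r := by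
    have h1 := isLimitFunctional_liminf.le_capacityRatio hE hne hθ₁ hs₁0 hs₁s.le hs.2.1 hs.2.2
    have h2 : ((s₁ + 2 * (θ * (s - s₁) / 4) : ℝ) : EReal) <
        liminf (fun r : ℝ => (capacityRatio θ s₁ t E r : EReal)) (𝓝[>] (0 : ℝ)) :=
      lt_of_lt_of_le (by exact_mod_cast (by linarith)) h1
    exact (eventually_lt_of_lt_liminf h2 (by isBoundedDefault)).mono
      fun r hr => by exact_mod_cast hr
  refine hτ.2 1 one_pos ?_
  filter_upwards [hcap, eventually_not_isAdmissibleCover_of_lt_capacityRatio hE hne hθ₁ hs₁0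
    (hs₁s.le.trans hs.2.1) (by linarith) hA', eventually_rpow_pos_le_one hγ] with r h1 h2 h3
  exact not_isAdmissibleCover_of_le h3.1 h3.2 hτs₁.le (h2 h1)

/-- The counterpart of `lowerIntermediateDim_eq_of_bounds` for the upper intermediate dimension. -/
theorem upperIntermediateDim_eq_of_bounds (hE : IsCompact E) (hne : E.Nonempty) (hα : 0 < α)
    (hθ₀ : 0 < θ) (hθ₁ : θ ≤ 1) (hs : IsUpperProfile θ t E s)
    (hA : ∀ δ : ℝ, 0 < δ → ∃ s₁, s - δ < s₁ ∧ (0 ≤ s₁ → s₁ < s ∧ ∀ᶠ r in 𝓝[>] 0,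
      ∀ (ε : ℝ) (𝒰 : Finset (Set X)), IsAdmissibleCover θ (s₁ / α) (r ^ (θ * α)) ε F 𝒰 →
        r ^ (s₁ + θ * (s - s₁) / 4) * (profileCapacity r θ s₁ t E).toReal ≤ ε))
    (hB : ∀ η : ℝ, 0 < η → ∀ᶠ r in 𝓝[>] 0, ∃ 𝒰 : Finset (Set X),
      IsAdmissibleCover θ (s / α) (r ^ (θ * α))
        (r ^ (s - η) * (profileCapacity r θ s t E).toReal) F 𝒰) :
    upperIntermediateDim θ F = s / α := by
  have hγ : 0 < θ * α := mul_pos hθ₀ hα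
  rw [upperIntermediateDim_eq θ F hγ]
  set S := {s : ℝ | 0 ≤ s ∧ ∀ ε : ℝ, 0 < ε →
      ∀ᶠ r : ℝ in 𝓝[>] 0, ∃ 𝒰 : Finset (Set X), IsAdmissibleCover θ s (r ^ (θ * α)) ε F 𝒰}
  have hmem : ∀ τ, s / α < τ → τ ∈ S := fun τ hτ => ⟨(div_nonneg hs.1 hα.le).trans hτ.le,
    fun ε hε => eventually_exists_isAdmissibleCover hE hne hα hθ₀ hθ₁ hs hB hτ hε⟩
  have hbdd : BddBelow S := ⟨0, fun τ hτ => hτ.1⟩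
  refine le_antisymm (le_of_forall_gt_imp_ge_of_dense fun τ hτ => csInf_le hbdd (hmem τ hτ))
    (le_csInf ⟨_, hmem (s / α + 1) (lt_add_one _)⟩ fun τ hτ => ?_)
  by_contra! hlt
  obtain ⟨s₁, hs₁, h⟩ := hA (s - α * τ) (by rw [lt_div_iff₀ hα] at hlt; linarith)
  have hτs₁ : τ < s₁ / α := by rw [lt_div_iff₀ hα]; linarith
  have hs₁0 : 0 ≤ s₁ := by have := mul_nonneg hα.le hτ.1; linarith
  obtain ⟨hs₁s, hA'⟩ := h hs₁0
  have hη : 0 < θ * (s - s₁) := mul_pos hθ₀ (sub_pos.2 hs₁s)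
  have hcap : ∃ᶠ r in 𝓝[>] 0, s₁ + 2 * (θ * (s - s₁) / 4) < capacityRatio θ s₁ t E r := by
    have h1 := isLimitFunctional_limsup.le_capacityRatio hE hne hθ₁ hs₁0 hs₁s.le hs.2.1 hs.2.2
    have h2 : ((s₁ + 2 * (θ * (s - s₁) / 4) : ℝ) : EReal) <
        limsup (fun r : ℝ => (capacityRatio θ s₁ t E r : EReal)) (𝓝[>] (0 : ℝ)) :=
      lt_of_lt_of_le (by exact_mod_cast (by linarith)) h1
    exact (frequently_lt_of_lt_limsup (by isBoundedDefault) h2).mono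
      fun r hr => by exact_mod_cast hr
  refine hcap (((eventually_not_isAdmissibleCover_of_lt_capacityRatio hE hne hθ₁ hs₁0
    (hs₁s.le.trans hs.2.1) (by linarith) hA').and ((eventually_rpow_pos_le_one hγ).and
    (hτ.2 1 one_pos))).mono fun r hr h1 => ?_)
  exact not_isAdmissibleCover_of_le hr.2.1.1 hr.2.1.2 hτs₁.le (hr.1 h1) hr.2.2

end IntermediateDim

/-! ### Expectations of truncated kernels -/

section Gaussian

theorem gaussianReal_le_smul_volume {v : ℝ≥0} (hv : v ≠ 0) :
    gaussianReal 0 v ≤ ENNReal.ofReal (√v)⁻¹ • (volume : Measure ℝ) := by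
  rw [gaussianReal_of_var_ne_zero 0 hv, ← withDensity_const]
  refine withDensity_mono (ae_of_all _ fun x => ENNReal.ofReal_le_ofReal ?_)
  have hv' : 0 < (v : ℝ) := by positivity
  rw [gaussianPDFReal]
  refine (mul_le_of_le_one_right (by positivity) (Real.exp_le_one_iff.2 ?_)).trans ?_
  · exact div_nonpos_of_nonpos_of_nonneg (neg_nonpos.2 (sq_nonneg _)) (by positivity)
  · refine inv_anti₀ (by positivity) (Real.sqrt_le_sqrt ?_)
    have := Real.pi_gt_three
    nlinarith

theorem setLIntegral_Icc_rpow_neg {β R : ℝ} (hβ1 : β < 1) (hR : 0 ≤ R) :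
    ∫⁻ x in Set.Icc 0 R, ENNReal.ofReal (|x| ^ (-β)) =
      ENNReal.ofReal (R ^ (1 - β) / (1 - β)) := by
  rw [setLIntegral_congr Ioc_ae_eq_Icc.symm]
  have hint : IntervalIntegrable (fun x : ℝ => x ^ (-β)) volume 0 R :=
    intervalIntegral.intervalIntegrable_rpow' (by linarith)
  rw [intervalIntegrable_iff_integrableOn_Ioc_of_le hR] at hint
  have h1 : ∫⁻ x in Set.Ioc 0 R, ENNReal.ofReal (|x| ^ (-β)) =
      ∫⁻ x in Set.Ioc 0 R, ENNReal.ofReal (x ^ (-β)) :=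
    setLIntegral_congr_fun measurableSet_Ioc fun x hx => by
      simp only [abs_of_pos hx.1]
  rw [h1, ← ofReal_integral_eq_lintegral_ofReal hint ?_, ← intervalIntegral.integral_of_le hR,
    integral_rpow (Or.inl (by linarith)), Real.zero_rpow (by linarith)]
  · ring_nf
  · exact (ae_restrict_iff' measurableSet_Ioc).2
      (ae_of_all _ fun x hx => Real.rpow_nonneg hx.1.le _)

theorem setLIntegral_Icc_neg_rpow_neg_le {β R : ℝ} (hβ1 : β < 1) (hR : 0 ≤ R) :
    ∫⁻ x in Set.Icc (-R) R, ENNReal.ofReal (|x| ^ (-β)) ≤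
      ENNReal.ofReal (2 * R ^ (1 - β) / (1 - β)) := by
  have hneg : ∫⁻ x in Set.Icc (-R) 0, ENNReal.ofReal (|x| ^ (-β)) =
      ∫⁻ x in Set.Icc 0 R, ENNReal.ofReal (|x| ^ (-β)) := by
    have := (Measure.measurePreserving_neg (volume : Measure ℝ)).setLIntegral_comp_preimage_emb
      (MeasurableEquiv.neg ℝ).measurableEmbedding (fun x => ENNReal.ofReal (|x| ^ (-β)))
      (Set.Icc 0 R)
    simpa [abs_neg] using this
  rw [← Set.Icc_union_Icc_eq_Icc (neg_nonpos.2 hR) hR]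
  refine (lintegral_union_le _ _ _).trans ?_
  have h1β : 0 < 1 - β := by linarith
  rw [hneg, setLIntegral_Icc_rpow_neg hβ1 hR, ← ENNReal.ofReal_add (by positivity) (by positivity)]
  exact ENNReal.ofReal_le_ofReal (le_of_eq (by ring))

theorem lintegral_gaussianReal_indicator_rpow_le {β R d : ℝ} (hβ1 : β < 1) (hR : 0 ≤ R)
    {v : ℝ≥0} (hd : 0 < d) (hv : (v : ℝ) = d ^ 2) :
    ∫⁻ x, (Set.Icc (-R) R).indicator (fun x => ENNReal.ofReal (|x| ^ (-β))) x ∂(gaussianReal 0 v) ≤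
      ENNReal.ofReal (2 / (1 - β) * (R ^ (1 - β) / d)) := by
  have hv0 : v ≠ 0 := by
    rintro rfl
    simp only [NNReal.coe_zero] at hv
    exact (pow_pos hd 2).ne hv
  refine (lintegral_mono' (gaussianReal_le_smul_volume hv0) le_rfl).trans ?_
  rw [lintegral_smul_measure, lintegral_indicator measurableSet_Icc, hv, Real.sqrt_sq hd.le,
    smul_eq_mul]
  refine (mul_le_mul_right (setLIntegral_Icc_neg_rpow_neg_le hβ1 hR) _).trans ?_
  rw [← ENNReal.ofReal_mul (by positivity)]
  exact ENNReal.ofReal_le_ofReal (le_of_eq (by field_simp))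

/-- The kernel `min(1, ρ / |z|) ^ σ` truncated at the distance `R`. -/
noncomputable def truncatedKernel (ρ R σ : ℝ) : ℝ → ℝ :=
  (Set.Iic R).indicator fun u => (ρ / max ρ u) ^ σ

theorem truncatedKernel_nonneg {ρ R σ u : ℝ} (hρ : 0 < ρ) : 0 ≤ truncatedKernel ρ R σ u :=
  Set.indicator_nonneg (fun _ _ => Real.rpow_nonneg (div_max_pos hρ _).le _) _

theorem truncatedKernel_le_one {ρ R σ u : ℝ} (hρ : 0 < ρ) (hσ : 0 ≤ σ) :
    truncatedKernel ρ R σ u ≤ 1 :=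
  Set.indicator_apply_le' (fun _ => Real.rpow_le_one (div_max_pos hρ _).le (div_max_le_one hρ _) hσ)
    fun _ => zero_le_one

theorem measurable_truncatedKernel {ρ R σ : ℝ} : Measurable (truncatedKernel ρ R σ) := by
  refine Measurable.indicator ?_ measurableSet_Iic
  fun_prop

/-- As `|z i| ≤ ‖z‖`, each of the `m` factors is at least the `m`-th root of the left-hand side. -/
theorem truncatedKernel_le_prod {m : ℕ} (hm : 0 < m) {ρ R σ : ℝ} (hρ : 0 < ρ) (hσ : 0 ≤ σ)
    (z : EuclideanSpace ℝ (Fin m)) :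
    truncatedKernel ρ R σ ‖z‖ ≤ ∏ i, truncatedKernel ρ R (σ / m) |z i| := by
  have hz : ∀ i, |z i| ≤ ‖z‖ := fun i => by simpa using PiLp.norm_apply_le z i
  by_cases h : ‖z‖ ≤ R
  · have h1 : ∀ i, truncatedKernel ρ R (σ / m) |z i| = (ρ / max ρ |z i|) ^ (σ / m) := fun i =>
      Set.indicator_of_mem (Set.mem_Iic.2 ((hz i).trans h)) _
    rw [truncatedKernel, Set.indicator_of_mem (Set.mem_Iic.2 h)]
    simp only [h1]
    calc (ρ / max ρ ‖z‖) ^ σ = ∏ _i : Fin m, (ρ / max ρ ‖z‖) ^ (σ / m) := by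
          rw [Finset.prod_const, Finset.card_univ, Fintype.card_fin, ← Real.rpow_natCast,
            ← Real.rpow_mul (div_max_pos hρ _).le, div_mul_cancel₀]
          exact_mod_cast hm.ne'
      _ ≤ _ := Finset.prod_le_prod (fun i _ => Real.rpow_nonneg (div_max_pos hρ _).le _)
          fun i _ => Real.rpow_le_rpow (div_max_pos hρ _).le (div_max_antitone hρ (hz i))
            (by positivity)
  · rw [truncatedKernel, Set.indicator_of_notMem (by simpa using h)]
    exact Finset.prod_nonneg fun i _ => truncatedKernel_nonneg hρ

/-- The expectation of the truncated kernel at a centred normal variable with standard deviation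
`d` is at most of the order of a product of two truncated powers of `d`. -/
theorem lintegral_gaussianReal_truncatedKernel_le {β ρ R d : ℝ} (hβ0 : 0 ≤ β) (hβ1 : β < 1)
    (hρ : 0 < ρ) (hρR : ρ ≤ R) {v : ℝ≥0} (hv : (v : ℝ) = d ^ 2) :
    ∫⁻ x, ENNReal.ofReal (truncatedKernel ρ R β |x|) ∂(gaussianReal 0 v) ≤
      ENNReal.ofReal ((1 + 2 / (1 - β)) *
        ((ρ / max ρ d) ^ β * (R / max R d) ^ (1 - β))) := by
  have h1β : 0 < 1 - β := by linarith
  have hR : 0 < R := hρ.trans_le hρR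
  rcases le_or_gt d ρ with hdρ | hdρ
  · rw [max_eq_left hdρ, max_eq_left (hdρ.trans hρR), div_self hρ.ne', div_self hR.ne']
    refine (lintegral_mono fun x => ENNReal.ofReal_le_ofReal
      (truncatedKernel_le_one hρ hβ0)).trans ?_
    simp only [Real.one_rpow, mul_one, ENNReal.ofReal_one, lintegral_const, measure_univ]
    rw [← ENNReal.ofReal_one]
    exact ENNReal.ofReal_le_ofReal (le_add_of_nonneg_right (by positivity))
  have hd0 : 0 < d := hρ.trans hdρ
  have hpow : ∀ x : ℝ, x ≠ 0 → (ρ / max ρ |x|) ^ β ≤ ρ ^ β * |x| ^ (-β) := fun x hx => by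
    have hx' : 0 < |x| := abs_pos.2 hx
    rw [Real.rpow_neg hx'.le, ← div_eq_mul_inv, ← Real.div_rpow hρ.le hx'.le]
    exact Real.rpow_le_rpow (div_max_pos hρ _).le
      (div_le_div_of_nonneg_left hρ.le hx' (le_max_right _ _)) hβ0
  have hv0 : v ≠ 0 := by
    rintro rfl
    simp only [NNReal.coe_zero] at hv
    exact (pow_pos hd0 2).ne hv
  have hne : ∀ᵐ x ∂(gaussianReal 0 v), x ≠ 0 := by
    have := nullSingletonClass_gaussianReal (μ := 0) hv0
    exact measure_eq_zero_iff_ae_notMem.1 (measure_singleton (0 : ℝ))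
  rw [max_eq_right hdρ.le]
  rcases le_or_gt d R with hdR | hdR
  · rw [max_eq_left hdR, div_self hR.ne', Real.one_rpow, mul_one]
    -- beyond the distance `d` the kernel is at most `(ρ / d) ^ β`
    have hle : ∀ᵐ x ∂(gaussianReal 0 v), ENNReal.ofReal (truncatedKernel ρ R β |x|) ≤
        ENNReal.ofReal ((ρ / d) ^ β) + ENNReal.ofReal (ρ ^ β) *
          (Set.Icc (-d) d).indicator (fun x => ENNReal.ofReal (|x| ^ (-β))) x := by
      filter_upwards [hne] with x hx
      have h0 : truncatedKernel ρ R β |x| ≤ (ρ / max ρ |x|) ^ β :=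
        Set.indicator_apply_le' (fun _ => le_rfl)
          fun _ => Real.rpow_nonneg (div_max_pos hρ _).le _
      by_cases hxd : |x| ≤ d
      · rw [Set.indicator_of_mem (Set.mem_Icc.2 (abs_le.1 hxd)),
          ← ENNReal.ofReal_mul (by positivity)]
        exact le_add_left (ENNReal.ofReal_le_ofReal (h0.trans (hpow x hx)))
      · refine le_add_right (ENNReal.ofReal_le_ofReal (h0.trans ?_))
        exact Real.rpow_le_rpow (div_max_pos hρ _).le
          (div_le_div_of_nonneg_left hρ.le hd0 ((not_le.1 hxd).le.trans (le_max_right _ _))) hβ0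
    refine (lintegral_mono_ae hle).trans ?_
    rw [lintegral_add_left measurable_const, lintegral_const, measure_univ, mul_one,
      lintegral_const_mul' _ _ ENNReal.ofReal_ne_top]
    refine (add_le_add le_rfl (mul_le_mul_right
      (lintegral_gaussianReal_indicator_rpow_le hβ1 hd0.le hd0 hv) _)).trans ?_
    rw [← ENNReal.ofReal_mul (by positivity), ← ENNReal.ofReal_add (by positivity) (by positivity)]
    refine ENNReal.ofReal_le_ofReal (le_of_eq ?_)
    rw [Real.rpow_sub hd0, Real.rpow_one, Real.div_rpow hρ.le hd0.le]
    field_simp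
  · rw [max_eq_right hdR.le]
    have hle : ∀ᵐ x ∂(gaussianReal 0 v), ENNReal.ofReal (truncatedKernel ρ R β |x|) ≤
        ENNReal.ofReal (ρ ^ β) *
          (Set.Icc (-R) R).indicator (fun x => ENNReal.ofReal (|x| ^ (-β))) x := by
      filter_upwards [hne] with x hx
      by_cases hxR : |x| ≤ R
      · rw [Set.indicator_of_mem (Set.mem_Icc.2 (abs_le.1 hxR)),
          ← ENNReal.ofReal_mul (by positivity),
          truncatedKernel, Set.indicator_of_mem (Set.mem_Iic.2 hxR)]
        exact ENNReal.ofReal_le_ofReal (hpow x hx)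
      · rw [truncatedKernel, Set.indicator_of_notMem (by simpa using hxR)]
        simp
    refine (lintegral_mono_ae hle).trans ?_
    rw [lintegral_const_mul' _ _ ENNReal.ofReal_ne_top]
    refine (mul_le_mul_right
      (lintegral_gaussianReal_indicator_rpow_le hβ1 hR.le hd0 hv) _).trans ?_
    rw [← ENNReal.ofReal_mul (by positivity)]
    refine ENNReal.ofReal_le_ofReal ?_
    have : ρ ^ β * (2 / (1 - β) * (R ^ (1 - β) / d)) =
        2 / (1 - β) * ((ρ / d) ^ β * (R / d) ^ (1 - β)) := by
      rw [Real.div_rpow hρ.le hd0.le, Real.div_rpow hR.le hd0.le]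
      have hdd : d ^ β * d ^ (1 - β) = d := by
        rw [← Real.rpow_add hd0, add_sub_cancel, Real.rpow_one]
      field_simp
      rw [hdd]
    rw [this, add_mul, one_mul]
    exact le_add_of_nonneg_left (by positivity)

end Gaussian

section Expectation

variable {Ω : Type*} [MeasurableSpace Ω] {P : Measure Ω} {n m : ℕ} {α θ : ℝ}
  {B : EuclideanSpace ℝ (Fin n) → Ω → EuclideanSpace ℝ (Fin m)}

/-- The expectation of the truncated kernel of the image at `B x - B y` is bounded by the kernel of
the profile at `x - y`. The coordinates of `B x - B y` are independent, and the truncated kernel is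
bounded by a product of truncated kernels of the coordinates. -/
theorem IsFractionalBrownianMotion.lintegral_truncatedKernel_le
    (hB : IsFractionalBrownianMotion P α B) (hm : 0 < m) (hα₀ : 0 < α)
    (hθ₁ : θ ≤ 1) {r s : ℝ} (hr : 0 < r) (hr1 : r ≤ 1) (hs : 0 ≤ s) (hst : s < m * α)
    (x y : EuclideanSpace ℝ (Fin n)) :
    ∫⁻ ω, ENNReal.ofReal (truncatedKernel (r ^ α) (r ^ (θ * α)) (s / α) ‖B x ω - B y ω‖) ∂P ≤
      ENNReal.ofReal ((1 + 2 / (1 - s / α / m)) ^ m) *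
        ENNReal.ofReal (profileKernel r θ s (m * α) (x - y)) := by
  set ρ := r ^ α
  set R := r ^ (θ * α) with hRdef
  set β := s / α / m with hβ
  set d := ‖x - y‖ ^ α with hd
  have hm' : (0 : ℝ) < m := by exact_mod_cast hm
  have hρ : 0 < ρ := Real.rpow_pos_of_pos hr _
  have hR : 0 < R := Real.rpow_pos_of_pos hr _
  have hρR : ρ ≤ R := Real.rpow_le_rpow_of_exponent_ge hr hr1 (by nlinarith)
  have hσ : 0 ≤ s / α := by positivity
  have hβ0 : 0 ≤ β := by positivity
  have hβ1 : β < 1 := by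
    rw [hβ, div_div, div_lt_one (by positivity)]; linarith
  have hd0 : 0 ≤ d := by positivity
  have h1β : 0 < 1 - β := by linarith
  have hmeas : ∀ i,
    Measurable fun ω => ENNReal.ofReal (truncatedKernel ρ R β |B x ω i - B y ω i|) := by
    intro i
    have h1 : Measurable fun ω => B x ω i :=
      (EuclideanSpace.proj (𝕜 := ℝ) i).continuous.measurable.comp (hB.measurable x)
    have h2 : Measurable fun ω => B y ω i :=
      (EuclideanSpace.proj (𝕜 := ℝ) i).continuous.measurable.comp (hB.measurable y)
    exact (measurable_truncatedKernel.comp (h1.sub h2).abs).ennreal_ofReal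
  have hind : iIndepFun (fun (i : Fin m) ω =>
      ENNReal.ofReal (truncatedKernel ρ R β |B x ω i - B y ω i|)) P :=
    hB.indep.comp (fun _ (p : EuclideanSpace ℝ (Fin n) → ℝ) =>
      ENNReal.ofReal (truncatedKernel ρ R β |p x - p y|)) fun _ =>
      (measurable_truncatedKernel.comp
        ((measurable_pi_apply x).sub (measurable_pi_apply y)).abs).ennreal_ofReal
  have hone : ∀ i, ∫⁻ ω, ENNReal.ofReal (truncatedKernel ρ R β |B x ω i - B y ω i|) ∂P ≤
      ENNReal.ofReal ((1 + 2 / (1 - β)) * ((ρ / max ρ d) ^ β * (R / max R d) ^ (1 - β))) := by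
    intro i
    have := (hB.increments i x y).lintegral_comp
      (f := fun z => ENNReal.ofReal (truncatedKernel ρ R β |z|))
      (measurable_truncatedKernel.comp measurable_abs).ennreal_ofReal.aemeasurable
    rw [this]
    refine lintegral_gaussianReal_truncatedKernel_le hβ0 hβ1 hρ hρR ?_
    rw [NNReal.coe_rpow, coe_nnnorm, hd, ← Real.rpow_natCast, ← Real.rpow_mul (norm_nonneg _)]
    congr 1
    push_cast
    ring
  calc _ ≤ ∫⁻ ω, ∏ i, ENNReal.ofReal (truncatedKernel ρ R β |B x ω i - B y ω i|) ∂P := by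
        refine lintegral_mono fun ω => ?_
        rw [← ENNReal.ofReal_prod_of_nonneg fun i _ => truncatedKernel_nonneg hρ]
        exact ENNReal.ofReal_le_ofReal (truncatedKernel_le_prod hm hρ hσ _)
    _ = ∏ i, ∫⁻ ω, ENNReal.ofReal (truncatedKernel ρ R β |B x ω i - B y ω i|) ∂P :=
        lintegral_prod_eq_prod_lintegral_of_indepFun _ _ hind hmeas
    _ ≤ ∏ _i : Fin m, ENNReal.ofReal
          ((1 + 2 / (1 - β)) * ((ρ / max ρ d) ^ β * (R / max R d) ^ (1 - β))) :=
        Finset.prod_le_prod' fun i _ => hone i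
    _ = _ := by
        have hmaxpow : ∀ a : ℝ, 0 < a → a ^ α / max (a ^ α) d = (a / max a ‖x - y‖) ^ α :=
          fun a ha => by
            rw [Real.div_rpow ha.le (lt_max_of_lt_left ha).le, hd]
            congr 1
            rcases le_total a ‖x - y‖ with h | h
            · rw [max_eq_right h, max_eq_right (Real.rpow_le_rpow ha.le h hα₀.le)]
            · rw [max_eq_left h, max_eq_left (Real.rpow_le_rpow (norm_nonneg _) h hα₀.le)]
        have hRθ : R = (r ^ θ) ^ α := by rw [← Real.rpow_mul hr.le]
        have hrθ := Real.rpow_pos_of_pos hr θ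
        rw [Finset.prod_const, Finset.card_univ, Fintype.card_fin, ← ENNReal.ofReal_pow,
          ← ENNReal.ofReal_mul, profileKernel_eq_radialKernel hr hr1 hθ₁, radialKernel, mul_pow,
          mul_pow, hRθ, hmaxpow r hr, hmaxpow _ hrθ]
        · congr 2
          have h1 := div_max_pos hr ‖x - y‖
          have h2 := div_max_pos hrθ ‖x - y‖
          rw [← Real.rpow_natCast, ← Real.rpow_natCast, ← Real.rpow_mul h1.le,
            ← Real.rpow_mul h2.le, ← Real.rpow_mul (by positivity), ← Real.rpow_mul (by positivity)]
          congr 2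
          · rw [hβ]; field_simp
          · rw [hβ]; field_simp
        · positivity
        · positivity

end Expectation

/-! ### The lower bound for the sums over all covers -/

section CoverSum

/-- A Cauchy–Schwarz inequality: if a kernel is at least `(w i)⁻¹` on the square of the `i`-th piece
of a partition, then the sum of the `w i` is at least the reciprocal of the energy. -/
theorem one_le_sum_mul_lintegral {X ι : Type*} [MeasurableSpace X] [Fintype ι] {μ : Measure X}
    [IsProbabilityMeasure μ] {A : ι → Set X} (hA : ∀ i, MeasurableSet (A i))
    (hdisj : Pairwise (Function.onFun Disjoint A)) (hcov : μ (⋃ i, A i) = 1) {w : ι → ℝ}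
    (hw : ∀ i, 0 < w i) {K : X → X → ℝ≥0∞}
    (hK : ∀ i, ∀ x ∈ A i, ∀ y ∈ A i, ENNReal.ofReal (w i)⁻¹ ≤ K x y)
    (hfin : ∫⁻ x, ∫⁻ y, K x y ∂μ ∂μ ≠ ⊤) :
    1 ≤ (∑ i, w i) * (∫⁻ x, ∫⁻ y, K x y ∂μ ∂μ).toReal := by
  set p : ι → ℝ := fun i => (μ (A i)).toReal with hp
  have hsum : ∑ i, p i = 1 := by
    rw [← ENNReal.toReal_sum fun i _ => measure_ne_top _ _, ← tsum_fintype (L := .unconditional ι),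
      ← measure_iUnion hdisj hA, hcov, ENNReal.toReal_one]
  have hI : ∑ i, p i ^ 2 / w i ≤ (∫⁻ x, ∫⁻ y, K x y ∂μ ∂μ).toReal := by
    have h1 : ∑ i, ENNReal.ofReal (p i ^ 2 / w i) ≤ ∫⁻ x, ∫⁻ y, K x y ∂μ ∂μ := by
      calc ∑ i, ENNReal.ofReal (p i ^ 2 / w i)
          ≤ ∑ i, ∫⁻ x in A i, ∫⁻ y, K x y ∂μ ∂μ := by
            refine Finset.sum_le_sum fun i _ => ?_
            calc ENNReal.ofReal (p i ^ 2 / w i)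
                = ∫⁻ _ in A i, ∫⁻ _ in A i, ENNReal.ofReal (w i)⁻¹ ∂μ ∂μ := by
                  simp only [lintegral_const, Measure.restrict_apply_univ]
                  have := hw i
                  rw [div_eq_inv_mul, sq, ← mul_assoc, ENNReal.ofReal_mul (by positivity),
                    ENNReal.ofReal_mul (by positivity), hp]
                  simp only [ENNReal.ofReal_toReal (measure_ne_top μ (A i))]
              _ ≤ ∫⁻ x in A i, ∫⁻ y, K x y ∂μ ∂μ := by
                  refine setLIntegral_mono' (hA i) fun x hx => ?_
                  exact (setLIntegral_mono' (hA i) fun y hy => hK i x hx y hy).trans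
                    (setLIntegral_le_lintegral _ _)
        _ = ∫⁻ x in ⋃ i, A i, ∫⁻ y, K x y ∂μ ∂μ := by
            rw [lintegral_iUnion hA hdisj, tsum_fintype]
        _ ≤ _ := setLIntegral_le_lintegral _ _
    have h2 := ENNReal.toReal_mono hfin h1
    rw [← ENNReal.ofReal_sum_of_nonneg fun i _ => div_nonneg (sq_nonneg _) (hw i).le,
      ENNReal.toReal_ofReal (Finset.sum_nonneg fun i _ => div_nonneg (sq_nonneg _) (hw i).le)] at h2
    exact h2
  have hcs : (∑ i, p i) ^ 2 ≤ (∑ i, w i) * ∑ i, p i ^ 2 / w i :=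
    Finset.sum_sq_le_sum_mul_sum_of_sq_le_mul _ (fun i _ => (hw i).le)
      (fun i _ => div_nonneg (sq_nonneg _) (hw i).le) fun i _ => by
        rw [mul_div_cancel₀ _ (hw i).ne']
  rw [hsum, one_pow] at hcs
  exact hcs.trans (mul_le_mul_of_nonneg_left hI (Finset.sum_nonneg fun i _ => (hw i).le))

theorem truncatedKernel_antitone {ρ R σ u v : ℝ} (hρ : 0 < ρ) (hσ : 0 ≤ σ) (huv : u ≤ v) :
    truncatedKernel ρ R σ v ≤ truncatedKernel ρ R σ u := by
  by_cases h : v ≤ R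
  · rw [truncatedKernel, Set.indicator_of_mem (Set.mem_Iic.2 h),
      Set.indicator_of_mem (Set.mem_Iic.2 (huv.trans h))]
    exact Real.rpow_le_rpow (div_max_pos hρ _).le (div_max_antitone hρ huv) hσ
  · rw [truncatedKernel, Set.indicator_of_notMem (by simpa using h)]
    exact truncatedKernel_nonneg hρ

/-- A lower bound for the sum over a cover of the image of a measure by the energy of the image
measure for the truncated kernel. -/
theorem IsAdmissibleCover.rpow_le_mul_lintegral_truncatedKernel {n m : ℕ}
    {E : Set (EuclideanSpace ℝ (Fin n))} {μ : Measure (EuclideanSpace ℝ (Fin n))}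
    [IsProbabilityMeasure μ] (hμ : μ Eᶜ = 0)
    {f : EuclideanSpace ℝ (Fin n) → EuclideanSpace ℝ (Fin m)} (hf : Measurable f)
    {θ σ r ε ρ R : ℝ} {𝒰 : Finset (Set (EuclideanSpace ℝ (Fin m)))} (hr : 0 < r) (hσ : 0 ≤ σ)
    (h𝒰 : IsAdmissibleCover θ σ r ε (f '' E) 𝒰) (hρ : r ^ (1 / θ) ≤ ρ) (hR : r ≤ R) :
    (r ^ (1 / θ)) ^ σ ≤ ε *
      (∫⁻ x, ∫⁻ y, ENNReal.ofReal (truncatedKernel ρ R σ ‖f x - f y‖) ∂μ ∂μ).toReal := by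
  set ρ₀ := r ^ (1 / θ) with hρ₀
  have hρ₀pos : 0 < ρ₀ := Real.rpow_pos_of_pos hr _
  have hρpos : 0 < ρ := hρ₀pos.trans_le hρ
  set I := ∫⁻ x, ∫⁻ y, ENNReal.ofReal (truncatedKernel ρ R σ ‖f x - f y‖) ∂μ ∂μ with hI
  have hI1 : I ≤ 1 := by
    calc I ≤ ∫⁻ _, ∫⁻ _, 1 ∂μ ∂μ := lintegral_mono fun x => lintegral_mono fun y =>
          ENNReal.ofReal_le_one.2 (truncatedKernel_le_one hρpos hσ)
      _ = 1 := by simp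
  let e := 𝒰.equivFin.symm
  let V : Fin 𝒰.card → Set (EuclideanSpace ℝ (Fin n)) := fun i => f ⁻¹' closure (e i : Set _)
  have hV : ∀ i, MeasurableSet (V i) := fun i => hf isClosed_closure.measurableSet
  have hd : ∀ i, 0 < Metric.diam (e i : Set (EuclideanSpace ℝ (Fin m))) := fun i =>
    h𝒰.diam_pos hr (e i).2
  have key := one_le_sum_mul_lintegral (μ := μ) (A := disjointed V)
    (fun i => by
      rw [disjointed_apply, Finset.sup_set_eq_biUnion]
      exact (hV i).diff (Finset.measurableSet_biUnion _ fun j _ => hV j))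
    (disjoint_disjointed V)
    (hcov := by
      rw [iUnion_disjointed]
      refine (prob_compl_eq_zero_iff (MeasurableSet.iUnion hV)).1
        (measure_mono_null (Set.compl_subset_compl.2 fun x hx => ?_) hμ)
      obtain ⟨U, hU, hxU⟩ := Set.mem_iUnion₂.1 (h𝒰.1 (Set.mem_image_of_mem f hx))
      refine Set.mem_iUnion.2 ⟨𝒰.equivFin ⟨U, hU⟩, ?_⟩
      simpa [V, e] using subset_closure hxU)
    (w := fun i => Metric.diam (e i : Set (EuclideanSpace ℝ (Fin m))) ^ σ / ρ₀ ^ σ)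
    (fun i => by have := hd i; positivity)
    (K := fun x y => ENNReal.ofReal (truncatedKernel ρ R σ ‖f x - f y‖))
    (fun i x hx y hy => by
      refine ENNReal.ofReal_le_ofReal ?_
      -- an unbounded set would have `Metric.diam` equal to `0`
      have hbdd : Bornology.IsBounded (e i : Set (EuclideanSpace ℝ (Fin m))) := by
        by_contra hb
        exact (hd i).ne' (Metric.diam_eq_zero_of_unbounded hb)
      have hdist : ‖f x - f y‖ ≤ Metric.diam (e i : Set (EuclideanSpace ℝ (Fin m))) := by
        rw [← dist_eq_norm, ← Metric.diam_closure]
        exact Metric.dist_le_diam_of_mem hbdd.closure (disjointed_subset V i hx)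
          (disjointed_subset V i hy)
      have hdi := h𝒰.2.1 _ (e i).2
      refine le_trans ?_ (truncatedKernel_antitone hρpos hσ hdist)
      rw [truncatedKernel, Set.indicator_of_mem (Set.mem_Iic.2 (hdi.2.trans hR)), inv_div,
        ← Real.div_rpow hρ₀pos.le (hd i).le]
      refine Real.rpow_le_rpow (by have := hd i; positivity) ?_ hσ
      have := div_max_monotone (u := Metric.diam (e i : Set (EuclideanSpace ℝ (Fin m)))) hρ₀pos hρ
      rwa [max_eq_right hdi.1] at this)
    (ne_top_of_le_ne_top ENNReal.one_ne_top hI1)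
  have hsum : ∑ i, Metric.diam (e i : Set (EuclideanSpace ℝ (Fin m))) ^ σ =
      ∑ U ∈ 𝒰, Metric.diam U ^ σ := by
    rw [← Finset.sum_coe_sort 𝒰 fun U => Metric.diam U ^ σ]
    exact Equiv.sum_comp e fun U => Metric.diam (U : Set (EuclideanSpace ℝ (Fin m))) ^ σ
  rw [← Finset.sum_div, hsum, div_mul_eq_mul_div, one_le_div (by positivity)] at key
  exact key.trans (mul_le_mul_of_nonneg_right h𝒰.2.2 ENNReal.toReal_nonneg)

end CoverSum

section LowerBound

variable {Ω : Type*} [MeasurableSpace Ω] {P : Measure Ω} {n m : ℕ} {α θ : ℝ}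
  {B : EuclideanSpace ℝ (Fin n) → Ω → EuclideanSpace ℝ (Fin m)}

/-- If the expectations are summable, then the random variables tend to zero almost surely. -/
theorem ae_eventually_lt_one_of_tsum_lintegral_ne_top {X : ℕ → Ω → ℝ≥0∞}
    (hX : ∀ k, AEMeasurable (X k) P) (h : ∑' k, ∫⁻ ω, X k ω ∂P ≠ ⊤) :
    ∀ᵐ ω ∂P, ∀ᶠ k in atTop, X k ω < 1 := by
  rw [← lintegral_tsum hX] at h
  filter_upwards [ae_lt_top' (AEMeasurable.tsum hX) h] with ω hω
  exact (ENNReal.tendsto_atTop_zero_of_tsum_ne_top hω.ne).eventually_lt_const one_pos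

/-- A version of the process that is jointly measurable. -/
theorem IsFractionalBrownianMotion.exists_measurable_uncurry
    (hB : IsFractionalBrownianMotion P α B) :
    ∃ B' : EuclideanSpace ℝ (Fin n) → Ω → EuclideanSpace ℝ (Fin m),
      Measurable (Function.uncurry B') ∧ ∀ᵐ ω ∂P, ∀ x, B x ω = B' x ω := by
  classical
  obtain ⟨t, ht, htm, ht0⟩ := exists_measurable_superset_of_null (ae_iff.1 hB.continuous)
  refine ⟨fun x ω => if ω ∈ t then 0 else B x ω, ?_, ?_⟩
  · refine measurable_uncurry_of_continuous_of_measurable (fun ω => ?_) fun x =>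
      Measurable.ite htm measurable_const (hB.measurable x)
    by_cases h : ω ∈ t
    · simpa [h] using continuous_const
    · simp only [h, if_false]
      by_contra hc
      exact h (ht hc)
  · filter_upwards [measure_eq_zero_iff_ae_notMem.1 ht0] with ω hω x
    simp [hω]

/-- The expected energy of the image of a measure is at most a constant times the energy of the
measure. -/
theorem IsFractionalBrownianMotion.lintegral_energy_le [SFinite P]
    (hB : IsFractionalBrownianMotion P α B) (hm : 0 < m) (hα₀ : 0 < α)
    (hθ₁ : θ ≤ 1) {r s : ℝ} (hr : 0 < r) (hr1 : r ≤ 1) (hs : 0 ≤ s) (hst : s < m * α)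
    (μ : Measure (EuclideanSpace ℝ (Fin n))) [IsProbabilityMeasure μ] :
    AEMeasurable (fun ω => ∫⁻ x, ∫⁻ y, ENNReal.ofReal
        (truncatedKernel (r ^ α) (r ^ (θ * α)) (s / α) ‖B x ω - B y ω‖) ∂μ ∂μ) P ∧
      ∫⁻ ω, ∫⁻ x, ∫⁻ y, ENNReal.ofReal
        (truncatedKernel (r ^ α) (r ^ (θ * α)) (s / α) ‖B x ω - B y ω‖) ∂μ ∂μ ∂P ≤
      ENNReal.ofReal ((1 + 2 / (1 - s / α / m)) ^ m) * profileEnergy r θ s (m * α) μ := by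
  obtain ⟨B', hB'm, hB'⟩ := hB.exists_measurable_uncurry
  set ψ := truncatedKernel (r ^ α) (r ^ (θ * α)) (s / α)
  have hm3 : Measurable fun q : (Ω × EuclideanSpace ℝ (Fin n)) × EuclideanSpace ℝ (Fin n) =>
      ENNReal.ofReal (ψ ‖B' q.1.2 q.1.1 - B' q.2 q.1.1‖) := by
    have h1 : Measurable fun q : (Ω × EuclideanSpace ℝ (Fin n)) × EuclideanSpace ℝ (Fin n) =>
        B' q.1.2 q.1.1 := hB'm.comp (measurable_fst.snd.prodMk measurable_fst.fst)
    have h2 : Measurable fun q : (Ω × EuclideanSpace ℝ (Fin n)) × EuclideanSpace ℝ (Fin n) =>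
        B' q.2 q.1.1 := hB'm.comp (measurable_snd.prodMk measurable_fst.fst)
    exact (measurable_truncatedKernel.comp (h1.sub h2).norm).ennreal_ofReal
  have hm2 : Measurable fun q : Ω × EuclideanSpace ℝ (Fin n) =>
      ∫⁻ y, ENNReal.ofReal (ψ ‖B' q.2 q.1 - B' y q.1‖) ∂μ := hm3.lintegral_prod_right'
  have hcongr : (fun ω => ∫⁻ x, ∫⁻ y, ENNReal.ofReal (ψ ‖B x ω - B y ω‖) ∂μ ∂μ) =ᵐ[P]
      fun ω => ∫⁻ x, ∫⁻ y, ENNReal.ofReal (ψ ‖B' x ω - B' y ω‖) ∂μ ∂μ :=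
    hB'.mono fun ω hω => by simp only [hω]
  refine ⟨⟨_, hm2.lintegral_prod_right', hcongr⟩, ?_⟩
  rw [lintegral_congr_ae hcongr, lintegral_lintegral_swap hm2.aemeasurable, profileEnergy,
    ← lintegral_const_mul' _ _ ENNReal.ofReal_ne_top]
  refine lintegral_mono fun x => ?_
  rw [lintegral_lintegral_swap, ← lintegral_const_mul' _ _ ENNReal.ofReal_ne_top]
  · refine lintegral_mono fun y => ?_
    refine le_trans (le_of_eq (lintegral_congr_ae ?_))
      (hB.lintegral_truncatedKernel_le hm hα₀ hθ₁ hr hr1 hs hst x y)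
    filter_upwards [hB'] with ω hω
    rw [hω x, hω y]
  · exact (hm3.comp ((measurable_fst.prodMk measurable_const).prodMk measurable_snd)).aemeasurable

/-- Almost surely, the sums over all covers of the image at small scales are bounded below by the
capacities. -/
theorem IsFractionalBrownianMotion.ae_eventually_rpow_mul_profileCapacity_le [SFinite P]
    (hB : IsFractionalBrownianMotion P α B) (hm : 0 < m) (hα₀ : 0 < α)
    (hθ₀ : 0 < θ) (hθ₁ : θ ≤ 1) {E : Set (EuclideanSpace ℝ (Fin n))} (hE : IsCompact E)
    (hne : E.Nonempty) {s η : ℝ} (hs : 0 ≤ s) (hst : s < m * α) (hη : 0 < η) :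
    ∀ᵐ ω ∂P, ∀ᶠ r in 𝓝[>] 0, ∀ (ε : ℝ) (𝒰 : Finset (Set (EuclideanSpace ℝ (Fin m)))),
      IsAdmissibleCover θ (s / α) (r ^ (θ * α)) ε ((fun x => B x ω) '' E) 𝒰 →
        r ^ (s + η) * (profileCapacity r θ s (m * α) E).toReal ≤ ε := by
  set t : ℝ := m * α with ht
  set b : ℕ → ℝ := fun k => (1 / 2) ^ k with hb
  have hb0 : ∀ k, 0 < b k := fun k => by positivity
  have hb1 : ∀ k, b k ≤ 1 := fun k => pow_le_one₀ (by norm_num) (by norm_num)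
  set C : ℕ → ℝ≥0∞ := fun k => profileCapacity (b k) θ s t E with hC
  have hCtop : ∀ k, C k ≠ ⊤ := fun k =>
    profileCapacity_ne_top hE (hb0 k) (hb1 k) hθ₁ hs hst.le
  have hC1 : ∀ k, 1 ≤ C k := fun k =>
    one_le_profileCapacity hne (hb0 k) (hb1 k) hθ₁ hs hst.le
  have hC0 : ∀ k, C k ≠ 0 := fun k => (one_pos.trans_le (hC1 k)).ne'
  have hex : ∀ k, ∃ μ : Measure (EuclideanSpace ℝ (Fin n)), IsProbabilityMeasure μ ∧ μ Eᶜ = 0 ∧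
      profileEnergy (b k) θ s t μ < 2 * (C k)⁻¹ := fun k => by
    refine exists_profileEnergy_lt hE ?_
    rw [two_mul]
    exact ENNReal.lt_add_right (ENNReal.inv_ne_top.2 (hC0 k)) (ENNReal.inv_ne_zero.2 (hCtop k))
  choose μ hμ hμE hμI using hex
  set I : ℕ → Ω → ℝ≥0∞ := fun k ω => ∫⁻ x, ∫⁻ y, ENNReal.ofReal
    (truncatedKernel (b k ^ α) (b k ^ (θ * α)) (s / α) ‖B x ω - B y ω‖) ∂μ k ∂μ k with hI
  set K : ℝ≥0∞ := ENNReal.ofReal ((1 + 2 / (1 - s / α / m)) ^ m) with hK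
  set q : ℝ := (1 / 2) ^ (η / 2) with hq
  have hq0 : 0 < q := by positivity
  have hq1 : q < 1 := Real.rpow_lt_one (by norm_num) (by norm_num) (by linarith)
  have hbq : ∀ k, b k ^ (η / 2) = q ^ k := fun k => by
    change ((1 / 2 : ℝ) ^ k) ^ (η / 2) = _
    rw [hq, ← Real.rpow_natCast, ← Real.rpow_mul (by norm_num), ← Real.rpow_natCast,
      ← Real.rpow_mul (by norm_num), mul_comm]
  have hmain : ∀ k, AEMeasurable (I k) P ∧ ∫⁻ ω, I k ω ∂P ≤ K * (2 * (C k)⁻¹) := fun k => by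
    have := hμ k
    have h := hB.lintegral_energy_le hm hα₀ hθ₁ (hb0 k) (hb1 k) hs hst (μ k)
    exact ⟨h.1, h.2.trans (mul_le_mul_right (hμI k).le _)⟩
  -- the energies, normalized by a power of the scale, have a summable expectation
  have hae : ∀ᵐ ω ∂P, ∀ᶠ k in atTop, ENNReal.ofReal (q ^ k) * C k * I k ω < 1 := by
    refine ae_eventually_lt_one_of_tsum_lintegral_ne_top
      (fun k => (hmain k).1.const_mul _) (ne_top_of_le_ne_top (b := ∑' k,
        K * 2 * ENNReal.ofReal q ^ k) ?_
        (ENNReal.tsum_le_tsum fun k => ?_))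
    · rw [ENNReal.tsum_mul_left, ENNReal.tsum_geometric]
      refine ENNReal.mul_ne_top (ENNReal.mul_ne_top ENNReal.ofReal_ne_top (by norm_num)) ?_
      refine ENNReal.inv_ne_top.2 (tsub_pos_of_lt ?_).ne'
      exact ENNReal.ofReal_lt_one.2 hq1
    · rw [lintegral_const_mul' _ _ (ENNReal.mul_ne_top ENNReal.ofReal_ne_top (hCtop k))]
      refine (mul_le_mul_right (hmain k).2 _).trans (le_of_eq ?_)
      rw [ENNReal.ofReal_pow hq0.le]
      calc ENNReal.ofReal q ^ k * C k * (K * (2 * (C k)⁻¹))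
          = K * 2 * ENNReal.ofReal q ^ k * (C k * (C k)⁻¹) := by ring
        _ = _ := by rw [ENNReal.mul_inv_cancel (hC0 k) (hCtop k), mul_one]
  filter_upwards [hae, hB.continuous] with ω hω hcont
  obtain ⟨N, hN⟩ := eventually_atTop.1 hω
  have hsmall : ∀ᶠ r : ℝ in 𝓝[>] 0, r ^ (η / 2) < (2 ^ t)⁻¹ :=
    ((tendsto_rpow_nhdsGT_zero (half_pos hη)).eventually
      (eventually_nhdsGT_zero_lt (δ := (2 ^ t)⁻¹) (by positivity))).mono fun r hr => hr.2
  filter_upwards [eventually_nhdsGT_zero_lt one_pos, eventually_nhdsGT_zero_lt (hb0 N), hsmall]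
    with r ⟨hr, hr1⟩ ⟨_, hrN⟩ hrsmall ε 𝒰 h𝒰
  -- `r` is compared with the dyadic scale `b k` with `b k / 2 < r ≤ b k`
  obtain ⟨k, hk1, hk2⟩ := exists_nat_pow_near_of_lt_one hr hr1.le (y := (1 / 2 : ℝ)) (by norm_num)
    (by norm_num)
  have hkN : N ≤ k := by
    have : (1 / 2 : ℝ) ^ (k + 1) < (1 / 2) ^ N := hk1.trans hrN
    have := (pow_lt_pow_iff_right_of_lt_one₀ (by norm_num) (by norm_num)).1 this
    omega
  have hbk : b k ≤ 2 * r := by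
    have : b k = 2 * (1 / 2) ^ (k + 1) := by rw [hb]; simp only [pow_succ]; ring
    rw [this]; linarith
  have := hμ k
  have hcov := h𝒰.rpow_le_mul_lintegral_truncatedKernel (hμE k) hcont.measurable
    (Real.rpow_pos_of_pos hr _) (div_nonneg hs hα₀.le) (ρ := b k ^ α) (R := b k ^ (θ * α))
    (by
      rw [← Real.rpow_mul hr.le, show θ * α * (1 / θ) = α by field_simp]
      exact Real.rpow_le_rpow hr.le hk2 hα₀.le)
    (Real.rpow_le_rpow hr.le hk2 (by positivity))
  rw [← Real.rpow_mul hr.le, ← Real.rpow_mul hr.le,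
    show θ * α * (1 / θ) * (s / α) = s by field_simp] at hcov
  change r ^ s ≤ ε * (I k ω).toReal at hcov
  have hε0 : 0 ≤ ε :=
    (Finset.sum_nonneg fun U _ => Real.rpow_nonneg Metric.diam_nonneg _).trans h𝒰.2.2
  have hIlt : q ^ k * (C k).toReal * (I k ω).toReal ≤ 1 := by
    have h1 := ENNReal.toReal_mono ENNReal.one_ne_top (hN k hkN).le
    rwa [ENNReal.toReal_mul, ENNReal.toReal_mul, ENNReal.toReal_ofReal (by positivity),
      ENNReal.toReal_one] at h1
  have hCr : (profileCapacity r θ s t E).toReal ≤ 2 ^ t * (C k).toReal := by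
    have h1 := ENNReal.toReal_mono (ENNReal.mul_ne_top ENNReal.ofReal_ne_top (hCtop k))
      (profileCapacity_le_two_rpow_mul (E := E) hr hθ₀ hθ₁ hs hst.le hk2 (hb1 k) hbk)
    rwa [ENNReal.toReal_mul, ENNReal.toReal_ofReal (by positivity)] at h1
  have hrq : r ^ (η / 2) ≤ q ^ k := by
    rw [← hbq]
    exact Real.rpow_le_rpow hr.le hk2 (by linarith)
  have hrη := Real.rpow_pos_of_pos hr (η / 2)
  calc r ^ (s + η) * (profileCapacity r θ s t E).toReal
      ≤ r ^ (s + η) * (2 ^ t * (C k).toReal) :=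
        mul_le_mul_of_nonneg_left hCr (Real.rpow_nonneg hr.le _)
    _ = r ^ s * (r ^ (η / 2) * 2 ^ t) * (r ^ (η / 2) * (C k).toReal) := by
        rw [show s + η = s + (η / 2 + η / 2) by ring, Real.rpow_add hr, Real.rpow_add hr]; ring
    _ ≤ r ^ s * 1 * (q ^ k * (C k).toReal) := by
        refine mul_le_mul (mul_le_mul_of_nonneg_left ?_ (Real.rpow_nonneg hr.le _))
          (mul_le_mul_of_nonneg_right hrq ENNReal.toReal_nonneg) (by positivity)
          (by have := Real.rpow_pos_of_pos hr s; positivity)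
        rw [← le_div_iff₀ (by positivity), one_div]
        exact hrsmall.le
    _ ≤ ε * (I k ω).toReal * 1 * (q ^ k * (C k).toReal) := by gcongr
    _ = ε * (q ^ k * (C k).toReal * (I k ω).toReal) := by ring
    _ ≤ ε * 1 := mul_le_mul_of_nonneg_left hIlt hε0
    _ = ε := mul_one _

end LowerBound

/-! ### Hölder continuity of the paths -/

section Holder

variable {n : ℕ}

/-- The point of the dyadic lattice of mesh `2 ^ (-j)` with the integer coordinates `z`. -/
noncomputable def dyadicPoint (j : ℕ) (z : Fin n → ℤ) : EuclideanSpace ℝ (Fin n) :=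
  WithLp.toLp 2 fun i => z i / 2 ^ j

theorem norm_le_card_mul {n : ℕ} {x : EuclideanSpace ℝ (Fin n)} {c : ℝ} (h : ∀ i, |x i| ≤ c) :
    ‖x‖ ≤ n * c := by
  calc ‖x‖ ≤ ∑ i, |x i| := by
        rw [EuclideanSpace.norm_eq]
        refine (Real.sqrt_le_left (Finset.sum_nonneg fun i _ => abs_nonneg _)).2 ?_
        simpa using Finset.sum_sq_le_sq_sum_of_nonneg (s := Finset.univ) fun i _ => abs_nonneg (x i)
    _ ≤ ∑ _i : Fin n, c := Finset.sum_le_sum fun i _ => h i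
    _ = n * c := by simp

/-- The lower left corner of the dyadic cube of side `2 ^ (-j)` that contains `x`. -/
noncomputable def dyadicFloor (j : ℕ) (x : EuclideanSpace ℝ (Fin n)) : Fin n → ℤ :=
  fun i => ⌊2 ^ j * x i⌋

theorem norm_dyadicPoint_dyadicFloor_sub_le (j : ℕ) (x : EuclideanSpace ℝ (Fin n)) :
    ‖dyadicPoint j (dyadicFloor j x) - x‖ ≤ n * (1 / 2) ^ j := by
  refine norm_le_card_mul fun i => ?_
  have h1 := Int.floor_le (2 ^ j * x i)
  have h2 := Int.lt_floor_add_one (2 ^ j * x i)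
  have hp : (0 : ℝ) < 2 ^ j := by positivity
  have : (dyadicPoint j (dyadicFloor j x) - x) i = (⌊2 ^ j * x i⌋ - 2 ^ j * x i) / 2 ^ j := by
    simp only [dyadicPoint, dyadicFloor, PiLp.sub_apply]
    field_simp
  rw [this, abs_div, abs_of_pos hp, div_le_iff₀ hp, ← mul_pow]
  norm_num
  rw [abs_le]
  constructor <;> linarith

theorem tendsto_dyadicPoint_dyadicFloor (x : EuclideanSpace ℝ (Fin n)) :
    Tendsto (fun j => dyadicPoint j (dyadicFloor j x)) atTop (𝓝 x) := by
  rw [tendsto_iff_norm_sub_tendsto_zero]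
  refine squeeze_zero (fun j => norm_nonneg _)
    (fun j => norm_dyadicPoint_dyadicFloor_sub_le j x) ?_
  simpa using (tendsto_pow_atTop_nhds_zero_of_lt_one (r := (1 / 2 : ℝ)) (by norm_num)
    (by norm_num)).const_mul (n : ℝ)

theorem dyadicPoint_succ_two_mul (j : ℕ) (z : Fin n → ℤ) :
    dyadicPoint (j + 1) (fun i => 2 * z i) = dyadicPoint j z := by
  ext i
  simp only [dyadicPoint]
  push_cast
  rw [pow_succ]
  field_simp

/-- The integer vectors with entries of modulus at most `N`. -/
noncomputable def integerCube (n : ℕ) (N : ℤ) : Finset (Fin n → ℤ) :=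
  Fintype.piFinset fun _ => Finset.Icc (-N) N

theorem mem_integerCube {N : ℤ} {z : Fin n → ℤ} : z ∈ integerCube n N ↔ ∀ i, |z i| ≤ N := by
  simp [integerCube, abs_le]

theorem card_integerCube (N : ℕ) : (integerCube n (N : ℤ)).card = (2 * N + 1) ^ n := by
  have : (Finset.Icc (-(N : ℤ)) N).card = 2 * N + 1 := by
    rw [Int.card_Icc]; omega
  simp [integerCube, this]

theorem dyadicFloor_mem_integerCube {L : ℕ} {x : EuclideanSpace ℝ (Fin n)} (hx : ‖x‖ ≤ L) (j : ℕ) :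
    dyadicFloor j x ∈ integerCube n ((L * 2 ^ j : ℕ) : ℤ) := by
  refine mem_integerCube.2 fun i => ?_
  have h1 : |x i| ≤ L := (by simpa using PiLp.norm_apply_le x i : |x i| ≤ ‖x‖).trans hx
  rw [abs_le] at h1
  have hp : (0 : ℝ) < 2 ^ j := by positivity
  rw [abs_le, dyadicFloor, Int.le_floor, ← Int.lt_add_one_iff, Int.floor_lt]
  push_cast
  constructor <;> nlinarith

/-- Dyadic chaining: bounds for the increments between neighbouring points of all fine dyadic
lattices imply a Hölder bound for a continuous function. -/
theorem exists_holder_of_dyadic {g : EuclideanSpace ℝ (Fin n) → ℝ} (hg : Continuous g)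
    {E : Set (EuclideanSpace ℝ (Fin n))} (hE : IsCompact E) {L : ℕ} (hL : ∀ x ∈ E, ‖x‖ ≤ L)
    {a : ℝ} (ha : 0 < a) {J : ℕ}
    (h : ∀ j ≥ J, ∀ z ∈ integerCube n ((L * 2 ^ j : ℕ) : ℤ), ∀ e ∈ integerCube n 1,
      |g (dyadicPoint j (z + e)) - g (dyadicPoint j z)| ≤ ((1 / 2 : ℝ) ^ a) ^ j) :
    ∃ K : ℝ, 0 ≤ K ∧ ∀ x ∈ E, ∀ y ∈ E, |g x - g y| ≤ K * ‖x - y‖ ^ a := by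
  set q : ℝ := (1 / 2) ^ a with hq
  have hq0 : 0 < q := by positivity
  have hq1 : q < 1 := Real.rpow_lt_one (by norm_num) (by norm_num) ha
  have h1q : 0 < 1 - q := by linarith
  set G : ℕ → EuclideanSpace ℝ (Fin n) → ℝ := fun j x => g (dyadicPoint j (dyadicFloor j x)) with hG
  have hstep : ∀ x ∈ E, ∀ j ≥ J, |G j x - G (j + 1) x| ≤ q ^ j := by
    intro x hx j hj
    have h1 := h (j + 1) (by omega) _ (dyadicFloor_mem_integerCube (hL x hx) (j + 1))
      (fun i => 2 * dyadicFloor j x i - dyadicFloor (j + 1) x i) (mem_integerCube.2 fun i => by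
        have h1 := Int.floor_le (2 ^ j * x i)
        have h2 := Int.lt_floor_add_one (2 ^ j * x i)
        have h3 := Int.floor_le (2 ^ (j + 1) * x i)
        have h4 := Int.lt_floor_add_one (2 ^ (j + 1) * x i)
        have hpow : (2 : ℝ) ^ (j + 1) * x i = 2 * (2 ^ j * x i) := by rw [pow_succ]; ring
        simp only [dyadicFloor]
        rw [abs_le]
        have h5 : (2 * (⌊2 ^ j * x i⌋ : ℝ)) < ⌊2 ^ (j + 1) * x i⌋ + 1 := by linarith
        have h6 : (⌊2 ^ (j + 1) * x i⌋ : ℝ) < 2 * ⌊2 ^ j * x i⌋ + 2 := by linarith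
        have h5' : 2 * ⌊2 ^ j * x i⌋ < ⌊2 ^ (j + 1) * x i⌋ + 1 := by
          rw [← Int.cast_lt (R := ℝ)]; push_cast; exact h5
        have h6' : ⌊2 ^ (j + 1) * x i⌋ < 2 * ⌊2 ^ j * x i⌋ + 2 := by
          rw [← Int.cast_lt (R := ℝ)]; push_cast; exact h6
        constructor <;> omega)
    have h2 : (dyadicFloor (j + 1) x + fun i => 2 * dyadicFloor j x i - dyadicFloor (j + 1) x i) =
        fun i => 2 * dyadicFloor j x i := by
      ext i; simp
    rw [h2, dyadicPoint_succ_two_mul] at h1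
    exact h1.trans (pow_le_pow_of_le_one hq0.le hq1.le (Nat.le_succ j))
  have hlim : ∀ x ∈ E, ∀ j ≥ J, |G j x - g x| ≤ q ^ j / (1 - q) := by
    intro x hx j hj
    have h1 := dist_le_of_le_geometric_of_tendsto₀ q (q ^ j) hq1 (f := fun i => G (j + i) x)
      (a := g x) (fun i => by
        rw [Real.dist_eq, ← pow_add]
        exact hstep x hx (j + i) (by omega))
      ((hg.tendsto x).comp (((tendsto_dyadicPoint_dyadicFloor x).comp
        (tendsto_add_atTop_nat j)).congr fun i => by simp [add_comm]))
    simpa [Real.dist_eq] using h1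
  have hclose : ∀ x ∈ E, ∀ y ∈ E, ∀ j ≥ J, ‖x - y‖ ≤ (1 / 2) ^ j →
      |g x - g y| ≤ (1 + 2 / (1 - q)) * q ^ j := by
    intro x hx y hy j hj hxy
    have h1 := h j hj _ (dyadicFloor_mem_integerCube (hL x hx) j)
      (dyadicFloor j y - dyadicFloor j x) (mem_integerCube.2 fun i => by
        have h1 := Int.floor_le (2 ^ j * x i)
        have h2 := Int.lt_floor_add_one (2 ^ j * x i)
        have h3 := Int.floor_le (2 ^ j * y i)
        have h4 := Int.lt_floor_add_one (2 ^ j * y i)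
        have hp : (0 : ℝ) < 2 ^ j := by positivity
        have h0 : |x i - y i| ≤ (1 / 2) ^ j :=
          (by simpa using PiLp.norm_apply_le (x - y) i : |x i - y i| ≤ ‖x - y‖).trans hxy
        rw [one_div, inv_pow, ← one_div, le_div_iff₀ hp] at h0
        have h0' := abs_le.1 (by rwa [← abs_of_pos hp, ← abs_mul] at h0 :
          |(x i - y i) * 2 ^ j| ≤ 1)
        simp only [dyadicFloor, Pi.sub_apply]
        have h5 : (⌊2 ^ j * y i⌋ : ℝ) < ⌊2 ^ j * x i⌋ + 2 := by nlinarith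
        have h6 : (⌊2 ^ j * x i⌋ : ℝ) < ⌊2 ^ j * y i⌋ + 2 := by nlinarith
        have h5' : ⌊2 ^ j * y i⌋ < ⌊2 ^ j * x i⌋ + 2 := by
          rw [← Int.cast_lt (R := ℝ)]; push_cast; exact h5
        have h6' : ⌊2 ^ j * x i⌋ < ⌊2 ^ j * y i⌋ + 2 := by
          rw [← Int.cast_lt (R := ℝ)]; push_cast; exact h6
        rw [abs_le]
        constructor <;> omega)
    rw [add_sub_cancel] at h1
    have hx' := hlim x hx j hj
    have hy' := hlim y hy j hj
    rw [abs_sub_comm] at hx'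
    have : (1 + 2 / (1 - q)) * q ^ j = q ^ j / (1 - q) + q ^ j + q ^ j / (1 - q) := by
      field_simp; ring
    rw [this]
    change |G j y - G j x| ≤ q ^ j at h1
    rw [abs_le] at *
    constructor <;> linarith
  obtain ⟨M, hM⟩ := hE.exists_bound_of_continuousOn hg.continuousOn
  set K₁ : ℝ := (1 + 2 / (1 - q)) / q with hK₁
  set K₂ : ℝ := 2 * |M| / q ^ J with hK₂
  have hK₁0 : 0 ≤ K₁ := by positivity
  have hK₂0 : 0 ≤ K₂ := by positivity
  have hqpow : ∀ j : ℕ, q ^ j = ((1 / 2 : ℝ) ^ j) ^ a := fun j => by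
    rw [hq, ← Real.rpow_natCast, ← Real.rpow_natCast, ← Real.rpow_mul (by norm_num),
      ← Real.rpow_mul (by norm_num), mul_comm]
  refine ⟨K₁ + K₂, by positivity, fun x hx y hy => ?_⟩
  have hd := Real.rpow_nonneg (norm_nonneg (x - y)) a
  rcases le_or_gt ‖x - y‖ ((1 / 2) ^ J) with hle | hgt
  · rcases (norm_nonneg (x - y)).eq_or_lt with h0 | hpos
    · have : x = y := by rwa [eq_comm, norm_eq_zero, sub_eq_zero] at h0
      subst this
      simp only [sub_self, abs_zero]
      positivity
    obtain ⟨j, hj1, hj2⟩ := exists_nat_pow_near_of_lt_one hpos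
      (hle.trans (pow_le_one₀ (by norm_num) (by norm_num))) (y := (1 / 2 : ℝ)) (by norm_num)
      (by norm_num)
    have hjJ : J ≤ j := by
      have := (pow_lt_pow_iff_right_of_lt_one₀ (by norm_num) (by norm_num)).1 (hj1.trans_le hle)
      omega
    have h1 : q ^ (j + 1) ≤ ‖x - y‖ ^ a := by
      rw [hqpow]; exact Real.rpow_le_rpow (by positivity) hj1.le ha.le
    calc |g x - g y| ≤ (1 + 2 / (1 - q)) * q ^ j := hclose x hx y hy j hjJ hj2
      _ = K₁ * q ^ (j + 1) := by rw [hK₁, pow_succ]; field_simp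
      _ ≤ K₁ * ‖x - y‖ ^ a := mul_le_mul_of_nonneg_left h1 hK₁0
      _ ≤ _ := mul_le_mul_of_nonneg_right (by linarith) hd
  · have h1 : q ^ J ≤ ‖x - y‖ ^ a := by
      rw [hqpow]; exact Real.rpow_le_rpow (by positivity) hgt.le ha.le
    have h2 : |g x - g y| ≤ 2 * |M| := by
      have hx' := (hM x hx).trans (le_abs_self M)
      have hy' := (hM y hy).trans (le_abs_self M)
      rw [Real.norm_eq_abs] at hx' hy'
      exact (abs_sub _ _).trans (by linarith)
    calc |g x - g y| ≤ 2 * |M| := h2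
      _ = K₂ * q ^ J := by rw [hK₂]; field_simp
      _ ≤ K₂ * ‖x - y‖ ^ a := mul_le_mul_of_nonneg_left h1 hK₂0
      _ ≤ _ := mul_le_mul_of_nonneg_right (by linarith) hd

/-- The absolute moments of a centred normal variable scale with the standard deviation. -/
theorem lintegral_gaussianReal_enorm_pow (p : ℕ) {d : ℝ} (hd : 0 ≤ d) {v : ℝ≥0}
    (hv : (v : ℝ) = d ^ 2) :
    ∫⁻ x, ‖x‖ₑ ^ p ∂(gaussianReal 0 v) =
      ENNReal.ofReal d ^ p * ∫⁻ x, ‖x‖ₑ ^ p ∂(gaussianReal 0 1) := by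
  have h1 : gaussianReal 0 v = (gaussianReal 0 1).map (d * ·) := by
    rw [gaussianReal_map_const_mul, mul_zero, mul_one]
    congr 1
    exact NNReal.coe_injective hv
  rw [h1, lintegral_map (by fun_prop) (by fun_prop),
    ← lintegral_const_mul' _ _ (ENNReal.pow_ne_top ENNReal.ofReal_ne_top)]
  refine lintegral_congr fun x => ?_
  rw [enorm_mul, mul_pow, Real.enorm_of_nonneg hd]

theorem lintegral_gaussianReal_enorm_pow_ne_top (p : ℕ) :
    ∫⁻ x, ‖x‖ₑ ^ p ∂(gaussianReal 0 1) ≠ ⊤ := by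
  have h := (memLp_id_gaussianReal' (μ := 0) (v := 1) (p : ℝ≥0∞) (by simp))
  rcases p.eq_zero_or_pos with rfl | hp
  · simp
  have h2 := lintegral_rpow_enorm_lt_top_of_eLpNorm_lt_top (by exact_mod_cast hp.ne') (by simp) h.2
  simpa using h2.ne

variable {Ω : Type*} [MeasurableSpace Ω] {P : Measure Ω} {m : ℕ} {α θ : ℝ}

/-- A Kolmogorov criterion: a continuous real process with centred normal increments of standard
deviation `‖x - y‖ ^ α` is Hölder continuous on compact sets of every order below `α`. -/
theorem ae_exists_holder_of_hasLaw {X : EuclideanSpace ℝ (Fin n) → Ω → ℝ}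
    (hX : ∀ x, Measurable (X x)) (hcont : ∀ᵐ ω ∂P, Continuous fun x => X x ω) (hα₀ : 0 < α)
    (hlaw : ∀ x y, HasLaw (fun ω => X x ω - X y ω) (gaussianReal 0 (‖x - y‖₊ ^ (2 * α))) P)
    {E : Set (EuclideanSpace ℝ (Fin n))} (hE : IsCompact E) {a : ℝ} (ha : 0 < a) (haα : a < α) :
    ∀ᵐ ω ∂P, ∃ K : ℝ, 0 ≤ K ∧ ∀ x ∈ E, ∀ y ∈ E, |X x ω - X y ω| ≤ K * ‖x - y‖ ^ a := by
  obtain ⟨L, hL⟩ : ∃ L : ℕ, ∀ x ∈ E, ‖x‖ ≤ L := by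
    obtain ⟨C, hC⟩ := hE.isBounded.exists_norm_le
    obtain ⟨L, hL⟩ := exists_nat_ge C
    exact ⟨L, fun x hx => (hC x hx).trans hL⟩
  -- the moment is large enough to compensate for the number of lattice points
  obtain ⟨p, hp⟩ := exists_nat_ge ((n + 1) / (α - a))
  have hp' : (n : ℝ) + 1 ≤ p * (α - a) := by rwa [div_le_iff₀ (by linarith)] at hp
  have hp0 : p ≠ 0 := by
    rintro rfl
    have : (0 : ℝ) ≤ n := Nat.cast_nonneg n
    simp at hp'
    linarith
  set q : ℝ := (1 / 2) ^ a with hq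
  have hq0 : 0 < q := by positivity
  set c : ℝ≥0∞ := ∫⁻ x, ‖x‖ₑ ^ p ∂(gaussianReal 0 1) with hc
  have hctop : c ≠ ⊤ := lintegral_gaussianReal_enorm_pow_ne_top p
  have hmom : ∀ x y, ∫⁻ ω, ‖X x ω - X y ω‖ₑ ^ p ∂P = ENNReal.ofReal (‖x - y‖ ^ α) ^ p * c := by
    intro x y
    rw [(hlaw x y).lintegral_comp (f := fun z => ‖z‖ₑ ^ p) (by fun_prop)]
    refine lintegral_gaussianReal_enorm_pow p (by positivity) ?_
    rw [NNReal.coe_rpow, coe_nnnorm, ← Real.rpow_natCast, ← Real.rpow_mul (norm_nonneg _)]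
    congr 1
    push_cast
    ring
  set S : ℕ → Finset (Fin n → ℤ) := fun j => integerCube n ((L * 2 ^ j : ℕ) : ℤ) with hS
  set T : Finset (Fin n → ℤ) := integerCube n 1 with hT
  set Y : ℕ → Ω → ℝ≥0∞ := fun j ω => ∑ z ∈ S j, ∑ e ∈ T,
    ‖X (dyadicPoint j (z + e)) ω - X (dyadicPoint j z) ω‖ₑ ^ p with hY
  have hYm : ∀ j, Measurable (Y j) := fun j =>
    Finset.measurable_fun_sum _ fun z _ => Finset.measurable_fun_sum _ fun e _ =>
      (((hX _).sub (hX _)).enorm).pow_const p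
  set D : ℝ := ((2 * L + 1) ^ n * 3 ^ n * ((n : ℝ) ^ α) ^ p) with hD
  have hYint : ∀ j, ∫⁻ ω, Y j ω ∂P ≤ ENNReal.ofReal (D * q ^ (j * p) * (1 / 2) ^ j) * c := by
    intro j
    have hterm : ∀ z ∈ S j, ∀ e ∈ T,
        ∫⁻ ω, ‖X (dyadicPoint j (z + e)) ω - X (dyadicPoint j z) ω‖ₑ ^ p ∂P ≤
          ENNReal.ofReal (((n * (1 / 2) ^ j) ^ α) ^ p) * c := by
      intro z _ e he
      rw [hmom, ENNReal.ofReal_pow (by positivity)]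
      refine mul_le_mul_left (pow_le_pow_left' (ENNReal.ofReal_le_ofReal
        (Real.rpow_le_rpow (norm_nonneg _) (norm_le_card_mul fun i => ?_) hα₀.le)) p) c
      have hei : |(e i : ℝ)| ≤ 1 := by exact_mod_cast (mem_integerCube.1 he i)
      have : (dyadicPoint j (z + e) - dyadicPoint j z) i = e i * (1 / 2) ^ j := by
        simp only [dyadicPoint, PiLp.sub_apply, Pi.add_apply]
        push_cast
        rw [one_div, inv_pow]
        ring
      rw [this, abs_mul, abs_of_pos (by positivity : (0 : ℝ) < (1 / 2) ^ j)]
      exact mul_le_of_le_one_left (by positivity) hei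
    have hcard : ((S j).card : ℝ) ≤ (2 * L + 1) ^ n * (2 ^ j) ^ n := by
      rw [hS, card_integerCube, ← mul_pow]
      push_cast
      refine pow_le_pow_left₀ (by positivity) ?_ n
      have : (1 : ℝ) ≤ 2 ^ j := one_le_pow₀ (by norm_num)
      nlinarith
    have hTcard : (T.card : ℝ) = 3 ^ n := by
      have := card_integerCube (n := n) 1
      rw [hT]
      exact_mod_cast this
    have hm : ∀ z e, Measurable fun ω =>
        ‖X (dyadicPoint j (z + e)) ω - X (dyadicPoint j z) ω‖ₑ ^ p := fun z e =>
      (((hX _).sub (hX _)).enorm).pow_const p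
    calc ∫⁻ ω, Y j ω ∂P = ∑ z ∈ S j, ∑ e ∈ T,
          ∫⁻ ω, ‖X (dyadicPoint j (z + e)) ω - X (dyadicPoint j z) ω‖ₑ ^ p ∂P := by
          rw [lintegral_finsetSum _ fun z _ => Finset.measurable_fun_sum _ fun e _ => hm z e]
          exact Finset.sum_congr rfl fun z _ => lintegral_finsetSum _ fun e _ => hm z e
      _ ≤ ∑ z ∈ S j, ∑ e ∈ T, ENNReal.ofReal (((n * (1 / 2) ^ j) ^ α) ^ p) * c :=
          Finset.sum_le_sum fun z hz => Finset.sum_le_sum fun e he => hterm z hz e he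
      _ = ENNReal.ofReal ((S j).card * T.card * ((n * (1 / 2) ^ j) ^ α) ^ p) * c := by
          rw [Finset.sum_const, Finset.sum_const, nsmul_eq_mul, nsmul_eq_mul,
            ENNReal.ofReal_mul (by positivity), ENNReal.ofReal_mul (by positivity),
            ENNReal.ofReal_natCast, ENNReal.ofReal_natCast]
          ring
      _ ≤ _ := by
          refine mul_le_mul_left (ENNReal.ofReal_le_ofReal ?_) c
          have hkey : (2 ^ j) ^ n * (((1 / 2 : ℝ) ^ j) ^ α) ^ p ≤ q ^ (j * p) * (1 / 2) ^ j := by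
            have h2 : ((2 : ℝ) ^ j) ^ n = (1 / 2 : ℝ) ^ (-((j : ℝ) * n)) := by
              rw [Real.rpow_neg (by norm_num), ← Real.inv_rpow (by norm_num), ← pow_mul,
                ← Nat.cast_mul, Real.rpow_natCast]
              norm_num
            rw [h2, hq, ← Real.rpow_natCast, ← Real.rpow_natCast, ← Real.rpow_natCast,
              ← Real.rpow_mul (by norm_num), ← Real.rpow_mul (by norm_num),
              ← Real.rpow_mul (by norm_num), ← Real.rpow_add (by norm_num),
              ← Real.rpow_add (by norm_num)]
            refine Real.rpow_le_rpow_of_exponent_ge (by norm_num) (by norm_num) ?_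
            push_cast
            have hj : (0 : ℝ) ≤ j := Nat.cast_nonneg j
            nlinarith
          rw [hTcard, Real.mul_rpow (Nat.cast_nonneg n) (by positivity), mul_pow, hD]
          calc ((S j).card : ℝ) * 3 ^ n * (((n : ℝ) ^ α) ^ p * (((1 / 2 : ℝ) ^ j) ^ α) ^ p)
              ≤ ((2 * L + 1) ^ n * (2 ^ j) ^ n) * 3 ^ n *
                (((n : ℝ) ^ α) ^ p * (((1 / 2 : ℝ) ^ j) ^ α) ^ p) := by gcongr
            _ = (2 * L + 1) ^ n * 3 ^ n * ((n : ℝ) ^ α) ^ p *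
                ((2 ^ j) ^ n * (((1 / 2 : ℝ) ^ j) ^ α) ^ p) := by ring
            _ ≤ (2 * L + 1) ^ n * 3 ^ n * ((n : ℝ) ^ α) ^ p * (q ^ (j * p) * (1 / 2) ^ j) := by
                gcongr
            _ = _ := by ring
  have hD0 : 0 ≤ D := by positivity
  have hae : ∀ᵐ ω ∂P, ∀ᶠ j in atTop, ENNReal.ofReal (q ^ (j * p))⁻¹ * Y j ω < 1 := by
    refine ae_eventually_lt_one_of_tsum_lintegral_ne_top
      (fun j => ((hYm j).const_mul _).aemeasurable)
      (ne_top_of_le_ne_top (b := ∑' j, ENNReal.ofReal D * c * ENNReal.ofReal (1 / 2) ^ j) ?_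
        (ENNReal.tsum_le_tsum fun j => ?_))
    · rw [ENNReal.tsum_mul_left, ENNReal.tsum_geometric]
      refine ENNReal.mul_ne_top (ENNReal.mul_ne_top ENNReal.ofReal_ne_top hctop) ?_
      refine ENNReal.inv_ne_top.2 (tsub_pos_of_lt ?_).ne'
      exact ENNReal.ofReal_lt_one.2 (by norm_num)
    · rw [lintegral_const_mul' _ _ ENNReal.ofReal_ne_top]
      refine (mul_le_mul_right (hYint j) _).trans (le_of_eq ?_)
      rw [← mul_assoc, ← ENNReal.ofReal_mul (by positivity), ← ENNReal.ofReal_pow (by norm_num),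
        mul_right_comm (ENNReal.ofReal D) c, ← ENNReal.ofReal_mul hD0]
      congr 2
      have : q ^ (j * p) ≠ 0 := by positivity
      field_simp
  filter_upwards [hae, hcont] with ω hω hc
  obtain ⟨J, hJ⟩ := eventually_atTop.1 hω
  refine exists_holder_of_dyadic hc hE hL ha (J := J) fun j hj z hz e he => ?_
  have h1 : ‖X (dyadicPoint j (z + e)) ω - X (dyadicPoint j z) ω‖ₑ ^ p ≤ Y j ω :=
    (Finset.single_le_sum (f := fun e =>
      ‖X (dyadicPoint j (z + e)) ω - X (dyadicPoint j z) ω‖ₑ ^ p) (fun _ _ => zero_le) he).trans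
    (Finset.single_le_sum (f := fun z => ∑ e ∈ T,
      ‖X (dyadicPoint j (z + e)) ω - X (dyadicPoint j z) ω‖ₑ ^ p) (fun _ _ => zero_le) hz)
  have h2 : Y j ω ≤ ENNReal.ofReal (q ^ (j * p)) := by
    have h3 := (hJ j hj).le
    rwa [ENNReal.ofReal_inv_of_pos (by positivity), ← ENNReal.div_eq_inv_mul,
      ENNReal.div_le_iff (by simpa using (by positivity : 0 < q ^ (j * p))) ENNReal.ofReal_ne_top,
      one_mul] at h3
  have h3 := h1.trans h2
  rw [Real.enorm_eq_ofReal_abs, ← ENNReal.ofReal_pow (abs_nonneg _),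
    ENNReal.ofReal_le_ofReal_iff (by positivity), pow_mul] at h3
  exact le_of_pow_le_pow_left₀ hp0 (by positivity) h3

/-- The paths are almost surely Hölder continuous on compact sets of every order below `α`. -/
theorem IsFractionalBrownianMotion.ae_exists_holder
    {B : EuclideanSpace ℝ (Fin n) → Ω → EuclideanSpace ℝ (Fin m)}
    (hB : IsFractionalBrownianMotion P α B) (hα₀ : 0 < α)
    {E : Set (EuclideanSpace ℝ (Fin n))} (hE : IsCompact E) {a : ℝ} (ha : 0 < a) (haα : a < α) :
    ∀ᵐ ω ∂P, ∃ K : ℝ, ∀ x ∈ E, ∀ y ∈ E, ‖B x ω - B y ω‖ ≤ K * ‖x - y‖ ^ a := by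
  have h : ∀ i : Fin m, ∀ᵐ ω ∂P, ∃ K : ℝ, 0 ≤ K ∧ ∀ x ∈ E, ∀ y ∈ E,
      |B x ω i - B y ω i| ≤ K * ‖x - y‖ ^ a := fun i =>
    ae_exists_holder_of_hasLaw
      (fun x => (EuclideanSpace.proj (𝕜 := ℝ) i).continuous.measurable.comp (hB.measurable x))
      (hB.continuous.mono fun ω hω => (EuclideanSpace.proj (𝕜 := ℝ) i).continuous.comp hω)
      hα₀ (hB.increments i) hE ha haα
  filter_upwards [ae_all_iff.2 h] with ω hω
  choose K hK0 hK using hω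
  refine ⟨m * ∑ i, K i, fun x hx y hy => ?_⟩
  rw [mul_assoc]
  refine norm_le_card_mul fun i => ?_
  refine (hK i x hx y hy).trans (mul_le_mul_of_nonneg_right
    (Finset.single_le_sum (fun i _ => hK0 i) (Finset.mem_univ i)) (by positivity))

end Holder

/-! ### Measures with large potential and efficient covers -/

section Potential

variable {n : ℕ} {E : Set (EuclideanSpace ℝ (Fin n))} {r θ s t : ℝ}

/-- The potential of a measure for the kernel of the profiles. -/
noncomputable def profilePotential {n : ℕ} (r θ s t : ℝ) (μ : Measure (EuclideanSpace ℝ (Fin n)))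
    (x : EuclideanSpace ℝ (Fin n)) : ℝ≥0∞ :=
  ∫⁻ y, ENNReal.ofReal (profileKernel r θ s t (x - y)) ∂μ

theorem profilePotential_le_one {μ : Measure (EuclideanSpace ℝ (Fin n))} [IsProbabilityMeasure μ]
    (hr : 0 < r) (hr1 : r ≤ 1) (hθ₁ : θ ≤ 1) (hs : 0 ≤ s) (hst : s ≤ t)
    (x : EuclideanSpace ℝ (Fin n)) : profilePotential r θ s t μ x ≤ 1 := by
  calc profilePotential r θ s t μ x ≤ ∫⁻ _, 1 ∂μ := lintegral_mono fun y =>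
        ENNReal.ofReal_le_one.2 (profileKernel_le_one hr hr1 hθ₁ hs hst _)
    _ = 1 := by simp

theorem lintegral_smul_add_smul_dirac {X : Type*} [MeasurableSpace X] [MeasurableSingletonClass X]
    {μ : Measure X} (c d : ℝ≥0∞) (a : X) (g : X → ℝ≥0∞) :
    ∫⁻ x, g x ∂(c • μ + d • Measure.dirac a) = c * ∫⁻ x, g x ∂μ + d * g a := by
  rw [lintegral_add_measure, lintegral_smul_measure, lintegral_smul_measure, lintegral_dirac,
    smul_eq_mul, smul_eq_mul]

/-- The energy of a perturbation of `μ` towards the point mass at `a`. -/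
theorem profileEnergy_smul_add_smul_dirac {μ : Measure (EuclideanSpace ℝ (Fin n))} [SFinite μ]
    (hr : 0 < r) (hr1 : r ≤ 1) (hθ₁ : θ ≤ 1) (c d : ℝ≥0∞)
    (a : EuclideanSpace ℝ (Fin n)) :
    profileEnergy r θ s t (c • μ + d • Measure.dirac a) =
      c * c * profileEnergy r θ s t μ + 2 * (c * d) * profilePotential r θ s t μ a + d * d := by
  have hm : Measurable fun q : EuclideanSpace ℝ (Fin n) × EuclideanSpace ℝ (Fin n) =>
      ENNReal.ofReal (profileKernel r θ s t (q.1 - q.2)) :=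
    ((measurable_profileKernel hr hr1 hθ₁).comp (measurable_fst.sub measurable_snd)).ennreal_ofReal
  have hU : Measurable (profilePotential r θ s t μ) := hm.lintegral_prod_right'
  have hk : Measurable fun x => ENNReal.ofReal (profileKernel r θ s t (x - a)) :=
    ((measurable_profileKernel hr hr1 hθ₁).comp
      (measurable_id.sub measurable_const)).ennreal_ofReal
  have hsymm : ∫⁻ x, ENNReal.ofReal (profileKernel r θ s t (x - a)) ∂μ =
      profilePotential r θ s t μ a := by
    refine lintegral_congr fun x => ?_
    rw [profileKernel_eq_radialKernel hr hr1 hθ₁, profileKernel_eq_radialKernel hr hr1 hθ₁,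
      norm_sub_rev]
  have h0 : ENNReal.ofReal (profileKernel r θ s t (a - a)) = 1 := by
    rw [sub_self, profileKernel, norm_zero, if_pos hr, ENNReal.ofReal_one]
  have hinner : ∀ x, ∫⁻ y, ENNReal.ofReal (profileKernel r θ s t (x - y))
        ∂(c • μ + d • Measure.dirac a) =
      c * profilePotential r θ s t μ x + d * ENNReal.ofReal (profileKernel r θ s t (x - a)) :=
    fun x => lintegral_smul_add_smul_dirac c d a _
  have hmain : ∫⁻ x, (c * profilePotential r θ s t μ x +
      d * ENNReal.ofReal (profileKernel r θ s t (x - a))) ∂μ =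
      c * profileEnergy r θ s t μ + d * profilePotential r θ s t μ a := by
    rw [lintegral_add_left (hU.const_mul c), lintegral_const_mul c hU, lintegral_const_mul d hk,
      hsymm]
    rfl
  rw [profileEnergy, lintegral_congr hinner, lintegral_smul_add_smul_dirac, hmain, h0]
  ring

/-- There is a measure on `E` whose potential is everywhere on `E` at least half the minimal
energy: moving mass from a near-minimizer to a point where its potential is smaller would
decrease the energy below the minimum. -/
theorem exists_half_le_profilePotential (hE : IsCompact E) (hne : E.Nonempty) (hr : 0 < r)
    (hr1 : r ≤ 1) (hθ₁ : θ ≤ 1) (hs : 0 ≤ s) (hst : s ≤ t) :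
    ∃ μ : Measure (EuclideanSpace ℝ (Fin n)), IsProbabilityMeasure μ ∧ μ Eᶜ = 0 ∧
      ∀ x ∈ E, 1 / (2 * (profileCapacity r θ s t E).toReal) ≤
        (profilePotential r θ s t μ x).toReal := by
  have hC1 := one_le_toReal_profileCapacity hE hne hr hr1 hθ₁ hs hst
  have hCtop := profileCapacity_ne_top hE hr hr1 hθ₁ hs hst
  set V : ℝ := (profileCapacity r θ s t E).toReal⁻¹ with hV
  have hV0 : 0 < V := by positivity
  have hV1 : V ≤ 1 := inv_le_one_of_one_le₀ hC1
  have hVE : (profileCapacity r θ s t E)⁻¹ = ENNReal.ofReal V := by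
    rw [hV, ENNReal.ofReal_inv_of_pos (by linarith), ENNReal.ofReal_toReal hCtop]
  -- the mass to be moved; the errors below are of the order `d ^ 2`
  set d : ℝ := V / 4 with hd
  have hd0 : 0 < d := by positivity
  have hd1 : d ≤ 1 / 4 := by rw [hd]; linarith
  obtain ⟨μ, hμ, hμE, hμI⟩ := exists_profileEnergy_lt (r := r) (θ := θ) (s := s) (t := t) hE
    (e := ENNReal.ofReal (V + d ^ 2)) (by
      rw [hVE]
      exact (ENNReal.ofReal_lt_ofReal_iff (by positivity)).2 (lt_add_of_pos_right _
        (by positivity)))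
  refine ⟨μ, hμ, hμE, fun a ha => ?_⟩
  set U : ℝ := (profilePotential r θ s t μ a).toReal with hU
  have hUE : profilePotential r θ s t μ a = ENNReal.ofReal U :=
    (ENNReal.ofReal_toReal (ne_top_of_le_ne_top ENNReal.one_ne_top
      (profilePotential_le_one hr hr1 hθ₁ hs hst a))).symm
  have hU0 : 0 ≤ U := ENNReal.toReal_nonneg
  set ν := ENNReal.ofReal (1 - d) • μ + ENNReal.ofReal d • Measure.dirac a with hν
  have hνP : IsProbabilityMeasure ν := ⟨by
    rw [hν]
    simp only [Measure.add_apply, Measure.smul_apply, measure_univ, smul_eq_mul, mul_one]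
    rw [← ENNReal.ofReal_add (by linarith) hd0.le]
    simp⟩
  have hνE : ν Eᶜ = 0 := by
    rw [hν]
    simp [hμE, ha]
  have h1 := inv_profileCapacity_le_profileEnergy (r := r) (θ := θ) (s := s) (t := t) hE hνE
  rw [hVE, hν, profileEnergy_smul_add_smul_dirac hr hr1 hθ₁, hUE] at h1
  have h2 : ENNReal.ofReal V ≤ ENNReal.ofReal ((1 - d) * (1 - d) * (V + d ^ 2) +
      2 * ((1 - d) * d) * U + d * d) := by
    have h1d : 0 ≤ 1 - d := by linarith
    refine h1.trans ?_
    rw [ENNReal.ofReal_add (by positivity) (by positivity),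
      ENNReal.ofReal_add (by positivity) (by positivity), ENNReal.ofReal_mul (by positivity),
      ENNReal.ofReal_mul (by positivity), ENNReal.ofReal_mul (p :=
        2 * ((1 - d) * d)) (by positivity),
      ENNReal.ofReal_mul (p := 2) (by positivity), ENNReal.ofReal_mul (p := 1 - d) (by positivity),
      ENNReal.ofReal_mul (p := d) (by positivity)]
    gcongr
    simp
  rw [ENNReal.ofReal_le_ofReal_iff (by have : 0 ≤ 1 - d := by linarith
                                       positivity)] at h2
  have h3 : V - 3 / 2 * d ≤ U := by
    have h4 : d * (2 * V - 3 * d) ≤ d * (2 * U) := by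
      nlinarith [mul_nonneg (sq_nonneg d) hU0, mul_nonneg (sq_nonneg d) (sub_nonneg.2 hV1),
        mul_nonneg (pow_pos hd0 3).le (by linarith : 0 ≤ 2 - d)]
    have := le_of_mul_le_mul_left h4 hd0
    linarith
  rw [one_div, mul_inv, ← hV]
  linarith

/-- The dyadic pigeonhole: if the potential of `μ` at `x` is at least `v`, then some ball of
dyadic radius `2 ^ k * r` about `x` has large measure. -/
theorem exists_le_measureReal_closedBall {μ : Measure (EuclideanSpace ℝ (Fin n))}
    [IsProbabilityMeasure μ] (hr : 0 < r) (hr1 : r ≤ 1) (hθ₁ : θ ≤ 1) (hs : 0 ≤ s) (hst : s ≤ t)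
    {N : ℕ} {x : EuclideanSpace ℝ (Fin n)} (hN : ∀ᵐ y ∂μ, ‖x - y‖ ≤ 2 ^ N * r) :
    ∃ k ≤ N, (profilePotential r θ s t μ x).toReal ≤
      2 ^ t * (N + 1) * (radialKernel r θ s t (2 ^ k * r) *
        μ.real (Metric.closedBall x (2 ^ k * r))) := by
  set Φ := radialKernel r θ s t with hΦ
  have hΦ0 : ∀ u, 0 < Φ u := fun u => radialKernel_pos hr u
  have ht2 : (1 : ℝ) ≤ 2 ^ t := Real.one_le_rpow one_le_two (hs.trans hst)
  have hpt : ∀ y, ‖x - y‖ ≤ 2 ^ N * r → ENNReal.ofReal (profileKernel r θ s t (x - y)) ≤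
      ∑ k ∈ Finset.range (N + 1), ENNReal.ofReal (2 ^ t * Φ (2 ^ k * r)) *
        (Metric.closedBall x (2 ^ k * r)).indicator 1 y := by
    classical
    intro y hy
    have hex : ∃ k : ℕ, ‖x - y‖ ≤ 2 ^ k * r := ⟨N, hy⟩
    have hk := Nat.find_spec hex
    have hkN : Nat.find hex ≤ N := Nat.find_min' hex hy
    set k := Nat.find hex with hkdef
    refine le_trans ?_ (Finset.single_le_sum (f := fun k => ENNReal.ofReal (2 ^ t * Φ (2 ^ k * r)) *
        (Metric.closedBall x (2 ^ k * r)).indicator 1 y) (fun _ _ => zero_le)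
        (Finset.mem_range.2 (Nat.lt_succ_of_le hkN)))
    have hmem : y ∈ Metric.closedBall x (2 ^ k * r) := by
      rwa [Metric.mem_closedBall, dist_comm, dist_eq_norm]
    simp only [Set.indicator_of_mem hmem, Pi.one_apply, mul_one]
    refine ENNReal.ofReal_le_ofReal ?_
    rw [profileKernel_eq_radialKernel hr hr1 hθ₁]
    rcases Nat.eq_zero_or_pos k with h0 | hpos
    · have h1 : Φ (2 ^ k * r) = 1 := by
        rw [h0, pow_zero, one_mul, hΦ, radialKernel, max_self, div_self hr.ne',
          max_eq_left (le_rpow_self_of_le_one hr hr1 hθ₁),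
          div_self (Real.rpow_pos_of_pos hr _).ne', Real.one_rpow, Real.one_rpow, mul_one]
      rw [h1, mul_one]
      exact (radialKernel_le_one hr hs hst _).trans ht2
    · have hlt : 2 ^ (k - 1) * r < ‖x - y‖ := not_le.1 (Nat.find_min hex (Nat.sub_lt hpos one_pos))
      have h2 : (2 : ℝ) ^ k * r = 2 * (2 ^ (k - 1) * r) := by
        rw [← mul_assoc, ← pow_succ', Nat.sub_add_cancel hpos]
      rw [h2]
      exact (radialKernel_antitone hr hs hst hlt.le).trans
        (radialKernel_le_mul hr hs hst one_le_two)
  have hint : profilePotential r θ s t μ x ≤ ∑ k ∈ Finset.range (N + 1),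
      ENNReal.ofReal (2 ^ t * Φ (2 ^ k * r) * μ.real (Metric.closedBall x (2 ^ k * r))) := by
    refine (lintegral_mono_ae (hN.mono hpt)).trans (le_of_eq ?_)
    have hmi : ∀ k : ℕ, Measurable
        ((Metric.closedBall x (2 ^ k * r)).indicator (1 : EuclideanSpace ℝ (Fin n) → ℝ≥0∞)) :=
      fun k => measurable_one.indicator Metric.isClosed_closedBall.measurableSet
    rw [lintegral_finsetSum _ fun k _ => (hmi k).const_mul _]
    refine Finset.sum_congr rfl fun k _ => ?_
    rw [lintegral_const_mul _ (hmi k),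
      lintegral_indicator_one Metric.isClosed_closedBall.measurableSet,
      ENNReal.ofReal_mul (p := 2 ^ t * Φ (2 ^ k * r)) (by have := hΦ0 (2 ^ k * r); positivity),
      ofReal_measureReal]
  rw [← ENNReal.ofReal_sum_of_nonneg fun k _ => by have := hΦ0 (2 ^ k * r); positivity] at hint
  have hreal := ENNReal.toReal_mono ENNReal.ofReal_ne_top hint
  rw [ENNReal.toReal_ofReal (Finset.sum_nonneg fun k _ => by
    have := hΦ0 (2 ^ k * r); positivity)] at hreal
  by_contra! hcon
  have hlt : ∑ k ∈ Finset.range (N + 1),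
      2 ^ t * Φ (2 ^ k * r) * μ.real (Metric.closedBall x (2 ^ k * r)) <
      ∑ _k ∈ Finset.range (N + 1), (profilePotential r θ s t μ x).toReal / (N + 1) := by
    refine Finset.sum_lt_sum_of_nonempty (by simp) fun k hk => ?_
    rw [lt_div_iff₀ (by positivity)]
    have := hcon k (Nat.lt_succ_iff.1 (Finset.mem_range.1 hk))
    linarith
  rw [Finset.sum_const, Finset.card_range, nsmul_eq_mul] at hlt
  push_cast at hlt
  rw [mul_div_cancel₀ _ (by positivity)] at hlt
  linarith

/-- A finite cover of `E` by balls of dyadic radii between `r` and the diameter of `E`, for which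
the sum of the reciprocals of the values of the kernel at the radii is at most of the order of the
capacity, up to the number of dyadic scales. -/
theorem exists_finset_closedBall_cover (hE : IsCompact E) (hne : E.Nonempty) (hr : 0 < r)
    (hr1 : r ≤ 1) (hθ₁ : θ ≤ 1) (hs : 0 ≤ s) (hst : s ≤ t) {N : ℕ}
    (hN : ∀ x ∈ E, ∀ y ∈ E, ‖x - y‖ ≤ 2 ^ N * r) :
    ∃ (u : Finset (EuclideanSpace ℝ (Fin n))) (ρ : EuclideanSpace ℝ (Fin n) → ℝ),
      (∀ x ∈ u, x ∈ E ∧ r ≤ ρ x) ∧ (E ⊆ ⋃ x ∈ u, Metric.closedBall x (5 * ρ x)) ∧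
      ∑ x ∈ u, (radialKernel r θ s t (ρ x))⁻¹ ≤
        2 ^ (t + 1) * (N + 1) * (profileCapacity r θ s t E).toReal := by
  classical
  set Φ := radialKernel r θ s t with hΦ
  have hΦ0 : ∀ u, 0 < Φ u := fun u => radialKernel_pos hr u
  set C := (profileCapacity r θ s t E).toReal with hC
  have hC1 : 1 ≤ C := one_le_toReal_profileCapacity hE hne hr hr1 hθ₁ hs hst
  obtain ⟨μ, hμ, hpot⟩ : ∃ μ : Measure (EuclideanSpace ℝ (Fin n)), IsProbabilityMeasure μ ∧
      (∀ x ∈ E, ∃ k ≤ N, (2 ^ (t + 1) * (N + 1) * C)⁻¹ ≤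
        Φ (2 ^ k * r) * μ.real (Metric.closedBall x (2 ^ k * r))) := by
    obtain ⟨μ, hμ, hμE, hpot⟩ := exists_half_le_profilePotential hE hne hr hr1 hθ₁ hs hst
    refine ⟨μ, hμ, fun x hx => ?_⟩
    have hae : ∀ᵐ y ∂μ, y ∈ E :=
      (measure_eq_zero_iff_ae_notMem.1 hμE).mono fun y hy => by simpa using hy
    obtain ⟨k, hkN, hk⟩ := exists_le_measureReal_closedBall (μ := μ) hr hr1 hθ₁ hs hst
      (hae.mono fun y hy => hN x hx y hy)
    refine ⟨k, hkN, ?_⟩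
    have h1 := (hpot x hx).trans hk
    rw [inv_le_iff_one_le_mul₀ (by positivity)]
    rw [div_le_iff₀ (by positivity)] at h1
    refine h1.trans (le_of_eq ?_)
    rw [Real.rpow_add two_pos, Real.rpow_one]
    ring
  set c := (2 ^ (t + 1) * (N + 1) * C)⁻¹ with hc
  have hc0 : 0 < c := by positivity
  choose! k hkN hk using hpot
  set ρ : EuclideanSpace ℝ (Fin n) → ℝ := fun x => 2 ^ k x * r with hρ
  have hrρ : ∀ x, r ≤ ρ x := fun x => le_mul_of_one_le_left hr.le (one_le_pow₀ one_le_two)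
  obtain ⟨u, huE, hdisj, hcov⟩ := Vitali.exists_disjoint_subfamily_covering_enlargement_closedBall
    E (fun x => x) ρ (2 ^ N * r) (fun x hx => mul_le_mul_of_nonneg_right
      (pow_le_pow_right₀ one_le_two (hkN x hx)) hr.le) 5 (by norm_num)
  have hmass : ∀ x ∈ u, c * (Φ (ρ x))⁻¹ ≤ μ.real (Metric.closedBall x (ρ x)) := fun x hx => by
    rw [← div_eq_mul_inv, div_le_iff₀ (hΦ0 _), mul_comm]
    exact hk x (huE hx)
  -- each ball of the disjoint family has mass at least `c`
  have hfin : u.Finite := by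
    have h1 := Measure.finite_const_le_meas_of_disjoint_iUnion μ (ι := u)
      (As := fun x => Metric.closedBall (x : EuclideanSpace ℝ (Fin n)) (ρ x))
      (ENNReal.ofReal_pos.2 hc0) (fun x => Metric.isClosed_closedBall.measurableSet)
      (fun x y hxy => hdisj x.2 y.2 (Subtype.coe_injective.ne hxy)) (measure_ne_top _ _)
    rw [← Set.finite_coe_iff]
    refine Set.finite_univ_iff.1 (h1.subset fun x _ => ?_)
    change ENNReal.ofReal c ≤ μ (Metric.closedBall (x : EuclideanSpace ℝ (Fin n)) (ρ x))
    rw [← ofReal_measureReal]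
    refine ENNReal.ofReal_le_ofReal (le_trans ?_ (hmass x x.2))
    exact le_mul_of_one_le_right hc0.le
      ((one_le_inv₀ (hΦ0 _)).2 (radialKernel_le_one hr hs hst _))
  refine ⟨hfin.toFinset, ρ, fun x hx => ⟨huE (hfin.mem_toFinset.1 hx), hrρ x⟩, fun x hx => ?_, ?_⟩
  · obtain ⟨y, hy, hsub⟩ := hcov x hx
    exact Set.mem_iUnion₂.2 ⟨y, hfin.mem_toFinset.2 hy,
      hsub (Metric.mem_closedBall_self (hr.le.trans (hrρ x)))⟩
  · have h1 : ∑ x ∈ hfin.toFinset, μ.real (Metric.closedBall x (ρ x)) ≤ 1 := by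
      rw [← measureReal_biUnion_finset (fun x hx y hy hxy => hdisj (hfin.mem_toFinset.1 hx)
        (hfin.mem_toFinset.1 hy) hxy) fun x _ => Metric.isClosed_closedBall.measurableSet]
      exact measureReal_le_one
    have h2 : c * ∑ x ∈ hfin.toFinset, (Φ (ρ x))⁻¹ ≤ 1 := by
      rw [Finset.mul_sum]
      exact (Finset.sum_le_sum fun x hx => hmass x (hfin.mem_toFinset.1 hx)).trans h1
    rw [hc, inv_mul_le_iff₀ (by positivity), mul_one] at h2
    exact h2

end Potential

/-! ### The upper bound for the sums over suitable covers -/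

section ImageCover

/-- A ball of radius `A` in `ℝᵐ` is covered by at most a constant times `(A / δ) ^ m` sets of
diameter exactly `δ`. -/
theorem exists_finset_cover_closedBall {m : ℕ} (hm : 0 < m) (y : EuclideanSpace ℝ (Fin m))
    {A δ : ℝ} (hδ : 0 < δ) (hδA : δ ≤ A) :
    ∃ 𝒢 : Finset (Set (EuclideanSpace ℝ (Fin m))),
      (Metric.closedBall y A ⊆ ⋃ G ∈ 𝒢, G) ∧ (∀ G ∈ 𝒢, Metric.diam G = δ) ∧
      (𝒢.card : ℝ) ≤ ((4 * m + 5) * (A / δ)) ^ m := by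
  classical
  have hm' : (0 : ℝ) < m := by exact_mod_cast hm
  have : Nonempty (Fin m) := ⟨⟨0, hm⟩⟩
  have : Nontrivial (EuclideanSpace ℝ (Fin m)) := inferInstance
  have hA : 0 < A := hδ.trans_le hδA
  set h : ℝ := δ / (2 * m) with hh
  have hh0 : 0 < h := by positivity
  set N : ℕ := ⌈A / h⌉₊ + 1 with hN
  have hN1 : A / h + 1 ≤ N := by
    rw [hN]; push_cast; linarith [Nat.le_ceil (A / h)]
  have hN2 : (N : ℝ) ≤ A / h + 2 := by
    rw [hN]; push_cast; linarith [Nat.ceil_lt_add_one (by positivity : 0 ≤ A / h)]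
  refine ⟨(integerCube m (N : ℤ)).image fun z =>
    Metric.closedBall (y + WithLp.toLp 2 fun i => h * (z i : ℝ)) (δ / 2), ?_, ?_, ?_⟩
  · intro w hw
    rw [Metric.mem_closedBall, dist_eq_norm] at hw
    set z : Fin m → ℤ := fun i => ⌊(w - y) i / h⌋ with hz
    have hcoord : ∀ i, |(w - y) i / h| ≤ A / h := fun i => by
      rw [abs_div, abs_of_pos hh0]
      refine div_le_div_of_nonneg_right ?_ hh0.le
      exact (by simpa using PiLp.norm_apply_le (w - y) i : |(w - y) i| ≤ ‖w - y‖).trans hw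
    refine Set.mem_iUnion₂.2 ⟨_, Finset.mem_image_of_mem _ (mem_integerCube.2 fun i => ?_ :
      z ∈ integerCube m (N : ℤ)), ?_⟩
    · have h1 := Int.floor_le ((w - y) i / h)
      have h2 := Int.lt_floor_add_one ((w - y) i / h)
      have h3 := abs_le.1 (hcoord i)
      have h4 : |(⌊(w - y) i / h⌋ : ℝ)| ≤ N := by
        rw [abs_le]; constructor <;> linarith
      exact_mod_cast h4
    · rw [Metric.mem_closedBall, dist_eq_norm]
      have h5 : ‖w - (y + WithLp.toLp 2 fun i => h * (z i : ℝ))‖ ≤ m * h := by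
        refine norm_le_card_mul fun i => ?_
        have h1 := Int.floor_le ((w - y) i / h)
        have h2 := Int.lt_floor_add_one ((w - y) i / h)
        have h3 : (w - (y + WithLp.toLp 2 fun i => h * (z i : ℝ))) i =
            h * ((w - y) i / h - ⌊(w - y) i / h⌋) := by
          rw [mul_sub, mul_div_cancel₀ _ hh0.ne']
          simp only [PiLp.sub_apply, PiLp.add_apply, hz]
          ring
        rw [h3, abs_mul, abs_of_pos hh0]
        refine mul_le_of_le_one_right hh0.le ?_
        rw [abs_le]; constructor <;> linarith
      refine h5.trans (le_of_eq ?_)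
      rw [hh]; field_simp
  · intro G hG
    obtain ⟨z, _, rfl⟩ := Finset.mem_image.1 hG
    rw [Metric.diam_closedBall_eq _ (by positivity)]
    ring
  · calc (Finset.card _ : ℝ) ≤ ((integerCube m (N : ℤ)).card : ℝ) := by
          exact_mod_cast Finset.card_image_le
      _ = (2 * N + 1) ^ m := by rw [card_integerCube]; push_cast; rfl
      _ ≤ _ := by
          refine pow_le_pow_left₀ (by positivity) ?_ m
          have h1 : 1 ≤ A / δ := (one_le_div hδ).2 hδA
          have h2 : A / h = 2 * m * (A / δ) := by rw [hh]; field_simp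
          rw [h2] at hN2
          nlinarith

theorem sum_biUnion_le_sum {ι κ : Type*} [DecidableEq ι] [DecidableEq κ] (u : Finset ι)
    (𝒢 : ι → Finset κ) {f : κ → ℝ} (hf : ∀ i ∈ u, ∀ k ∈ 𝒢 i, 0 ≤ f k) :
    ∑ k ∈ u.biUnion 𝒢, f k ≤ ∑ i ∈ u, ∑ k ∈ 𝒢 i, f k := by
  induction u using Finset.induction_on with
  | empty => simp
  | insert a u ha ih =>
    rw [Finset.biUnion_insert, Finset.sum_insert ha]
    have h1 := Finset.sum_union_inter (s₁ := 𝒢 a) (s₂ := u.biUnion 𝒢) (f := f)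
    have h2 : 0 ≤ ∑ k ∈ 𝒢 a ∩ u.biUnion 𝒢, f k := Finset.sum_nonneg fun k hk =>
      hf a (Finset.mem_insert_self a u) k (Finset.mem_inter.1 hk).1
    have h3 := ih fun i hi => hf i (Finset.mem_insert_of_mem hi)
    linarith

/-- The value of `(R ^ α / δ) ^ m * δ ^ (s / α)` at `δ = min R (r ^ θ) ^ α`, in terms of the kernel.
-/
theorem rpow_div_pow_mul_rpow_eq {m : ℕ} {α θ r s R : ℝ} (hα : 0 < α) (hr : 0 < r) (hrR : r ≤ R) :
    (R ^ α / (min R (r ^ θ)) ^ α) ^ m * ((min R (r ^ θ)) ^ α) ^ (s / α) =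
      r ^ s * (radialKernel r θ s (m * α) R)⁻¹ := by
  have hR : 0 < R := hr.trans_le hrR
  have hrθ := Real.rpow_pos_of_pos hr θ
  have hmin : 0 < min R (r ^ θ) := lt_min hR hrθ
  have hmm : min R (r ^ θ) * max (r ^ θ) R = R * r ^ θ := by rw [max_comm, min_mul_max]
  have hmax : 0 < max (r ^ θ) R := lt_max_of_lt_right hR
  have hq : r ^ θ / max (r ^ θ) R = min R (r ^ θ) / R := by
    rw [div_eq_div_iff hmax.ne' hR.ne', hmm, mul_comm]
  rw [radialKernel, max_eq_right hrR, hq, ← Real.div_rpow hR.le hmin.le, ← Real.rpow_natCast,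
    ← Real.rpow_mul (by positivity), ← Real.rpow_mul hmin.le, mul_div_cancel₀ _ hα.ne',
    mul_comm α, mul_inv, Real.div_rpow hr.le hR.le, inv_div, ← Real.inv_rpow (by positivity),
      inv_div,
    Real.div_rpow hR.le hmin.le, Real.div_rpow hR.le hmin.le, Real.rpow_sub hR, Real.rpow_sub hmin]
  have h1 := Real.rpow_pos_of_pos hr s
  have h2 := Real.rpow_pos_of_pos hR s
  have h3 := Real.rpow_pos_of_pos hmin s
  have h4 := Real.rpow_pos_of_pos hR (m * α)
  have h5 := Real.rpow_pos_of_pos hmin (m * α)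
  field_simp

/-- A Hölder map of order `a` slightly below `α` transports the cover of
`exists_finset_closedBall_cover` to an admissible cover of the image. -/
theorem exists_isAdmissibleCover_image {n m : ℕ} (hm : 0 < m)
    {E : Set (EuclideanSpace ℝ (Fin n))} (hE : IsCompact E) (hne : E.Nonempty)
    {f : EuclideanSpace ℝ (Fin n) → EuclideanSpace ℝ (Fin m)} {α a K θ r s : ℝ}
    (ha : 0 < a) (haα : a ≤ α) (hf : ∀ x ∈ E, ∀ y ∈ E, ‖f x - f y‖ ≤ K * ‖x - y‖ ^ a)
    (hθ₀ : 0 < θ) (hθ₁ : θ ≤ 1) (hr : 0 < r) (hr1 : r ≤ 1) (hs : 0 ≤ s) (hst : s ≤ m * α) {N : ℕ}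
    (hN : ∀ x ∈ E, ∀ y ∈ E, ‖x - y‖ ≤ 2 ^ N * r) :
    ∃ 𝒰 : Finset (Set (EuclideanSpace ℝ (Fin m))), IsAdmissibleCover θ (s / α) (r ^ (θ * α))
      (((4 * m + 5) * (max 1 (|K| * 5 ^ a) * r ^ (-(α - a)))) ^ m * 2 ^ (m * α + 1) * (N + 1) *
        (r ^ s * (profileCapacity r θ s (m * α) E).toReal)) (f '' E) 𝒰 := by
  classical
  have hα : 0 < α := ha.trans_le haα
  obtain ⟨u, ρ, hu, hcov, hsum⟩ := exists_finset_closedBall_cover hE hne hr hr1 hθ₁ hs hst hN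
  have hrθ := Real.rpow_pos_of_pos hr θ
  set κ : ℝ := max 1 (|K| * 5 ^ a) * r ^ (-(α - a)) with hκ
  have hκ1 : 1 ≤ κ := by
    have h1 : (1 : ℝ) ≤ r ^ (-(α - a)) :=
      Real.one_le_rpow_of_pos_of_le_one_of_nonpos hr hr1 (by linarith)
    exact one_le_mul_of_one_le_of_one_le (le_max_left _ _) h1
  set δ : EuclideanSpace ℝ (Fin n) → ℝ := fun x => (min (ρ x) (r ^ θ)) ^ α with hδ
  have hρ0 : ∀ x ∈ u, 0 < ρ x := fun x hx => hr.trans_le (hu x hx).2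
  have hδ0 : ∀ x ∈ u, 0 < δ x := fun x hx => Real.rpow_pos_of_pos (lt_min (hρ0 x hx) hrθ) _
  have hδρ : ∀ x ∈ u, δ x ≤ ρ x ^ α := fun x hx =>
    Real.rpow_le_rpow (lt_min (hρ0 x hx) hrθ).le (min_le_left _ _) hα.le
  have hball : ∀ x ∈ u, ∃ 𝒢 : Finset (Set (EuclideanSpace ℝ (Fin m))),
      (Metric.closedBall (f x) (κ * ρ x ^ α) ⊆ ⋃ G ∈ 𝒢, G) ∧ (∀ G ∈ 𝒢, Metric.diam G = δ x) ∧
      (𝒢.card : ℝ) ≤ ((4 * m + 5) * (κ * ρ x ^ α / δ x)) ^ m := fun x hx =>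
    exists_finset_cover_closedBall hm (f x) (hδ0 x hx) ((hδρ x hx).trans
      (le_mul_of_one_le_left (Real.rpow_nonneg (hρ0 x hx).le _) hκ1))
  choose! 𝒢 h𝒢cov h𝒢diam h𝒢card using hball
  have hscale : (r ^ (θ * α)) ^ (1 / θ) = r ^ α := by
    rw [← Real.rpow_mul hr.le]; congr 1; field_simp
  refine ⟨u.biUnion 𝒢, ?_, ?_, ?_⟩
  · rintro _ ⟨y, hy, rfl⟩
    obtain ⟨x, hx, hyx⟩ := Set.mem_iUnion₂.1 (hcov hy)
    have hfy : f y ∈ Metric.closedBall (f x) (κ * ρ x ^ α) := by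
      rw [Metric.mem_closedBall, dist_eq_norm] at hyx ⊢
      have hρx := hρ0 x hx
      -- the loss from the smaller Hölder exponent is at most a power of `r`, since `r ≤ ρ x`
      have hpow : ρ x ^ a ≤ ρ x ^ α * r ^ (-(α - a)) := by
        calc ρ x ^ a = ρ x ^ α * ρ x ^ (-(α - a)) := by rw [← Real.rpow_add hρx]; ring_nf
          _ ≤ _ := mul_le_mul_of_nonneg_left (Real.rpow_le_rpow_of_nonpos hr (hu x hx).2
              (by linarith)) (by positivity)
      calc ‖f y - f x‖ ≤ K * ‖y - x‖ ^ a := hf y hy x (hu x hx).1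
        _ ≤ |K| * (5 * ρ x) ^ a := mul_le_mul (le_abs_self K)
            (Real.rpow_le_rpow (norm_nonneg _) hyx ha.le) (by positivity) (abs_nonneg K)
        _ = |K| * 5 ^ a * ρ x ^ a := by rw [Real.mul_rpow (by norm_num) hρx.le]; ring
        _ ≤ max 1 (|K| * 5 ^ a) * (ρ x ^ α * r ^ (-(α - a))) :=
            mul_le_mul (le_max_right _ _) hpow (by positivity) (by positivity)
        _ = κ * ρ x ^ α := by rw [hκ]; ring
    obtain ⟨G, hG, hyG⟩ := Set.mem_iUnion₂.1 (h𝒢cov x hx hfy)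
    exact Set.mem_iUnion₂.2 ⟨G, Finset.mem_biUnion.2 ⟨x, hx, hG⟩, hyG⟩
  · intro G hG
    obtain ⟨x, hx, hGx⟩ := Finset.mem_biUnion.1 hG
    rw [h𝒢diam x hx G hGx, hscale, Real.rpow_mul hr.le]
    exact ⟨Real.rpow_le_rpow hr.le (le_min (hu x hx).2 (le_rpow_self_of_le_one hr hr1 hθ₁)) hα.le,
      Real.rpow_le_rpow (lt_min (hρ0 x hx) hrθ).le (min_le_right _ _) hα.le⟩
  · calc ∑ U ∈ u.biUnion 𝒢, Metric.diam U ^ (s / α)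
        ≤ ∑ x ∈ u, ∑ G ∈ 𝒢 x, Metric.diam G ^ (s / α) :=
          sum_biUnion_le_sum u 𝒢 fun x _ G _ => Real.rpow_nonneg Metric.diam_nonneg _
      _ ≤ ∑ x ∈ u, ((4 * m + 5) * κ) ^ m * (r ^ s * (radialKernel r θ s (m * α) (ρ x))⁻¹) := by
          refine Finset.sum_le_sum fun x hx => ?_
          rw [Finset.sum_congr rfl fun G hG => by rw [h𝒢diam x hx G hG], Finset.sum_const,
            nsmul_eq_mul, ← rpow_div_pow_mul_rpow_eq hα hr (hu x hx).2]
          refine (mul_le_mul_of_nonneg_right (h𝒢card x hx)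
            (Real.rpow_nonneg (hδ0 x hx).le _)).trans (le_of_eq ?_)
          rw [mul_div_assoc, ← mul_assoc, mul_pow, mul_assoc]
      _ = ((4 * m + 5) * κ) ^ m * r ^ s * ∑ x ∈ u, (radialKernel r θ s (m * α) (ρ x))⁻¹ := by
          rw [Finset.mul_sum]
          exact Finset.sum_congr rfl fun x _ => by ring
      _ ≤ ((4 * m + 5) * κ) ^ m * r ^ s *
          (2 ^ (m * α + 1) * (N + 1) * (profileCapacity r θ s (m * α) E).toReal) :=
          mul_le_mul_of_nonneg_left hsum (by positivity)
      _ = _ := by ring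

/-- The number of dyadic scales between `r` and `D` is smaller than any negative power of `r`. -/
theorem exists_two_pow_mul_ge {D η : ℝ} (hD : 1 ≤ D) (hη : 0 < η) :
    ∃ c : ℝ, 0 < c ∧ ∀ r : ℝ, 0 < r → r ≤ 1 →
      ∃ N : ℕ, D ≤ 2 ^ N * r ∧ (N : ℝ) + 1 ≤ c * r ^ (-η) := by
  have hl : 0 < Real.log 2 := Real.log_pos one_lt_two
  refine ⟨2 + D ^ η / η / Real.log 2, by positivity, fun r hr hr1 => ?_⟩
  have hDr : 1 ≤ D / r := (one_le_div hr).2 (hr1.trans hD)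
  obtain ⟨M, hM1, hM2⟩ := exists_nat_pow_near hDr one_lt_two
  refine ⟨M + 1, ((div_lt_iff₀ hr).1 hM2).le, ?_⟩
  have h1 : M * Real.log 2 ≤ (D / r) ^ η / η := by
    rw [← Real.log_pow]
    exact (Real.log_le_log (by positivity) hM1).trans (Real.log_le_rpow_div (by positivity) hη)
  rw [← le_div_iff₀ hl, Real.div_rpow (by linarith) hr.le] at h1
  have h2 : (1 : ℝ) ≤ r ^ (-η) := Real.one_le_rpow_of_pos_of_le_one_of_nonpos hr hr1 (by linarith)
  have h3 : D ^ η / r ^ η / η / Real.log 2 = D ^ η / η / Real.log 2 * r ^ (-η) := by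
    rw [Real.rpow_neg hr.le]; ring
  rw [h3] at h1
  push_cast
  linarith

/-- If `f` is Hölder of all orders below `α` on `E`, then at all small scales the image of `E` has
covers whose sums are bounded by the capacities of `E`. -/
theorem eventually_exists_isAdmissibleCover_image {n m : ℕ} (hm : 0 < m)
    {E : Set (EuclideanSpace ℝ (Fin n))} (hE : IsCompact E) (hne : E.Nonempty)
    {f : EuclideanSpace ℝ (Fin n) → EuclideanSpace ℝ (Fin m)} {α a K θ s η : ℝ}
    (ha : 0 < a) (haα : a ≤ α) (hf : ∀ x ∈ E, ∀ y ∈ E, ‖f x - f y‖ ≤ K * ‖x - y‖ ^ a)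
    (hθ₀ : 0 < θ) (hθ₁ : θ ≤ 1) (hs : 0 ≤ s) (hst : s ≤ m * α) (hη : 0 < η)
    (haη : m * (α - a) ≤ η / 3) :
    ∀ᶠ r in 𝓝[>] 0, ∃ 𝒰 : Finset (Set (EuclideanSpace ℝ (Fin m))),
      IsAdmissibleCover θ (s / α) (r ^ (θ * α))
        (r ^ (s - η) * (profileCapacity r θ s (m * α) E).toReal) (f '' E) 𝒰 := by
  obtain ⟨D, hD1, hD⟩ := exists_one_le_norm_sub_le hE
  obtain ⟨c, hc, hcN⟩ := exists_two_pow_mul_ge hD1 (by positivity : 0 < η / 3)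
  set Q : ℝ := ((4 * m + 5) * max 1 (|K| * 5 ^ a)) ^ m * 2 ^ (m * α + 1) * c with hQ
  have hQ0 : 0 < Q := by
    have : 0 < max 1 (|K| * 5 ^ a) := lt_max_of_lt_left one_pos
    positivity
  filter_upwards [eventually_nhdsGT_zero_lt one_pos,
    (tendsto_rpow_nhdsGT_zero (by positivity : 0 < η / 3)).eventually
      (eventually_nhdsGT_zero_lt (inv_pos.2 hQ0))] with r ⟨hr, hr1⟩ ⟨_, hrQ⟩
  obtain ⟨N, hN, hNc⟩ := hcN r hr hr1.le
  obtain ⟨𝒰, h𝒰⟩ := exists_isAdmissibleCover_image hm hE hne ha haα hf hθ₀ hθ₁ hr hr1.le hs hst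
    (N := N) fun x hx y hy => (hD x (subset_closure hx) y (subset_closure hy)).trans hN
  refine ⟨𝒰, h𝒰.mono ?_⟩
  have hmax : 0 < max 1 (|K| * 5 ^ a) := lt_max_of_lt_left one_pos
  have h1 : (r ^ (-(α - a))) ^ m ≤ r ^ (-(η / 3)) := by
    rw [← Real.rpow_natCast, ← Real.rpow_mul hr.le]
    exact Real.rpow_le_rpow_of_exponent_ge hr hr1.le (by linarith)
  have hη3 := Real.rpow_pos_of_pos hr (η / 3)
  have h2 : Q ≤ r ^ (-(η / 3)) := by
    rw [Real.rpow_neg hr.le]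
    exact (le_inv_comm₀ hη3 hQ0).1 hrQ.le
  calc ((4 * m + 5) * (max 1 (|K| * 5 ^ a) * r ^ (-(α - a)))) ^ m * 2 ^ (m * α + 1) * (N + 1) *
        (r ^ s * (profileCapacity r θ s (m * α) E).toReal)
      = ((4 * m + 5) * max 1 (|K| * 5 ^ a)) ^ m * 2 ^ (m * α + 1) * ((r ^ (-(α - a))) ^ m *
        (N + 1)) * (r ^ s * (profileCapacity r θ s (m * α) E).toReal) := by
        rw [← mul_assoc (4 * (m : ℝ) + 5), mul_pow _ (r ^ _)]; ring
    _ ≤ ((4 * m + 5) * max 1 (|K| * 5 ^ a)) ^ m * 2 ^ (m * α + 1) * (r ^ (-(η / 3)) *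
        (c * r ^ (-(η / 3)))) * (r ^ s * (profileCapacity r θ s (m * α) E).toReal) := by
        have := Real.rpow_pos_of_pos hr s
        gcongr
    _ = Q * (r ^ (-(η / 3)) * r ^ (-(η / 3)) * r ^ s *
        (profileCapacity r θ s (m * α) E).toReal) := by rw [hQ]; ring
    _ ≤ r ^ (-(η / 3)) * (r ^ (-(η / 3)) * r ^ (-(η / 3)) * r ^ s *
        (profileCapacity r θ s (m * α) E).toReal) := by
        refine mul_le_mul_of_nonneg_right h2 ?_
        positivity
    _ = _ := by
        rw [← mul_assoc, ← mul_assoc, ← mul_assoc, ← Real.rpow_add hr, ← Real.rpow_add hr,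
          ← Real.rpow_add hr]
        ring_nf

end ImageCover

/-! ### The dimensions of the image -/

section Main

variable {Ω : Type*} [MeasurableSpace Ω] {P : Measure Ω} {n m : ℕ} {α θ : ℝ}
  {B : EuclideanSpace ℝ (Fin n) → Ω → EuclideanSpace ℝ (Fin m)}
  {E : Set (EuclideanSpace ℝ (Fin n))} {s : ℝ}

/-- Almost surely, the lower bound on the sums over covers holds along exponents that increase to
`s`. -/
theorem IsFractionalBrownianMotion.ae_forall_lower_bound [SFinite P]
    (hB : IsFractionalBrownianMotion P α B) (hm : 0 < m) (hα₀ : 0 < α) (hθ₀ : 0 < θ) (hθ₁ : θ ≤ 1)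
    (hE : IsCompact E) (hne : E.Nonempty) (hst : s ≤ m * α) :
    ∀ᵐ ω ∂P, ∀ δ : ℝ, 0 < δ → ∃ s₁, s - δ < s₁ ∧ (0 ≤ s₁ → s₁ < s ∧ ∀ᶠ r in 𝓝[>] 0,
      ∀ (ε : ℝ) (𝒰 : Finset (Set (EuclideanSpace ℝ (Fin m)))),
        IsAdmissibleCover θ (s₁ / α) (r ^ (θ * α)) ε ((fun x => B x ω) '' E) 𝒰 →
        r ^ (s₁ + θ * (s - s₁) / 4) * (profileCapacity r θ s₁ (m * α) E).toReal ≤ ε) := by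
  have hpos : ∀ k : ℕ, (0 : ℝ) < 1 / ((k : ℝ) + 1) := fun k => by positivity
  have h : ∀ k : ℕ, ∀ᵐ ω ∂P, 0 ≤ s - 1 / ((k : ℝ) + 1) → ∀ᶠ r in 𝓝[>] 0,
      ∀ (ε : ℝ) (𝒰 : Finset (Set (EuclideanSpace ℝ (Fin m)))),
        IsAdmissibleCover θ ((s - 1 / ((k : ℝ) + 1)) / α) (r ^ (θ * α)) ε
          ((fun x => B x ω) '' E) 𝒰 →
        r ^ (s - 1 / ((k : ℝ) + 1) + θ * (s - (s - 1 / ((k : ℝ) + 1))) / 4) *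
          (profileCapacity r θ (s - 1 / ((k : ℝ) + 1)) (m * α) E).toReal ≤ ε := fun k => by
    by_cases hk : 0 ≤ s - 1 / ((k : ℝ) + 1)
    · have hη : 0 < θ * (s - (s - 1 / ((k : ℝ) + 1))) / 4 := by
        rw [sub_sub_cancel]
        have := hpos k
        positivity
      exact (hB.ae_eventually_rpow_mul_profileCapacity_le hm hα₀ hθ₀ hθ₁ hE hne hk
        (by linarith [hpos k]) hη).mono fun ω hω _ => hω
    · exact ae_of_all _ fun ω h => absurd h hk
  filter_upwards [ae_all_iff.2 h] with ω hω δ hδ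
  obtain ⟨k, hk⟩ := exists_nat_one_div_lt hδ
  exact ⟨s - 1 / ((k : ℝ) + 1), by linarith, fun h0 => ⟨by linarith [hpos k], hω k h0⟩⟩

/-- Almost surely, there are covers as in the upper bound, with an arbitrarily small loss. -/
theorem IsFractionalBrownianMotion.ae_forall_upper_bound
    (hB : IsFractionalBrownianMotion P α B) (hm : 0 < m) (hα₀ : 0 < α) (hθ₀ : 0 < θ) (hθ₁ : θ ≤ 1)
    (hE : IsCompact E) (hne : E.Nonempty) (hs : 0 ≤ s) (hst : s ≤ m * α) :
    ∀ᵐ ω ∂P, ∀ η : ℝ, 0 < η → ∀ᶠ r in 𝓝[>] 0,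
      ∃ 𝒰 : Finset (Set (EuclideanSpace ℝ (Fin m))), IsAdmissibleCover θ (s / α) (r ^ (θ * α))
        (r ^ (s - η) * (profileCapacity r θ s (m * α) E).toReal) ((fun x => B x ω) '' E) 𝒰 := by
  have hm' : (0 : ℝ) < m := by exact_mod_cast hm
  have h : ∀ k : ℕ, ∀ᵐ ω ∂P, ∃ K : ℝ, ∀ x ∈ E, ∀ y ∈ E,
      ‖B x ω - B y ω‖ ≤ K * ‖x - y‖ ^ (α - α / ((k : ℝ) + 2)) := fun k => by
    have h1 : α / ((k : ℝ) + 2) < α :=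
      div_lt_self hα₀ (by linarith [(Nat.cast_nonneg k : (0:ℝ) ≤ k)])
    have h2 : 0 < α / ((k : ℝ) + 2) := by positivity
    exact hB.ae_exists_holder hα₀ hE (by linarith) (by linarith)
  filter_upwards [ae_all_iff.2 h] with ω hω η hη
  obtain ⟨k, hk⟩ := exists_nat_gt (m * α / (η / 3))
  obtain ⟨K, hK⟩ := hω k
  have hk0 : (0 : ℝ) ≤ k := Nat.cast_nonneg k
  have h1 : α / ((k : ℝ) + 2) < α := div_lt_self hα₀ (by linarith)
  have h2 : 0 < α / ((k : ℝ) + 2) := by positivity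
  refine eventually_exists_isAdmissibleCover_image hm hE hne (by linarith) (by linarith) hK hθ₀ hθ₁
    hs hst hη ?_
  rw [div_lt_iff₀ (by positivity)] at hk
  rw [sub_sub_cancel, ← mul_div_assoc, div_le_iff₀ (by positivity)]
  nlinarith

end Main

theorem theorem3p3 {Ω : Type*} [MeasurableSpace Ω] (P : Measure Ω) [IsProbabilityMeasure P]
    {n m : ℕ} (hm : 0 < m) {α : ℝ} (hα₀ : 0 < α) (hα₁ : α < 1) {θ : ℝ} (hθ₀ : 0 < θ) (hθ₁ : θ ≤ 1)
    (B : EuclideanSpace ℝ (Fin n) → Ω → EuclideanSpace ℝ (Fin m))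
    (hB : IsFractionalBrownianMotion P α B)
    (E : Set (EuclideanSpace ℝ (Fin n))) (hE : IsCompact E) (hne : E.Nonempty) :
    (∃! s : ℝ, IsLowerProfile θ (m * α) E s) ∧
    (∃! s : ℝ, IsUpperProfile θ (m * α) E s) ∧
    ∀ᵐ ω ∂P,
      lowerIntermediateDim θ ((fun x => B x ω) '' E) = 1 / α * lowerDimProfile θ (m * α) E ∧
      upperIntermediateDim θ ((fun x => B x ω) '' E) = 1 / α * upperDimProfile θ (m * α) E := by
  have ht : 0 ≤ (m : ℝ) * α := by positivity
  have hlow : ∃! s : ℝ, IsLowerProfile θ (m * α) E s :=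
    isLimitFunctional_liminf.existsUnique_fixedPoint hE hne hθ₀ hθ₁ ht
  have hupp : ∃! s : ℝ, IsUpperProfile θ (m * α) E s :=
    isLimitFunctional_limsup.existsUnique_fixedPoint hE hne hθ₀ hθ₁ ht
  have hl : IsLowerProfile θ (m * α) E (lowerDimProfile θ (m * α) E) :=
    Classical.epsilon_spec hlow.exists
  have hu : IsUpperProfile θ (m * α) E (upperDimProfile θ (m * α) E) :=
    Classical.epsilon_spec hupp.exists
  refine ⟨hlow, hupp, ?_⟩
  filter_upwards [hB.ae_forall_lower_bound hm hα₀ hθ₀ hθ₁ hE hne hl.2.1,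
    hB.ae_forall_upper_bound hm hα₀ hθ₀ hθ₁ hE hne hl.1 hl.2.1,
    hB.ae_forall_lower_bound hm hα₀ hθ₀ hθ₁ hE hne hu.2.1,
    hB.ae_forall_upper_bound hm hα₀ hθ₀ hθ₁ hE hne hu.1 hu.2.1] with ω h1 h2 h3 h4
  rw [one_div_mul_eq_div, one_div_mul_eq_div]
  exact ⟨lowerIntermediateDim_eq_of_bounds hE hne hα₀ hθ₀ hθ₁ hl h1 h2,
    upperIntermediateDim_eq_of_bounds hE hne hα₀ hθ₀ hθ₁ hu h3 h4⟩
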